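/- **Setting.** Let $\mathfrak g=\mathcal A(K_4')=K(1,4)_+\oplus\mathbb C C$, where $K(1,4)_+=\mathbb C[t]\otimes\bigwedge(\xi_1,\dots,\xi_4)$ has the contact bracket $$[f,g]=\Big(2f-\sum_i\xi_i\partial_if\Big)\partial_tg-\partial_tf\Big(2g-\sum_i\xi_i\partial_ig\Big)+(-1)^{p(f)}\sum_i\partial_if\,\partial_ig ,$$ and $C$ is central, the extension being given by the 2-cocycle whose only nonzero values on the monomial basis, up to super skew-symmetry, are $\psi(1,\xi_{1234})=-2$ and $\psi(\xi_i,\partial_i\xi_{1234})=-1$. Grade $\mathfrak g$ by $\deg t^m\xi_I=2m+|I|-2$, $\deg C=0$. In $U(\mathfrak g_{<0})$ let $\eta_i$ be the image of $\xi_i$ and $$w_{11}=\eta_2+i\eta_1,\quad w_{22}=\eta_2-i\eta_1,\quad w_{12}=-\eta_4+i\eta_3,\quad w_{21}=\eta_4+i\eta_3 .$$ The semisimple part of $\mathfrak g_0$ is $\langle e_x,f_x,h_x\rangle\oplus\langle e_y,f_y,h_y\rangle\cong\mathfrak{sl}_2\oplus\mathfrak{sl}_2$ with $h_x=-i\xi_{12}+i\xi_{34}$,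 $h_y=-i\xi_{12}-i\xi_{34}$, $e_x=\frac12(-\xi_{13}-\xi_{24}-i\xi_{14}+i\xi_{23})$, $e_y=\frac12(-\xi_{13}+\xi_{24}+i\xi_{14}+i\xi_{23})$, $f_x=\frac12(\xi_{13}+\xi_{24}-i\xi_{14}+i\xi_{23})$, $f_y=\frac12(\xi_{13}-\xi_{24}+i\xi_{14}+i\xi_{23})$. Let $$V_A=\mathbb C[x_1,x_2,y_1,y_2],\quad V_B=\mathbb C[\partial_{x_1},\partial_{x_2},y_1,y_2]_{[1,-1]},\quad V_C=\mathbb C[\partial_{x_1},\partial_{x_2},\partial_{y_1},\partial_{y_2}]_{[2,0]},\quad V_D=\mathbb C[x_1,x_2,\partial_{y_1},\partial_{y_2}]_{[1,1]} .$$ Here $e_x,f_x,h_x$ act as the derivations $x_1\partial_{x_2}$, $x_2\partial_{x_1}$, $x_1\partial_{x_1}-x_2\partial_{x_2}$, with $x_i\partial_{x_j}.x_k=\delta_{jk}x_i$ and $x_i\partial_{x_j}.\partial_{x_k}=-\delta_{ik}\partial_{x_j}$ (similarly for $y$). With $E_x=\sum_jx_j\partial_{x_j}$ and $E_y=\sum_jy_j\partial_{y_j}$,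 on $V_{[i,j]}$ the element $t$ acts as $-\frac12(E_x+E_y)+i$ and $C$ as $\frac12(E_x-E_y)+j$ (both subscripts are $0$ for $V_A$), and $\mathfrak g_{>0}$ acts by $0$. Let $V_X^{m,n}$ be the subspace where $E_x=m$, $E_y=n$. Put $M_X=\mathrm{Ind}_{\mathfrak g_{\ge0}}^{\mathfrak g}V_X$, $M_X^{m,n}=\mathrm{Ind}_{\mathfrak g_{\ge0}}^{\mathfrak g}V_X^{m,n}$, $M_{X'}=\bigoplus_mM_X^{m,0}$, $M_{X''}=\bigoplus_nM_X^{0,n}$. For $u\in U(\mathfrak g_{<0})$ and $\phi\in\mathrm{Hom}(V_X,V_Y)$ put $(u\otimes\phi)(u'\otimes v)=u'u\otimes\phi(v)$. On $V_X$ the symbol $\partial_{x_j}$ denotes the derivation by $x_j$ for $X=A,D$ and the multiplication by $\partial_{x_j}$ for $X=B,C$; $\partial_{y_j}$ is the derivation by $y_j$ for $X=A,B$ and the multiplication by $\partial_{y_j}$ for $X=C,D$. Let $$\Delta^+=w_{11}\otimes\partial_{x_1}+w_{21}\otimes\partial_{x_2},\qquad \Delta^-=w_{12}\otimes\partial_{x_1}+w_{22}\otimes\partial_{x_2},$$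 $$\widetilde\Delta^+=w_{11}\otimes\partial_{y_1}+w_{12}\otimes\partial_{y_2},\qquad \widetilde\Delta^-=w_{21}\otimes\partial_{y_1}+w_{22}\otimes\partial_{y_2},$$ and let $\tau,\widetilde\tau,\tau_3$ denote identity maps on the underlying spaces of polynomials. **Statement.** For every $X$ and every $\mathfrak g_{\ge0}$-submodule $S$ of $V_X$ the canonical map $U(\mathfrak g_{<0})\otimes S\to\mathrm{Ind}_{\mathfrak g_{\ge0}}^{\mathfrak g}S$ is bijective; under this identification the following hold. 1. *Degree 1.* For $X=A,B,C,D$ the map $\nabla=\Delta^+\partial_{y_1}+\Delta^-\partial_{y_2}=\sum_{i,j}w_{ij}\otimes\partial_{x_i}\partial_{y_j}$ is a morphism of $\mathfrak g$-modules $M_X\to M_X$ and $M_X^{m,n}\to M_X^{m-1,n-1}$ for all $m,n\in\mathbb Z$, and $\nabla^2=0$. 2. *Degree 2.* For $(X,Y)=(A,D)$ and $(B,C)$ the map $$\nabla_2=\Delta^-\Delta^+\tau=w_{11}w_{12}\otimes\partial_{x_1}^2+(w_{11}w_{22}+w_{21}w_{12})\otimes\partial_{x_1}\partial_{x_2}+w_{21}w_{22}\otimes\partial_{x_2}^2$$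 is a morphism of $\mathfrak g$-modules $M_{X'}\to M_{Y'}$ and $M_X^{m,0}\to M_Y^{m-2,0}$ for all $m\in\mathbb Z$; moreover $\nabla\nabla_2=0$ on $M_{X'}$, and $\nabla_2\nabla=0$ on $M_X^{m,1}$ for all $m$. For $(X,Y)=(A,B)$ and $(D,C)$ the map $$\widetilde\nabla_2=\widetilde\Delta^-\widetilde\Delta^+\widetilde\tau=w_{11}w_{21}\otimes\partial_{y_1}^2+(w_{12}w_{21}+w_{11}w_{22})\otimes\partial_{y_1}\partial_{y_2}+w_{12}w_{22}\otimes\partial_{y_2}^2$$ is a morphism of $\mathfrak g$-modules $M_{X''}\to M_{Y''}$ and $M_X^{0,n}\to M_Y^{0,n-2}$ for all $n\in\mathbb Z$; moreover $\nabla\widetilde\nabla_2=0$ on $M_{X''}$, and $\widetilde\nabla_2\nabla=0$ on $M_X^{1,n}$ for all $n$. 3. *Degree 3.* The maps $\nabla_3:M_A^{0,1}\to M_C^{-1,0}$ and $\widetilde\nabla_3:M_A^{1,0}\to M_C^{0,-1}$, $$\nabla_3=\Delta^-\circ(w_{11}w_{21}\otimes\tau_3)\circ(1\otimes\partial_{y_1})+\Delta^-\circ((w_{12}w_{21}+w_{11}w_{22})\otimes\tau_3)\circ(1\otimes\partial_{y_2}),$$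 $$\widetilde\nabla_3=\widetilde\Delta^-\circ(w_{11}w_{12}\otimes\tau_3)\circ(1\otimes\partial_{x_1})+\widetilde\Delta^-\circ((w_{21}w_{12}+w_{11}w_{22})\otimes\tau_3)\circ(1\otimes\partial_{x_2}),$$ are morphisms of $\mathfrak g$-modules; $\nabla_3\nabla=0$ on $M_A^{1,2}$, $\nabla\nabla_3=0$ on $M_A^{0,1}$, $\widetilde\nabla_3\nabla=0$ on $M_A^{2,1}$ and $\nabla\widetilde\nabla_3=0$ on $M_A^{1,0}$. 4. *These are the morphisms determined by the highest weight singular vectors.* For $a,b\in\mathbb Z_{\ge0}$, in each line below the map is a $\mathfrak g$-morphism between the modules shown. It sends $1\otimes v$, where $v$ is the displayed monomial on the left, to the displayed nonzero multiple of the displayed vector. The vector $1\otimes v$ is a highest weight singular vector of degree $0$ of the source (nonzero and annihilated by $e_x,e_y,\mathfrak g_{>0}$). The displayed vector on the right (without the scalar factor in front) is a highest weight singular vector of the target, of degree $1$ for $\nabla$, $2$ for $\nabla_2,\widetilde\nabla_2$ and $3$ for $\nabla_3,\widetilde\nabla_3$. Both have the same weight with respect to $(h_x,h_y,t,C)$: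 if the source is $M_A^{m,n}$, $M_B^{-m,n}$, $M_C^{-m,-n}$ or $M_D^{m,-n}$ with $m,n\ge0$, this weight is respectively $(m,n,-\frac{m+n}2,\frac{m-n}2)$, $(m,n,1+\frac{m-n}2,-\frac{m+n}2-1)$, $(m,n,\frac{m+n}2+2,\frac{n-m}2)$, $(m,n,1+\frac{n-m}2,\frac{m+n}2+1)$. - $\nabla:M_A^{a+1,b+1}\to M_A^{a,b}$: $x_1^{a+1}y_1^{b+1}\mapsto(a+1)(b+1)\;w_{11}\otimes x_1^ay_1^b$. - $\nabla:M_B^{-a,b+1}\to M_B^{-a-1,b}$: $\partial_{x_2}^ay_1^{b+1}\mapsto(b+1)\,(w_{21}\otimes\partial_{x_2}^{a+1}y_1^b+w_{11}\otimes\partial_{x_1}\partial_{x_2}^ay_1^b)$. - $\nabla:M_C^{-a,-b}\to M_C^{-a-1,-b-1}$: $\partial_{x_2}^a\partial_{y_2}^b\mapsto w_{22}\otimes\partial_{x_2}^{a+1}\partial_{y_2}^{b+1}+w_{12}\otimes\partial_{x_1}\partial_{x_2}^a\partial_{y_2}^{b+1}+w_{21}\otimes\partial_{x_2}^{a+1}\partial_{y_1}\partial_{y_2}^b+w_{11}\otimes\partial_{x_1}\partial_{x_2}^a\partial_{y_1}\partial_{y_2}^b$.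 - $\nabla:M_D^{a+1,-b}\to M_D^{a,-b-1}$: $x_1^{a+1}\partial_{y_2}^b\mapsto(a+1)\,(w_{12}\otimes x_1^a\partial_{y_2}^{b+1}+w_{11}\otimes x_1^a\partial_{y_1}\partial_{y_2}^b)$. - $\nabla_2:M_A^{a+2,0}\to M_D^{a,0}$: $x_1^{a+2}\mapsto(a+2)(a+1)\;w_{11}w_{12}\otimes x_1^a$. - $\nabla_2:M_B^{-a,0}\to M_C^{-a-2,0}$: $\partial_{x_2}^a\mapsto w_{21}w_{22}\otimes\partial_{x_2}^{a+2}+(w_{11}w_{22}+w_{21}w_{12})\otimes\partial_{x_1}\partial_{x_2}^{a+1}+w_{11}w_{12}\otimes\partial_{x_1}^2\partial_{x_2}^a$. - $\widetilde\nabla_2:M_A^{0,b+2}\to M_B^{0,b}$: $y_1^{b+2}\mapsto(b+2)(b+1)\;w_{11}w_{21}\otimes y_1^b$. - $\widetilde\nabla_2:M_D^{0,-b}\to M_C^{0,-b-2}$: $\partial_{y_2}^b\mapsto w_{12}w_{22}\otimes\partial_{y_2}^{b+2}+(w_{11}w_{22}+w_{12}w_{21})\otimes\partial_{y_1}\partial_{y_2}^{b+1}+w_{11}w_{21}\otimes\partial_{y_1}^2\partial_{y_2}^b$.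 - $\nabla_3:M_A^{0,1}\to M_C^{-1,0}$: $y_1\mapsto-(w_{11}w_{22}w_{21}\otimes\partial_{x_2}-w_{21}w_{12}w_{11}\otimes\partial_{x_1})$. - $\widetilde\nabla_3:M_A^{1,0}\to M_C^{0,-1}$: $x_1\mapsto-(w_{11}w_{22}w_{12}\otimes\partial_{y_2}-w_{12}w_{21}w_{11}\otimes\partial_{y_1})$. -/

import Mathlib

open scoped TensorProduct

noncomputable section

namespace KFour

/-! # The Lie superalgebra `𝔤 = K(1,4)₊ ⊕ ℂ C` -/

/-- `K(1,4)₊ ≅ ℂ[t] ⊗ Λ(ξ₁,…,ξ₄)`; the basis vector with index `(m, I)` is `t^m ξ_I`, where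
`ξ_I = ξ_{i₁} ⋯ ξ_{i_r}` for `I = {i₁ < ⋯ < i_r}`.  The indices `1,2,3,4` are `0,1,2,3 : Fin 4`. -/
abbrev KPlus : Type := (ℕ × Finset (Fin 4)) →₀ ℂ

/-- The monomial `t^m ξ_I`. -/
def mono (m : ℕ) (I : Finset (Fin 4)) : KPlus := Finsupp.single (m, I) 1

/-- `ξ_I ξ_J = grSign I J • ξ_{I ∪ J}`. -/
def grSign (I J : Finset (Fin 4)) : ℂ :=
  if Disjoint I J then (-1) ^ ((I ×ˢ J).filter (fun p => p.2 < p.1)).card else 0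

/-- The product of `ℂ[t] ⊗ Λ(4)`. -/
def grMul : KPlus →ₗ[ℂ] KPlus →ₗ[ℂ] KPlus :=
  Finsupp.linearCombination ℂ fun a =>
    Finsupp.linearCombination ℂ fun b => grSign a.2 b.2 • mono (a.1 + b.1) (a.2 ∪ b.2)

/-- The derivation `∂_t`. -/
def dT : KPlus →ₗ[ℂ] KPlus :=
  Finsupp.linearCombination ℂ fun a => (a.1 : ℂ) • mono (a.1 - 1) a.2

/-- The odd (left) derivation `∂_i = ∂/∂ξ_i`. -/
def dXi (i : Fin 4) : KPlus →ₗ[ℂ] KPlus :=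
  Finsupp.linearCombination ℂ fun a =>
    if i ∈ a.2 then ((-1 : ℂ) ^ (a.2.filter (fun j => j < i)).card) • mono a.1 (a.2.erase i) else 0

/-- The parity involution `f ↦ (-1)^{p(f)} f`. -/
def parInv : KPlus →ₗ[ℂ] KPlus :=
  Finsupp.linearCombination ℂ fun a => ((-1 : ℂ) ^ a.2.card) • mono a.1 a.2

/-- `f ↦ 2 f - ∑ ξ_i ∂_i f`. -/
def twoSubEuler (f : KPlus) : KPlus := (2 : ℂ) • f - ∑ i, grMul (mono 0 {i}) (dXi i f)

/-- The contact bracket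
`[f,g] = (2f - ∑ ξ_i ∂_i f)(∂_t g) - (∂_t f)(2g - ∑ ξ_i ∂_i g) + (-1)^{p(f)} ∑ ∂_i f ∂_i g`. -/
def contactBr (f g : KPlus) : KPlus :=
  grMul (twoSubEuler f) (dT g) - grMul (dT f) (twoSubEuler g)
    + ∑ i, grMul (dXi i (parInv f)) (dXi i g)

/-- The values `ψ(1, ξ₁₂₃₄) = -2` and `ψ(ξ_i, ∂_i ξ₁₂₃₄) = -1` of the cocycle; note that
`∂_i ξ₁₂₃₄ = (-1)^i ξ_{{i}ᶜ}` for `i : Fin 4`. -/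
def cocycleHalf (a b : ℕ × Finset (Fin 4)) : ℂ :=
  (if a = (0, ∅) ∧ b = (0, Finset.univ) then -2 else 0)
    + ∑ i : Fin 4, if a = (0, {i}) ∧ b = (0, {i}ᶜ) then -(-1) ^ (i : ℕ) else 0

/-- The 2-cocycle `ψ`: the super skew-symmetric bilinear extension of `cocycleHalf`. -/
def cocycle : KPlus →ₗ[ℂ] KPlus →ₗ[ℂ] ℂ :=
  Finsupp.linearCombination ℂ fun a => Finsupp.linearCombination ℂ fun b =>
    cocycleHalf a b - (-1) ^ (a.2.card * b.2.card) * cocycleHalf b a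

/-- `𝔤 = K(1,4)₊ ⊕ ℂ C`; the second coordinate is the coefficient of `C`. -/
abbrev G : Type := KPlus × ℂ

/-- The bracket of the central extension. -/
def lieBr (x y : G) : G := (contactBr x.1 y.1, cocycle x.1 y.1)

/-- `ξ_I`, as an element of `𝔤`. -/
def xi (I : Finset (Fin 4)) : G := (mono 0 I, 0)

/-- The grading element `t`. -/
def tG : G := (mono 1 ∅, 0)

/-- The central element `C`. -/
def cG : G := (0, 1)

/-- The part of `𝔤` of parity `p`. -/
def parPart (p : Fin 2) : Submodule ℂ G :=
  (Finsupp.supported ℂ ℂ {a : ℕ × Finset (Fin 4) | a.2.card % 2 = (p : ℕ)}).prod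
    (if p = 0 then ⊤ else ⊥)

/-- `deg (t^m ξ_I) = 2m + |I| - 2`; the degree of `C` is `0`. -/
def degB (a : ℕ × Finset (Fin 4)) : ℤ := 2 * a.1 + a.2.card - 2

/-- `𝔤_{≥ 0}`. -/
def gGe : Submodule ℂ G := (Finsupp.supported ℂ ℂ {a | 0 ≤ degB a}).prod ⊤

/-- `𝔤_{> 0}`. -/
def gPos : Submodule ℂ G := (Finsupp.supported ℂ ℂ {a | 0 < degB a}).prod ⊥

/-- `𝔤_{< 0}`. -/
def gNeg : Submodule ℂ G := (Finsupp.supported ℂ ℂ {a | degB a < 0}).prod ⊥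

/-! The Chevalley generators of the semisimple part of `𝔤₀`. -/

def hX : G := -Complex.I • xi {0, 1} + Complex.I • xi {2, 3}

def hY : G := -Complex.I • xi {0, 1} - Complex.I • xi {2, 3}

def eX : G := (1 / 2 : ℂ) •
  (-xi {0, 2} - xi {1, 3} - Complex.I • xi {0, 3} + Complex.I • xi {1, 2})

def eY : G := (1 / 2 : ℂ) •
  (-xi {0, 2} + xi {1, 3} + Complex.I • xi {0, 3} + Complex.I • xi {1, 2})

def fX : G := (1 / 2 : ℂ) •
  (xi {0, 2} + xi {1, 3} - Complex.I • xi {0, 3} + Complex.I • xi {1, 2})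

def fY : G := (1 / 2 : ℂ) •
  (xi {0, 2} - xi {1, 3} + Complex.I • xi {0, 3} + Complex.I • xi {1, 2})

/-! # Enveloping algebra and induced modules -/

/-- The defining relations `x y - (-1)^{p(x)p(y)} y x = [x, y]` of the enveloping algebra. -/
inductive URel : TensorAlgebra ℂ G → TensorAlgebra ℂ G → Prop
  | comm {p q : Fin 2} {x y : G} (hx : x ∈ parPart p) (hy : y ∈ parPart q) :
      URel (TensorAlgebra.ι ℂ x * TensorAlgebra.ι ℂ y)
        (((-1 : ℂ) ^ ((p : ℕ) * (q : ℕ))) • (TensorAlgebra.ι ℂ y * TensorAlgebra.ι ℂ x)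
          + TensorAlgebra.ι ℂ (lieBr x y))

/-- The universal enveloping algebra `U(𝔤)` of the Lie superalgebra `𝔤`. -/
def U : Type := RingQuot URel

instance : Ring U := inferInstanceAs (Ring (RingQuot URel))

instance : Algebra ℂ U := inferInstanceAs (Algebra ℂ (RingQuot URel))

/-- The canonical map `𝔤 → U(𝔤)`. -/
def iota : G →ₗ[ℂ] U :=
  (show TensorAlgebra ℂ G →ₐ[ℂ] U from RingQuot.mkAlgHom ℂ URel).toLinearMap ∘ₗ TensorAlgebra.ι ℂ

/-- `U(𝔤_{<0})`, as the subalgebra of `U(𝔤)` generated by `𝔤_{<0}`. -/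
def UNeg : Subalgebra ℂ U := Algebra.adjoin ℂ (iota '' gNeg)

/-- `η_i`, the image of `ξ_i` in `U(𝔤_{<0})`. -/
def eta (i : Fin 4) : UNeg :=
  ⟨iota (xi {i}), Algebra.subset_adjoin ⟨xi {i}, by
    refine ⟨?_, by simp [xi]⟩
    simpa [xi, mono] using Finsupp.single_mem_supported ℂ (1 : ℂ)
      (show ((0, {i}) : ℕ × Finset (Fin 4)) ∈ {a | degB a < 0} by simp [degB]), rfl⟩⟩

def w11 : UNeg := eta 1 + Complex.I • eta 0
def w22 : UNeg := eta 1 - Complex.I • eta 0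
def w12 : UNeg := -eta 3 + Complex.I • eta 2
def w21 : UNeg := eta 3 + Complex.I • eta 2

/-- The homogeneous part of degree `d` of `U(𝔤_{<0})`, with the sign of the degree inverted: the
span of the products of basis vectors of `𝔤_{<0}` with degrees adding up to `-d`. -/
def UNegDeg (d : ℕ) : Submodule ℂ UNeg :=
  Submodule.span ℂ {u | ∃ l : List (ℕ × Finset (Fin 4)), (∀ a ∈ l, degB a < 0) ∧
    (l.map degB).sum = -(d : ℤ) ∧ (u : U) = (l.map fun a => iota (mono a.1 a.2, 0)).prod}

section Induced

variable {F : Type} [AddCommGroup F] [Module ℂ F]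

/-- The relations `u x ⊗ v = u ⊗ x.v`, for `x ∈ 𝔤_{≥0}`. -/
def indRel (rho : gGe →ₗ[ℂ] Module.End ℂ F) : Submodule U (U ⊗[ℂ] F) :=
  Submodule.span U {z | ∃ (u : U) (x : gGe) (v : F),
    z = (u * iota (x : G)) ⊗ₜ[ℂ] v - u ⊗ₜ[ℂ] (rho x v)}

/-- The induced module `Ind F = U(𝔤) ⊗_{U(𝔤_{≥0})} F`, where `𝔤_{≥0}` acts on `F` by `rho`: since
`U(𝔤_{≥0})` is generated by `𝔤_{≥0}`, it is the quotient of `U(𝔤) ⊗_ℂ F` by `indRel`. -/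
abbrev Ind (rho : gGe →ₗ[ℂ] Module.End ℂ F) : Type := (U ⊗[ℂ] F) ⧸ indRel rho

/-- The canonical map `U(𝔤_{<0}) ⊗ F → Ind F`, `u ⊗ v ↦ u ⊗ v`. -/
def pbwInd (rho : gGe →ₗ[ℂ] Module.End ℂ F) : (UNeg ⊗[ℂ] F) →ₗ[ℂ] Ind rho :=
  ((indRel rho).mkQ.restrictScalars ℂ) ∘ₗ TensorProduct.map UNeg.val.toLinearMap LinearMap.id

end Induced

/-! # The `𝔤₀`-modules `V_X` -/

/-- The four quadrants. -/
inductive Quadrant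
  | A | B | C | D

/-- Whether the first pair of letters is `∂_{x₁}, ∂_{x₂}` (quadrants B, C) or `x₁, x₂`. -/
def Quadrant.xDual : Quadrant → Bool
  | .A => false | .B => true | .C => true | .D => false

/-- Whether the second pair of letters is `∂_{y₁}, ∂_{y₂}` (quadrants C, D) or `y₁, y₂`. -/
def Quadrant.yDual : Quadrant → Bool
  | .A => false | .B => false | .C => true | .D => true

/-- The first entry of the subscript `[i, j]`. -/
def Quadrant.tShift : Quadrant → ℂ
  | .A => 0 | .B => 1 | .C => 2 | .D => 1

/-- The second entry of the subscript `[i, j]`. -/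
def Quadrant.cShift : Quadrant → ℂ
  | .A => 0 | .B => -1 | .C => 0 | .D => 1

/-- The space underlying every `V_X`: the polynomials in four letters.  The letter `inl j` is `x_j`
or `∂_{x_j}` and the letter `inr j` is `y_j` or `∂_{y_j}`, according to the quadrant `X`. The
indices `1,2` are `0,1 : Fin 2`. -/
abbrev V : Type := MvPolynomial (Fin 2 ⊕ Fin 2) ℂ

/-- The first pair of letters, `x_j` or `∂_{x_j}`. -/
def lx (j : Fin 2) : V := MvPolynomial.X (Sum.inl j)

/-- The second pair of letters, `y_j` or `∂_{y_j}`. -/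
def ly (j : Fin 2) : V := MvPolynomial.X (Sum.inr j)

/-- The action of `x_i ∂_{x_j}` on `V_X`: the derivation with `x_i ∂_{x_j} x_k = δ_{jk} x_i` or
`x_i ∂_{x_j}.∂_{x_k} = -δ_{ik} ∂_{x_j}`, which annihilates the letters of the second pair. -/
def glX (q : Quadrant) (i j : Fin 2) : Derivation ℂ V V :=
  MvPolynomial.mkDerivation ℂ (Sum.elim
    (fun k => if q.xDual then (if i = k then -lx j else 0) else (if j = k then lx i else 0))
    (fun _ => 0))

/-- The action of `y_i ∂_{y_j}` on `V_X`. -/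
def glY (q : Quadrant) (i j : Fin 2) : Derivation ℂ V V :=
  MvPolynomial.mkDerivation ℂ (Sum.elim
    (fun _ => 0)
    (fun k => if q.yDual then (if i = k then -ly j else 0) else (if j = k then ly i else 0)))

/-- `x₁∂_{x₁} + x₂∂_{x₂}` on `V_X`. -/
def eulX (q : Quadrant) : Derivation ℂ V V := glX q 0 0 + glX q 1 1

/-- `y₁∂_{y₁} + y₂∂_{y₂}` on `V_X`. -/
def eulY (q : Quadrant) : Derivation ℂ V V := glY q 0 0 + glY q 1 1

/-- `x₁∂_{x₁} - x₂∂_{x₂}` on `V_X`. -/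
def cartX (q : Quadrant) : Derivation ℂ V V := glX q 0 0 - glX q 1 1

/-- `y₁∂_{y₁} - y₂∂_{y₂}` on `V_X`. -/
def cartY (q : Quadrant) : Derivation ℂ V V := glY q 0 0 - glY q 1 1

/-- The action of `t`. -/
def actT (q : Quadrant) : Module.End ℂ V :=
  (-1 / 2 : ℂ) • ((eulX q).toLinearMap + (eulY q).toLinearMap) + q.tShift • LinearMap.id

/-- The action of `C`. -/
def actC (q : Quadrant) : Module.End ℂ V :=
  (1 / 2 : ℂ) • (eulX q).toLinearMap - (1 / 2 : ℂ) • (eulY q).toLinearMap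
    + q.cShift • LinearMap.id

/-- The action of `ξ_{ij}`, obtained by solving the definitions of `e_x, f_x, h_x, e_y, f_y, h_y`
for the `ξ_{ij}` (see `act_eX` and the following facts), and `0` for the other `ξ_I`. -/
def actXi (q : Quadrant) (I : Finset (Fin 4)) : Derivation ℂ V V :=
  if I = {0, 1} then (Complex.I / 2) • (cartX q + cartY q)
  else if I = {2, 3} then (-Complex.I / 2) • (cartX q - cartY q)
  else if I = {0, 2} then (1 / 2 : ℂ) • (glX q 1 0 + glY q 1 0 - glX q 0 1 - glY q 0 1)
  else if I = {1, 3} then (1 / 2 : ℂ) • (glX q 1 0 - glY q 1 0 - glX q 0 1 + glY q 0 1)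
  else if I = {0, 3} then (Complex.I / 2) • (glX q 0 1 - glY q 0 1 + glX q 1 0 - glY q 1 0)
  else if I = {1, 2} then (-Complex.I / 2) • (glX q 0 1 + glY q 0 1 + glX q 1 0 + glY q 1 0)
  else 0

/-- The action on `V_X` of the basis vector `t^m ξ_I`; it is `0` unless the degree is `0`. -/
def actB (q : Quadrant) (a : ℕ × Finset (Fin 4)) : Module.End ℂ V :=
  if a = (1, ∅) then actT q else if a.1 = 0 then (actXi q a.2).toLinearMap else 0

/-- The action of `𝔤_{≥0}` on `V_X`, with `𝔤_{>0}` acting trivially (only the restriction of this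
linear map to `𝔤_{≥0}` is used below). -/
def act (q : Quadrant) : G →ₗ[ℂ] Module.End ℂ V :=
  LinearMap.coprod (Finsupp.linearCombination ℂ (actB q)) (LinearMap.toSpanSingleton ℂ _ (actC q))

theorem act_xi (q : Quadrant) (I : Finset (Fin 4)) : act q (xi I) = (actXi q I).toLinearMap := by
  simp [act, xi, mono, actB]

theorem act_tG (q : Quadrant) : act q tG = actT q := by
  simp [act, tG, mono, actB]

theorem act_cG (q : Quadrant) : act q cG = actC q := by
  simp [act, cG]

theorem actXi_01 (q : Quadrant) : actXi q {0, 1} = (Complex.I / 2) • (cartX q + cartY q) := by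
  rw [actXi, if_pos rfl]

theorem actXi_23 (q : Quadrant) : actXi q {2, 3} = (-Complex.I / 2) • (cartX q - cartY q) := by
  rw [actXi, if_neg (by decide), if_pos rfl]

theorem actXi_02 (q : Quadrant) : actXi q {0, 2} =
    (1 / 2 : ℂ) • (glX q 1 0 + glY q 1 0 - glX q 0 1 - glY q 0 1) := by
  rw [actXi, if_neg (by decide), if_neg (by decide), if_pos rfl]

theorem actXi_13 (q : Quadrant) : actXi q {1, 3} =
    (1 / 2 : ℂ) • (glX q 1 0 - glY q 1 0 - glX q 0 1 + glY q 0 1) := by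
  rw [actXi, if_neg (by decide), if_neg (by decide), if_neg (by decide), if_pos rfl]

theorem actXi_03 (q : Quadrant) : actXi q {0, 3} =
    (Complex.I / 2) • (glX q 0 1 - glY q 0 1 + glX q 1 0 - glY q 1 0) := by
  rw [actXi, if_neg (by decide), if_neg (by decide), if_neg (by decide), if_neg (by decide),
    if_pos rfl]

theorem actXi_12 (q : Quadrant) : actXi q {1, 2} =
    (-Complex.I / 2) • (glX q 0 1 + glY q 0 1 + glX q 1 0 + glY q 1 0) := by
  rw [actXi, if_neg (by decide), if_neg (by decide), if_neg (by decide), if_neg (by decide),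
    if_neg (by decide), if_pos rfl]

/-! The Chevalley generators act as `x₁∂_{x₂}, x₂∂_{x₁}, x₁∂_{x₁} - x₂∂_{x₂}` and
`y₁∂_{y₂}, y₂∂_{y₁}, y₁∂_{y₁} - y₂∂_{y₂}`. -/

set_option linter.unusedSimpArgs false

theorem act_eX (q : Quadrant) : act q eX = (glX q 0 1).toLinearMap := by
  refine LinearMap.ext fun v => ?_
  simp only [eX, cartX, cartY, map_smul, map_add, map_sub, map_neg, act_xi, actXi_01, actXi_23,
    actXi_02, actXi_13, actXi_03, actXi_12, LinearMap.smul_apply, LinearMap.add_apply,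
    LinearMap.sub_apply, LinearMap.neg_apply, Derivation.coeFn_coe, Derivation.smul_apply,
    Derivation.add_apply, Derivation.sub_apply]
  match_scalars <;> ring_nf <;> norm_num [Complex.I_sq]

theorem act_fX (q : Quadrant) : act q fX = (glX q 1 0).toLinearMap := by
  refine LinearMap.ext fun v => ?_
  simp only [fX, cartX, cartY, map_smul, map_add, map_sub, map_neg, act_xi, actXi_01, actXi_23,
    actXi_02, actXi_13, actXi_03, actXi_12, LinearMap.smul_apply, LinearMap.add_apply,
    LinearMap.sub_apply, LinearMap.neg_apply, Derivation.coeFn_coe, Derivation.smul_apply,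
    Derivation.add_apply, Derivation.sub_apply]
  match_scalars <;> ring_nf <;> norm_num [Complex.I_sq]

theorem act_hX (q : Quadrant) : act q hX = (cartX q).toLinearMap := by
  refine LinearMap.ext fun v => ?_
  simp only [hX, cartX, cartY, map_smul, map_add, map_sub, map_neg, act_xi, actXi_01, actXi_23,
    actXi_02, actXi_13, actXi_03, actXi_12, LinearMap.smul_apply, LinearMap.add_apply,
    LinearMap.sub_apply, LinearMap.neg_apply, Derivation.coeFn_coe, Derivation.smul_apply,
    Derivation.add_apply, Derivation.sub_apply]
  match_scalars <;> ring_nf <;> norm_num [Complex.I_sq]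

theorem act_eY (q : Quadrant) : act q eY = (glY q 0 1).toLinearMap := by
  refine LinearMap.ext fun v => ?_
  simp only [eY, cartX, cartY, map_smul, map_add, map_sub, map_neg, act_xi, actXi_01, actXi_23,
    actXi_02, actXi_13, actXi_03, actXi_12, LinearMap.smul_apply, LinearMap.add_apply,
    LinearMap.sub_apply, LinearMap.neg_apply, Derivation.coeFn_coe, Derivation.smul_apply,
    Derivation.add_apply, Derivation.sub_apply]
  match_scalars <;> ring_nf <;> norm_num [Complex.I_sq]

theorem act_fY (q : Quadrant) : act q fY = (glY q 1 0).toLinearMap := by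
  refine LinearMap.ext fun v => ?_
  simp only [fY, cartX, cartY, map_smul, map_add, map_sub, map_neg, act_xi, actXi_01, actXi_23,
    actXi_02, actXi_13, actXi_03, actXi_12, LinearMap.smul_apply, LinearMap.add_apply,
    LinearMap.sub_apply, LinearMap.neg_apply, Derivation.coeFn_coe, Derivation.smul_apply,
    Derivation.add_apply, Derivation.sub_apply]
  match_scalars <;> ring_nf <;> norm_num [Complex.I_sq]

theorem act_hY (q : Quadrant) : act q hY = (cartY q).toLinearMap := by
  refine LinearMap.ext fun v => ?_
  simp only [hY, cartX, cartY, map_smul, map_add, map_sub, map_neg, act_xi, actXi_01, actXi_23,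
    actXi_02, actXi_13, actXi_03, actXi_12, LinearMap.smul_apply, LinearMap.add_apply,
    LinearMap.sub_apply, LinearMap.neg_apply, Derivation.coeFn_coe, Derivation.smul_apply,
    Derivation.add_apply, Derivation.sub_apply]
  match_scalars <;> ring_nf <;> norm_num [Complex.I_sq]

/-! # Verma modules -/

theorem eulX_X (q : Quadrant) (k : Fin 2 ⊕ Fin 2) : eulX q (MvPolynomial.X k) =
    (Sum.elim (fun _ => if q.xDual then (-1 : ℂ) else 1) (fun _ => 0) k) • MvPolynomial.X k := by
  rcases k with k | k
  · fin_cases k <;> cases h : q.xDual <;> simp [eulX, glX, MvPolynomial.mkDerivation_X, lx, h]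
  · simp [eulX, glX, MvPolynomial.mkDerivation_X]

theorem eulY_X (q : Quadrant) (k : Fin 2 ⊕ Fin 2) : eulY q (MvPolynomial.X k) =
    (Sum.elim (fun _ => 0) (fun _ => if q.yDual then (-1 : ℂ) else 1) k) • MvPolynomial.X k := by
  rcases k with k | k
  · simp [eulY, glY, MvPolynomial.mkDerivation_X]
  · fin_cases k <;> cases h : q.yDual <;> simp [eulY, glY, MvPolynomial.mkDerivation_X, ly, h]

theorem eulX_comm_glX (q : Quadrant) (i j : Fin 2) : ⁅eulX q, glX q i j⁆ = 0 := by
  refine MvPolynomial.derivation_ext fun k => ?_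
  rw [Derivation.commutator_apply, eulX_X]
  rcases k with k | k
  · cases h : q.xDual <;> by_cases h1 : i = k <;> by_cases h2 : j = k <;>
      simp [glX, MvPolynomial.mkDerivation_X, lx, eulX_X, h, h1, h2]
  · simp [glX, MvPolynomial.mkDerivation_X]

theorem eulX_comm_glY (q : Quadrant) (i j : Fin 2) : ⁅eulX q, glY q i j⁆ = 0 := by
  refine MvPolynomial.derivation_ext fun k => ?_
  rw [Derivation.commutator_apply, eulX_X]
  rcases k with k | k
  · cases h : q.xDual <;> simp [glY, MvPolynomial.mkDerivation_X, h]
  · cases h : q.yDual <;> by_cases h1 : i = k <;> by_cases h2 : j = k <;>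
      simp [glY, MvPolynomial.mkDerivation_X, ly, eulX_X, h, h1, h2]

theorem eulY_comm_glX (q : Quadrant) (i j : Fin 2) : ⁅eulY q, glX q i j⁆ = 0 := by
  refine MvPolynomial.derivation_ext fun k => ?_
  rw [Derivation.commutator_apply, eulY_X]
  rcases k with k | k
  · cases h : q.xDual <;> by_cases h1 : i = k <;> by_cases h2 : j = k <;>
      simp [glX, MvPolynomial.mkDerivation_X, lx, eulY_X, h, h1, h2]
  · cases h : q.yDual <;> simp [glX, MvPolynomial.mkDerivation_X, h]

theorem eulY_comm_glY (q : Quadrant) (i j : Fin 2) : ⁅eulY q, glY q i j⁆ = 0 := by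
  refine MvPolynomial.derivation_ext fun k => ?_
  rw [Derivation.commutator_apply, eulY_X]
  rcases k with k | k
  · simp [glY, MvPolynomial.mkDerivation_X]
  · cases h : q.yDual <;> by_cases h1 : i = k <;> by_cases h2 : j = k <;>
      simp [glY, MvPolynomial.mkDerivation_X, ly, eulY_X, h, h1, h2]

/-- `V_X^{m,n}`, as a subspace of `V_X`. -/
def bidegSpace (q : Quadrant) (m n : ℤ) : Submodule ℂ V where
  carrier := {f | eulX q f = (m : ℂ) • f ∧ eulY q f = (n : ℂ) • f}
  add_mem' := by
    rintro a b ⟨ha, ha'⟩ ⟨hb, hb'⟩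
    exact ⟨by rw [map_add, ha, hb, smul_add], by rw [map_add, ha', hb', smul_add]⟩
  zero_mem' := by simp
  smul_mem' := by
    rintro c a ⟨ha, ha'⟩
    exact ⟨by rw [Derivation.map_smul, ha, smul_comm], by rw [Derivation.map_smul, ha', smul_comm]⟩

/-- A derivation commuting with the two Euler operators preserves `V_X^{m,n}`. -/
theorem derivation_mem (q : Quadrant) (m n : ℤ) (D : Derivation ℂ V V) (hx : ⁅eulX q, D⁆ = 0)
    (hy : ⁅eulY q, D⁆ = 0) {f : V} (hf : f ∈ bidegSpace q m n) : D f ∈ bidegSpace q m n := by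
  obtain ⟨h1, h2⟩ := hf
  have e1 := congrArg (fun E : Derivation ℂ V V => E f) hx
  have e2 := congrArg (fun E : Derivation ℂ V V => E f) hy
  simp only [Derivation.commutator_apply, Derivation.zero_apply, sub_eq_zero] at e1 e2
  exact ⟨by rw [e1, h1, Derivation.map_smul], by rw [e2, h2, Derivation.map_smul]⟩

theorem glX_mem (q : Quadrant) (m n : ℤ) (i j : Fin 2) {f : V} (hf : f ∈ bidegSpace q m n) :
    glX q i j f ∈ bidegSpace q m n :=
  derivation_mem q m n _ (eulX_comm_glX q i j) (eulY_comm_glX q i j) hf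

theorem glY_mem (q : Quadrant) (m n : ℤ) (i j : Fin 2) {f : V} (hf : f ∈ bidegSpace q m n) :
    glY q i j f ∈ bidegSpace q m n :=
  derivation_mem q m n _ (eulX_comm_glY q i j) (eulY_comm_glY q i j) hf

theorem actXi_mem (q : Quadrant) (m n : ℤ) (I : Finset (Fin 4)) {f : V}
    (hf : f ∈ bidegSpace q m n) : actXi q I f ∈ bidegSpace q m n := by
  have hX := fun i j => glX_mem q m n i j hf
  have hY := fun i j => glY_mem q m n i j hf
  have hcX : cartX q f ∈ bidegSpace q m n := Submodule.sub_mem _ (hX 0 0) (hX 1 1)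
  have hcY : cartY q f ∈ bidegSpace q m n := Submodule.sub_mem _ (hY 0 0) (hY 1 1)
  unfold actXi
  split_ifs
  · exact Submodule.smul_mem _ _ (Submodule.add_mem _ hcX hcY)
  · exact Submodule.smul_mem _ _ (Submodule.sub_mem _ hcX hcY)
  · exact Submodule.smul_mem _ _ (Submodule.sub_mem _ (Submodule.sub_mem _
      (Submodule.add_mem _ (hX 1 0) (hY 1 0)) (hX 0 1)) (hY 0 1))
  · exact Submodule.smul_mem _ _ (Submodule.add_mem _ (Submodule.sub_mem _
      (Submodule.sub_mem _ (hX 1 0) (hY 1 0)) (hX 0 1)) (hY 0 1))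
  · exact Submodule.smul_mem _ _ (Submodule.sub_mem _ (Submodule.add_mem _
      (Submodule.sub_mem _ (hX 0 1) (hY 0 1)) (hX 1 0)) (hY 1 0))
  · exact Submodule.smul_mem _ _ (Submodule.add_mem _ (Submodule.add_mem _
      (Submodule.add_mem _ (hX 0 1) (hY 0 1)) (hX 1 0)) (hY 1 0))
  · exact Submodule.zero_mem _

theorem act_mem (q : Quadrant) (m n : ℤ) (x : G) {f : V} (hf : f ∈ bidegSpace q m n) :
    act q x f ∈ bidegSpace q m n := by
  have hX : eulX q f ∈ bidegSpace q m n := by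
    rw [hf.1]; exact Submodule.smul_mem _ _ hf
  have hY : eulY q f ∈ bidegSpace q m n := by
    rw [hf.2]; exact Submodule.smul_mem _ _ hf
  have hC : actC q f ∈ bidegSpace q m n :=
    Submodule.add_mem _ (Submodule.sub_mem _ (Submodule.smul_mem _ _ hX)
      (Submodule.smul_mem _ _ hY)) (Submodule.smul_mem _ _ hf)
  have hT : actT q f ∈ bidegSpace q m n :=
    Submodule.add_mem _ (Submodule.smul_mem _ _ (Submodule.add_mem _ hX hY))
      (Submodule.smul_mem _ _ hf)
  have hB : ∀ a, actB q a f ∈ bidegSpace q m n := by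
    intro a
    unfold actB
    split_ifs
    · exact hT
    · exact actXi_mem q m n a.2 hf
    · exact Submodule.zero_mem _
  have hK : ∀ k : KPlus, Finsupp.linearCombination ℂ (actB q) k f ∈ bidegSpace q m n := by
    intro k
    induction k using Finsupp.induction_linear with
    | zero => simp
    | add a b ha hb => rw [map_add]; exact Submodule.add_mem _ ha hb
    | single a c =>
      rw [Finsupp.linearCombination_single]; exact Submodule.smul_mem _ _ (hB a)
  simp only [act, LinearMap.coprod_apply, LinearMap.add_apply, LinearMap.toSpanSingleton_apply,
    LinearMap.smul_apply]
  exact Submodule.add_mem _ (hK x.1) (Submodule.smul_mem _ _ hC)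

/-- A `𝔤_{≥0}`-submodule of `V_X`. -/
structure SubRep (q : Quadrant) where
  carrier : Submodule ℂ V
  stable : ∀ (x : G) {f : V}, f ∈ carrier → act q x f ∈ carrier

/-- The action of `𝔤_{≥0}` on a submodule of `V_X`. -/
def SubRep.rho {q : Quadrant} (S : SubRep q) : gGe →ₗ[ℂ] Module.End ℂ S.carrier where
  toFun x := (act q x).restrict fun _ hf => S.stable x hf
  map_add' x y := by ext v; simp [LinearMap.restrict_apply]
  map_smul' c x := by ext v; simp [LinearMap.restrict_apply]

/-- The `𝔤`-module `Ind S`. -/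
abbrev SubRep.ind {q : Quadrant} (S : SubRep q) : Type := Ind S.rho

/-- The vector space `U(𝔤_{<0}) ⊗ S`, which is identified with `Ind S` by `SubRep.pbw`. -/
abbrev SubRep.M {q : Quadrant} (S : SubRep q) : Type := UNeg ⊗[ℂ] S.carrier

/-- The Poincaré–Birkhoff–Witt map `U(𝔤_{<0}) ⊗ S → Ind S`. -/
def SubRep.pbw {q : Quadrant} (S : SubRep q) : S.M →ₗ[ℂ] S.ind := pbwInd S.rho

/-- The space `U(𝔤_{<0}) ⊗ V_X` underlying `M_X`. -/
abbrev MV : Type := UNeg ⊗[ℂ] V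

/-- The inclusion `U(𝔤_{<0}) ⊗ S → U(𝔤_{<0}) ⊗ V_X`. -/
def SubRep.incl {q : Quadrant} (S : SubRep q) : S.M →ₗ[ℂ] MV :=
  TensorProduct.map LinearMap.id S.carrier.subtype

/-- `V_X` itself. -/
def whole (q : Quadrant) : SubRep q := ⟨⊤, fun _ _ _ => Submodule.mem_top⟩

/-- `V_X^{m,n}`. -/
def bideg (q : Quadrant) (m n : ℤ) : SubRep q := ⟨bidegSpace q m n, fun x _ hf => act_mem q m n x hf⟩

theorem iSup_stable (q : Quadrant) (W : ℤ → SubRep q) (x : G) {f : V}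
    (hf : f ∈ ⨆ k, (W k).carrier) : act q x f ∈ ⨆ k, (W k).carrier := by
  have h : (⨆ k, (W k).carrier) ≤ (⨆ k, (W k).carrier).comap (act q x) :=
    iSup_le fun k g hg =>
      Submodule.mem_comap.2 (Submodule.mem_iSup_of_mem k ((W k).stable x hg))
  exact h hf

/-- `V_{X'} = ⨁_m V_X^{m,0}`. -/
def axisX (q : Quadrant) : SubRep q :=
  ⟨⨆ m : ℤ, (bideg q m 0).carrier, fun x _ hf => iSup_stable q (fun m => bideg q m 0) x hf⟩

/-- `V_{X''} = ⨁_n V_X^{0,n}`. -/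
def axisY (q : Quadrant) : SubRep q :=
  ⟨⨆ n : ℤ, (bideg q 0 n).carrier, fun x _ hf => iSup_stable q (fun n => bideg q 0 n) x hf⟩

/-- The linear map `Φ : U(𝔤_{<0}) ⊗ V_X → U(𝔤_{<0}) ⊗ V_Y` restricts to a map
`U(𝔤_{<0}) ⊗ S → U(𝔤_{<0}) ⊗ T` which is a morphism of `𝔤`-modules `Ind S → Ind T`. -/
def IsMorphism {p q : Quadrant} (S : SubRep p) (T : SubRep q) (Φ : MV →ₗ[ℂ] MV) : Prop :=
  ∃ Ψ : S.ind →ₗ[U] T.ind, ∀ x : S.M, ∃ y : T.M,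
    T.incl y = Φ (S.incl x) ∧ Ψ (S.pbw x) = T.pbw y

/-! # The maps -/

/-- The map `u ⊗ φ`, that is `u' ⊗ v ↦ u' u ⊗ φ v`. -/
def tm (u : UNeg) (φ : V →ₗ[ℂ] V) : MV →ₗ[ℂ] MV := TensorProduct.map (LinearMap.mulRight ℂ u) φ

/-- `∂_{x_j} : V_X → V_X`: the derivation by `x_j` or the multiplication by the letter `∂_{x_j}`. -/
def dx (q : Quadrant) (j : Fin 2) : V →ₗ[ℂ] V :=
  if q.xDual then LinearMap.mulLeft ℂ (lx j) else (MvPolynomial.pderiv (Sum.inl j)).toLinearMap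

/-- `∂_{y_j} : V_X → V_X`: the derivation by `y_j` or the multiplication by the letter `∂_{y_j}`. -/
def dy (q : Quadrant) (j : Fin 2) : V →ₗ[ℂ] V :=
  if q.yDual then LinearMap.mulLeft ℂ (ly j) else (MvPolynomial.pderiv (Sum.inr j)).toLinearMap

/-- `Δ⁺ = w₁₁ ⊗ ∂_{x₁} + w₂₁ ⊗ ∂_{x₂}`. -/
def deltaP (q : Quadrant) : MV →ₗ[ℂ] MV := tm w11 (dx q 0) + tm w21 (dx q 1)

/-- `Δ⁻ = w₁₂ ⊗ ∂_{x₁} + w₂₂ ⊗ ∂_{x₂}`. -/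
def deltaM (q : Quadrant) : MV →ₗ[ℂ] MV := tm w12 (dx q 0) + tm w22 (dx q 1)

/-- `Δ̃⁺ = w₁₁ ⊗ ∂_{y₁} + w₁₂ ⊗ ∂_{y₂}`. -/
def deltaTP (q : Quadrant) : MV →ₗ[ℂ] MV := tm w11 (dy q 0) + tm w12 (dy q 1)

/-- `Δ̃⁻ = w₂₁ ⊗ ∂_{y₁} + w₂₂ ⊗ ∂_{y₂}`. -/
def deltaTM (q : Quadrant) : MV →ₗ[ℂ] MV := tm w21 (dy q 0) + tm w22 (dy q 1)

/-- `∇ = Δ⁺ ∂_{y₁} + Δ⁻ ∂_{y₂}` on `M_X`. -/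
def nabla (q : Quadrant) : MV →ₗ[ℂ] MV :=
  deltaP q ∘ₗ tm 1 (dy q 0) + deltaM q ∘ₗ tm 1 (dy q 1)

/-- The maps `τ` are identities on the underlying spaces of polynomials. -/
def tau : V →ₗ[ℂ] V := LinearMap.id

/-- `∇₂ = Δ⁻ Δ⁺ τ`, with values in `M_Y`; used on `M_{A'} → M_{D'}` and `M_{B'} → M_{C'}`. -/
def nabla2 (q : Quadrant) : MV →ₗ[ℂ] MV := deltaM q ∘ₗ deltaP q ∘ₗ tm 1 tau

/-- `∇̃₂ = Δ̃⁻ Δ̃⁺ τ̃`, with values in `M_Y`; used on `M_{A''} → M_{B''}` and `M_{D''} → M_{C''}`. -/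
def nablaT2 (q : Quadrant) : MV →ₗ[ℂ] MV := deltaTM q ∘ₗ deltaTP q ∘ₗ tm 1 tau

/-- `∇₃`, used on `M_A^{0,1} → M_C^{-1,0}`. -/
def nabla3 : MV →ₗ[ℂ] MV :=
  deltaM .C ∘ₗ tm (w11 * w21) tau ∘ₗ tm 1 (dy .A 0)
    + deltaM .C ∘ₗ tm (w12 * w21 + w11 * w22) tau ∘ₗ tm 1 (dy .A 1)

/-- `∇̃₃`, used on `M_A^{1,0} → M_C^{0,-1}`. -/
def nablaT3 : MV →ₗ[ℂ] MV :=
  deltaTM .C ∘ₗ tm (w11 * w12) tau ∘ₗ tm 1 (dx .A 0)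
    + deltaTM .C ∘ₗ tm (w21 * w12 + w11 * w22) tau ∘ₗ tm 1 (dx .A 1)

/-! # Highest weight vectors and the morphisms they determine -/

/-- The module `V_X^{±m,±n}` at the point of coordinates `(m, n)` of the quadrant `X`. -/
def vertex (q : Quadrant) (m n : ℕ) : SubRep q :=
  bideg q (if q.xDual then -(m : ℤ) else m) (if q.yDual then -(n : ℤ) else n)

/-- The highest weight vector of `vertex q m n`: `x₁^m` or `∂_{x₂}^m` times `y₁^n` or `∂_{y₂}^n`. -/
def hwVec (q : Quadrant) (m n : ℕ) : V :=
  (if q.xDual then lx 1 ^ m else lx 0 ^ m) * (if q.yDual then ly 1 ^ n else ly 0 ^ n)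

/-- The eigenvalue of `t` on the highest weight vector of `vertex q m n`. -/
def muT (q : Quadrant) (m n : ℕ) : ℂ :=
  match q with
  | .A => -(m + n) / 2
  | .B => 1 + (m - n) / 2
  | .C => (m + n) / 2 + 2
  | .D => 1 + (n - m) / 2

/-- The eigenvalue of `C` on the highest weight vector of `vertex q m n`. -/
def muC (q : Quadrant) (m n : ℕ) : ℂ :=
  match q with
  | .A => (m - n) / 2
  | .B => -(m + n) / 2 - 1
  | .C => (n - m) / 2
  | .D => (m + n) / 2 + 1

/-- `z ∈ U(𝔤_{<0}) ⊗ V_X` lies in `U(𝔤_{<0}) ⊗ S` and is a highest weight singular vector of degree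
`d` of `Ind S`, of weight `(a, b, c, e)` with respect to `(h_x, h_y, t, C)`. -/
def IsHWSingular {q : Quadrant} (S : SubRep q) (d : ℕ) (a b c e : ℂ) (z : MV) : Prop :=
  ∃ y : S.M, S.incl y = z ∧ S.pbw y ≠ 0 ∧
    y ∈ LinearMap.range (TensorProduct.map (UNegDeg d).subtype
      (LinearMap.id : S.carrier →ₗ[ℂ] S.carrier)) ∧
    (∀ x ∈ gPos, iota x • S.pbw y = 0) ∧
    iota eX • S.pbw y = 0 ∧ iota eY • S.pbw y = 0 ∧
    iota hX • S.pbw y = a • S.pbw y ∧ iota hY • S.pbw y = b • S.pbw y ∧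
    iota tG • S.pbw y = c • S.pbw y ∧ iota cG • S.pbw y = e • S.pbw y

/-- `Φ` restricts to the morphism of degree `d` from the Verma module at the point `(m, n)` of the
quadrant `p` to the Verma module at the point `(m', n')` of the quadrant `q` which is determined by
the highest weight singular vector `z`: it is a morphism of `𝔤`-modules which sends the highest
weight vector to a nonzero multiple `r • z` of `z`. -/
def IsArrow (p : Quadrant) (m n : ℕ) (q : Quadrant) (m' n' : ℕ) (d : ℕ) (Φ : MV →ₗ[ℂ] MV) (r : ℂ)
    (z : MV) : Prop :=
  IsMorphism (vertex p m n) (vertex q m' n') Φ ∧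
    IsHWSingular (vertex p m n) 0 m n (muT p m n) (muC p m n) (1 ⊗ₜ[ℂ] hwVec p m n) ∧
    IsHWSingular (vertex q m' n') d m n (muT p m n) (muC p m n) z ∧
    r ≠ 0 ∧ Φ (1 ⊗ₜ[ℂ] hwVec p m n) = r • z

end KFour

end

noncomputable section

namespace KFour

/-! # Structure constants of the contact bracket -/

/-! The theorem reduces to computations with Weyl algebra operators acting on polynomials and with a
Clifford-like algebra generated by the `w_{ij}`.

PBW. Let `H` be the algebra on four anticommuting generators with a common square, the expected form
of `U(𝔤_{<0})`. On `H ⊗ F` the action of `𝔤` is forced: `x.(η_i z) = η_i (x̄.z) + [x, ξ_i].z` with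
`x̄ = (-1)^{p(x)} x`, starting from the given action of `𝔤_{≥0}` on `1 ⊗ F`. It is well defined
because the corresponding operators on `Hom(𝔤, H ⊗ F)` satisfy the relations of `H`
(`homEta_anticomm`). The commutation relations of `𝔤` hold because their defect at `η_i z` is a
combination of defects at `z` (`defect_smul`), which needs only the Jacobi identity with third
argument `ξ_i` (`jacobi_xi`). The induced module then maps back to `H ⊗ F`, which gives injectivity
in PBW; surjectivity comes from moving elements of `𝔤` to the right past the `η_i`.

One Weyl algebra for four quadrants. The shifts `[i, j]` in the action of `t` and `C` are exactly
what makes the elements `XG i j` and `YG i j` of `𝔤₀` act as the normally ordered operators `x_i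
∂_{x_j}` and `y_i ∂_{y_j}` (`act_XG`, `act_YG`), built from `mx`, `dx`, `my`, `dy` with the same
commutation relations in every quadrant. In these terms `w_{ab}` transforms like `x_a ⊗ y_b`, the
anticommutator of `w_{ab}` and `w_{cd}` is `ε_{ac} ε_{bd} κ` with `κ` central, and `𝔤₁` is spanned
by elements `PX`, `PY` whose brackets with the `w_{ab}` lie in the `x`-copy, respectively the
`y`-copy, of `𝔤𝔩₂`, with coefficients made of `ε`. Since `𝔤_{>0}` is generated in degree 1, a left
`U(𝔤_{<0})`-linear map is a morphism once it intertwines `XG` and `YG` on the vectors `1 ⊗ v` and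
sends these to vectors killed by `PX` and `PY` (`isMorphism_of_generators`).

Cancellations. For `∇` the antisymmetric `ε` meets the commuting operators `∂_{x_a} ∂_{x_b}` or
`∂_{y_a} ∂_{y_b}`. For `∇₂` the two factors `w` carry the determinant of the other `𝔤𝔩₂`, which
cancels the normal ordering constant of dual letters; this is why the map has to change quadrant. In
`∇₃` both pairs of letters become dual and both effects occur. The composites vanish on the whole
space, by the same (anti)symmetry.

Singular vectors. The image of a singular vector under a morphism is annihilated by what annihilates
the source vector and has the same weight, so only nonvanishing is left. It is seen by evaluating
polynomials at a point and mapping `H` to `4 × 4` gamma matrices. -/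

/-- The integer underlying `grSign`. -/
def sgnZ (I J : Finset (Fin 4)) : ℤ :=
  if Disjoint I J then (-1) ^ ((I ×ˢ J).filter (fun p => p.2 < p.1)).card else 0

theorem grSign_eq (I J : Finset (Fin 4)) : grSign I J = (sgnZ I J : ℂ) := by
  unfold grSign sgnZ; split_ifs <;> simp

/-- The coefficient of `m` in the bracket of `t^m ξ_I` and `t^n ξ_J`. -/
def brL (I J : Finset (Fin 4)) : ℤ := ((J.card : ℤ) - 2) * sgnZ I J

/-- The coefficient of `n` in the bracket of `t^m ξ_I` and `t^n ξ_J`. -/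
def brR (I J : Finset (Fin 4)) : ℤ := (2 - (I.card : ℤ)) * sgnZ I J

/-- One summand of `(-1)^{p(f)} ∑ ∂_i f ∂_i g` for `f = ξ_I` and `g = ξ_J`. -/
def brTerm (k : Fin 4) (I J : Finset (Fin 4)) : ℤ :=
  if k ∈ I ∧ k ∈ J then (-1) ^ (I.card + (I.filter (· < k)).card + (J.filter (· < k)).card)
    * sgnZ (I.erase k) (J.erase k) else 0

/-- The coefficient of `(-1)^{p(f)} ∑ ∂_i f ∂_i g` for `f = ξ_I` and `g = ξ_J`. -/
def brC (I J : Finset (Fin 4)) : ℤ := ∑ k, brTerm k I J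

theorem grMul_mono (m n : ℕ) (I J : Finset (Fin 4)) :
    grMul (mono m I) (mono n J) = (sgnZ I J : ℂ) • mono (m + n) (I ∪ J) := by
  simp [grMul, mono, grSign_eq]

theorem dT_mono (m : ℕ) (I : Finset (Fin 4)) : dT (mono m I) = (m : ℂ) • mono (m - 1) I := by
  simp [dT, mono]

theorem dXi_mono (i : Fin 4) (m : ℕ) (I : Finset (Fin 4)) : dXi i (mono m I) =
    if i ∈ I then ((-1 : ℂ) ^ (I.filter (fun j => j < i)).card) • mono m (I.erase i) else 0 := by
  simp [dXi, mono]

theorem parInv_mono (m : ℕ) (I : Finset (Fin 4)) :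
    parInv (mono m I) = ((-1 : ℂ) ^ I.card) • mono m I := by
  simp [parInv, mono]

theorem sgnZ_erase : ∀ (i : Fin 4) (I : Finset (Fin 4)), i ∈ I →
    (-1) ^ (I.filter (fun j => j < i)).card * sgnZ {i} (I.erase i) = 1 := by
  decide +kernel

theorem twoSubEuler_mono (m : ℕ) (I : Finset (Fin 4)) :
    twoSubEuler (mono m I) = ((2 - (I.card : ℤ) : ℤ) : ℂ) • mono m I := by
  have h : ∀ i, grMul (mono 0 {i}) (dXi i (mono m I)) = if i ∈ I then mono m I else 0 := by
    intro i
    rw [dXi_mono]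
    split_ifs with hi
    · rw [map_smul, grMul_mono, smul_smul, zero_add, ← Finset.insert_eq, Finset.insert_erase hi]
      have := congrArg (Int.cast : ℤ → ℂ) (sgnZ_erase i I hi)
      push_cast at this
      rw [this, one_smul]
    · simp
  simp only [twoSubEuler, h, Finset.sum_ite_mem, Finset.univ_inter, Finset.sum_const]
  push_cast
  rw [sub_smul, Nat.cast_smul_eq_nsmul ℂ]

/-- The sign vanishes unless the sets are disjoint, and then the union is the symmetric difference.
The terms `∂_k f ∂_k g` lead to the same symmetric difference, so the bracket of two monomials
involves a single index set. -/
theorem sgnZ_smul_union (I J : Finset (Fin 4)) (m : ℕ) :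
    (sgnZ I J : ℂ) • mono m (I ∪ J) = (sgnZ I J : ℂ) • mono m (symmDiff I J) := by
  by_cases h : Disjoint I J
  · rw [h.symmDiff_eq_sup]; rfl
  · simp [sgnZ, h]

theorem brTerm_symmDiff : ∀ (k : Fin 4) (I J : Finset (Fin 4)), k ∈ I → k ∈ J →
    symmDiff (I.erase k) (J.erase k) = symmDiff I J := by
  decide +kernel

/-- The bracket of two monomials. -/
theorem contactBr_mono (m n : ℕ) (I J : Finset (Fin 4)) :
    contactBr (mono m I) (mono n J) =
      ((brL I J : ℂ) * m + (brR I J : ℂ) * n) • mono (m + n - 1) (symmDiff I J)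
        + (brC I J : ℂ) • mono (m + n) (symmDiff I J) := by
  have h : ∀ k, grMul (dXi k (parInv (mono m I))) (dXi k (mono n J)) =
      (brTerm k I J : ℂ) • mono (m + n) (symmDiff I J) := by
    intro k
    rw [parInv_mono, map_smul, dXi_mono, dXi_mono, brTerm]
    by_cases hI : k ∈ I <;> by_cases hJ : k ∈ J <;>
      simp only [hI, hJ, if_true, if_false, smul_zero, map_zero, LinearMap.zero_apply, and_true,
        and_false, Int.cast_zero, zero_smul, map_smul, LinearMap.smul_apply, grMul_mono,
        sgnZ_smul_union]
    rw [brTerm_symmDiff k I J hI hJ]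
    simp only [smul_smul]
    congr 1
    push_cast
    ring
  rw [contactBr, twoSubEuler_mono, twoSubEuler_mono, dT_mono, dT_mono, Finset.sum_congr rfl
    (fun k _ => h k), ← Finset.sum_smul, brC]
  push_cast
  congr 1
  simp only [map_smul, LinearMap.smul_apply, grMul_mono, sgnZ_smul_union, brL, brR]
  -- Truncated subtraction is harmless: the exponent `n - 1` comes with the coefficient `n`, and `m
  -- + n - 1` is truncated only for `m = n = 0`, where its coefficient is zero.
  rcases m with _ | m <;> rcases n with _ | n
  · simp
  · have e1 : 0 + (n + 1) - 1 = n := by omega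
    have e2 : 0 + (n + 1 - 1) = n := by omega
    rw [e1, e2]
    push_cast
    module
  · have e1 : m + 1 + 0 - 1 = m := by omega
    rw [e1, Nat.add_zero]
    push_cast
    module
  · have e1 : m + 1 + (n + 1 - 1) = m + n + 1 := by omega
    have e2 : m + 1 - 1 + (n + 1) = m + n + 1 := by omega
    have e3 : m + 1 + (n + 1) - 1 = m + n + 1 := by omega
    rw [e1, e2, e3]
    simp only [smul_smul, ← sub_smul]
    congr 1
    push_cast
    ring

/-- The integer underlying the values of the cocycle on the `ξ_I`. -/
def cocZ (I J : Finset (Fin 4)) : ℤ :=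
  ((if I = ∅ ∧ J = Finset.univ then -2 else 0)
    + ∑ i : Fin 4, if I = {i} ∧ J = {i}ᶜ then -(-1) ^ (i : ℕ) else 0)
  - (-1) ^ (I.card * J.card) * ((if J = ∅ ∧ I = Finset.univ then -2 else 0)
    + ∑ i : Fin 4, if J = {i} ∧ I = {i}ᶜ then -(-1) ^ (i : ℕ) else 0)

theorem cocycle_mono (m n : ℕ) (I J : Finset (Fin 4)) :
    cocycle (mono m I) (mono n J) = if m = 0 ∧ n = 0 then (cocZ I J : ℂ) else 0 := by
  simp only [cocycle, mono, Finsupp.linearCombination_single, one_smul, cocycleHalf, cocZ,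
    Prod.mk.injEq]
  by_cases hm : m = 0 <;> by_cases hn : n = 0 <;> simp [hm, hn]

/-- The bracket as a bilinear map. -/
def contactL : KPlus →ₗ[ℂ] KPlus →ₗ[ℂ] KPlus :=
  LinearMap.mk₂ ℂ contactBr
    (fun f f' g => by
      simp only [contactBr, twoSubEuler, map_add, map_sub, map_smul, map_sum, LinearMap.add_apply,
        LinearMap.sub_apply, LinearMap.smul_apply, LinearMap.sum_apply, smul_add,
        Finset.sum_add_distrib]
      abel)
    (fun c f g => by
      simp only [contactBr, twoSubEuler, map_sub, map_smul, map_sum,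
        LinearMap.sub_apply, LinearMap.smul_apply, LinearMap.sum_apply, smul_add, smul_sub,
        Finset.smul_sum, smul_comm c (2 : ℂ)])
    (fun f g g' => by
      simp only [contactBr, twoSubEuler, map_add, map_sub, map_smul, map_sum,
        LinearMap.sub_apply, LinearMap.smul_apply, LinearMap.sum_apply, smul_add,
        Finset.sum_add_distrib]
      abel)
    (fun c f g => by
      simp only [contactBr, twoSubEuler, map_sub, map_smul, map_sum,
        LinearMap.sub_apply, LinearMap.smul_apply, LinearMap.sum_apply, smul_add, smul_sub,
        Finset.smul_sum, smul_comm c (2 : ℂ)])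

theorem contactL_apply (f g : KPlus) : contactL f g = contactBr f g := rfl

/-- The bracket of `𝔤` as a bilinear map. -/
def lieL : G →ₗ[ℂ] G →ₗ[ℂ] G :=
  (contactL.compl₁₂ (LinearMap.fst ℂ KPlus ℂ) (LinearMap.fst ℂ KPlus ℂ)).compr₂
      (LinearMap.inl ℂ KPlus ℂ)
    + (cocycle.compl₁₂ (LinearMap.fst ℂ KPlus ℂ) (LinearMap.fst ℂ KPlus ℂ)).compr₂
      (LinearMap.inr ℂ KPlus ℂ)

theorem lieL_apply (x y : G) : lieL x y = lieBr x y := by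
  simp [lieL, lieBr, contactL_apply]

theorem lieBr_add_left (x x' y : G) : lieBr (x + x') y = lieBr x y + lieBr x' y := by
  simp [← lieL_apply]

theorem lieBr_add_right (x y y' : G) : lieBr x (y + y') = lieBr x y + lieBr x y' := by
  simp [← lieL_apply]

theorem lieBr_sub_left (x x' y : G) : lieBr (x - x') y = lieBr x y - lieBr x' y := by
  simp [← lieL_apply]

theorem lieBr_sub_right (x y y' : G) : lieBr x (y - y') = lieBr x y - lieBr x y' := by
  simp [← lieL_apply]

theorem lieBr_neg_left (x y : G) : lieBr (-x) y = -lieBr x y := by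
  simp [← lieL_apply]

theorem lieBr_neg_right (x y : G) : lieBr x (-y) = -lieBr x y := by
  simp [← lieL_apply]

theorem lieBr_smul_left (c : ℂ) (x y : G) : lieBr (c • x) y = c • lieBr x y := by
  simp only [← lieL_apply, map_smul, LinearMap.smul_apply]

theorem lieBr_smul_right (c : ℂ) (x y : G) : lieBr x (c • y) = c • lieBr x y := by
  simp only [← lieL_apply, map_smul]

/-- The basis vector `t^m ξ_I` of `𝔤`. -/
def gmono (m : ℕ) (I : Finset (Fin 4)) : G := (mono m I, 0)

theorem xi_eq_gmono (I : Finset (Fin 4)) : xi I = gmono 0 I := rfl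

theorem tG_eq_gmono : tG = gmono 1 ∅ := rfl

theorem lieBr_gmono (m n : ℕ) (I J : Finset (Fin 4)) :
    lieBr (gmono m I) (gmono n J) =
      ((brL I J : ℂ) * m + (brR I J : ℂ) * n) • gmono (m + n - 1) (symmDiff I J)
        + (brC I J : ℂ) • gmono (m + n) (symmDiff I J)
        + (if m = 0 ∧ n = 0 then (cocZ I J : ℂ) else 0) • cG := by
  ext1
  · simp [lieBr, gmono, contactBr_mono, cG, -ite_smul]
  · simp [lieBr, gmono, cocycle_mono, cG, -ite_smul]

theorem lieBr_cG_left (x : G) : lieBr cG x = 0 := by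
  ext1 <;> simp [lieBr, cG, ← contactL_apply]

theorem lieBr_cG_right (x : G) : lieBr x cG = 0 := by
  ext1 <;> simp [lieBr, cG, ← contactL_apply]

/-- Two linear maps on `𝔤` agree if they agree on the basis. -/
theorem hom_ext_G {M : Type*} [AddCommMonoid M] [Module ℂ M] {f g : G →ₗ[ℂ] M}
    (h : ∀ m I, f (gmono m I) = g (gmono m I)) (hc : f cG = g cG) : f = g := by
  refine LinearMap.prod_ext (Finsupp.lhom_ext' fun a => LinearMap.ext_ring ?_)
    (LinearMap.ext_ring ?_)
  · exact h a.1 a.2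
  · exact hc

/-- The parity involution of `𝔤`. -/
def parG : G →ₗ[ℂ] G := LinearMap.prodMap parInv LinearMap.id

theorem parG_gmono (m : ℕ) (I : Finset (Fin 4)) :
    parG (gmono m I) = ((-1 : ℂ) ^ I.card) • gmono m I := by
  simp [parG, gmono, parInv_mono]

theorem parG_cG : parG cG = cG := by simp [parG, cG]

theorem parG_parG (x : G) : parG (parG x) = x := by
  have : parG ∘ₗ parG = LinearMap.id := by
    refine hom_ext_G (fun m I => ?_) ?_
    · simp [parG_gmono, smul_smul, ← mul_pow]
    · simp [parG_cG]
  exact LinearMap.congr_fun this x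

theorem neg_one_pow_symmDiff : ∀ I J : Finset (Fin 4),
    (-1 : ℤ) ^ (symmDiff I J).card = (-1) ^ I.card * (-1) ^ J.card := by
  decide +kernel

/-- The cocycle is even: it pairs only `∅` with the full set and a singleton with its complement. -/
theorem cocZ_parity : ∀ I J : Finset (Fin 4),
    (-1 : ℤ) ^ I.card * (-1) ^ J.card * cocZ I J = cocZ I J := by
  decide +kernel

theorem parG_lieBr (x y : G) : parG (lieBr x y) = lieBr (parG x) (parG y) := by
  have : lieL.compr₂ parG = lieL.compl₁₂ parG parG := by
    refine hom_ext_G (fun m I => hom_ext_G (fun n J => ?_) ?_) (LinearMap.ext fun y => ?_)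
    · have h1 := congrArg (Int.cast : ℤ → ℂ) (neg_one_pow_symmDiff I J)
      have h2 := congrArg (Int.cast : ℤ → ℂ) (cocZ_parity I J)
      push_cast at h1 h2
      simp only [LinearMap.compr₂_apply, LinearMap.compl₁₂_apply, lieL_apply, parG_gmono,
        lieBr_gmono, map_add, map_smul, parG_cG, h1,
        LinearMap.smul_apply]
      split_ifs
      · nth_rewrite 1 [← h2]
        module
      · module
    · simp [lieL_apply, parG_cG, lieBr_cG_right]
    · simp [lieL_apply, parG_cG, lieBr_cG_left]
  simpa [lieL_apply] using LinearMap.congr_fun (LinearMap.congr_fun this x) y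

theorem br_skew : ∀ I J : Finset (Fin 4),
    brL I J = -(-1) ^ (I.card * J.card) * brR J I ∧
    brC I J = -(-1) ^ (I.card * J.card) * brC J I ∧
    cocZ I J = -(-1) ^ (I.card * J.card) * cocZ J I := by
  decide +kernel

theorem lieBr_skew_gmono (m n : ℕ) (I J : Finset (Fin 4)) :
    lieBr (gmono m I) (gmono n J) =
      -((-1 : ℂ) ^ (I.card * J.card) • lieBr (gmono n J) (gmono m I)) := by
  obtain ⟨h1, h2, h3⟩ := br_skew I J
  obtain ⟨h1', -, -⟩ := br_skew J I
  have h4 : brR I J = -(-1) ^ (I.card * J.card) * brL J I := by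
    rw [h1', mul_comm J.card, neg_mul, neg_mul, mul_neg, neg_neg, ← mul_assoc, ← mul_pow]
    simp
  rw [lieBr_gmono, lieBr_gmono, h1, h2, h3, h4, symmDiff_comm J I, add_comm n m]
  simp only [and_comm (a := n = 0)]
  push_cast
  split_ifs <;> module

/-! # The Jacobi identity with one argument `ξ_i` -/

/-- Both sides of the Jacobi identity for `t^m ξ_I`, `t^n ξ_J`, `ξ_i` are polynomial in `m` and `n`.
The six equations compare the coefficients of `m(m-1)`, `n(n-1)` and `mn` at `t^{m+n-2}`, of `m` and
`n` at `t^{m+n-1}`, and the constant at `t^{m+n}`. They are integer identities about subsets of a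
set of four elements, so they can be checked exhaustively. -/
theorem jacobi_consts : ∀ (i : Fin 4) (I J : Finset (Fin 4)),
    brL I J * brL (symmDiff I J) {i} =
      (-1) ^ J.card * (brL I {i} * brL (symmDiff I {i}) J) ∧
    brR I J * brL (symmDiff I J) {i} = brL J {i} * brR I (symmDiff J {i}) ∧
    (brL I J + brR I J) * brL (symmDiff I J) {i} = brL J {i} * brL I (symmDiff J {i})
      + (-1) ^ J.card * (brL I {i} * brR (symmDiff I {i}) J) ∧
    brL I J * brC (symmDiff I J) {i} + brC I J * brL (symmDiff I J) {i} =
      brC J {i} * brL I (symmDiff J {i}) + (-1) ^ J.card * (brL I {i} * brC (symmDiff I {i}) J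
        + brC I {i} * brL (symmDiff I {i}) J) ∧
    brR I J * brC (symmDiff I J) {i} + brC I J * brL (symmDiff I J) {i} =
      brL J {i} * brC I (symmDiff J {i}) + brC J {i} * brR I (symmDiff J {i})
        + (-1) ^ J.card * (brC I {i} * brR (symmDiff I {i}) J) ∧
    brC I J * brC (symmDiff I J) {i} =
      brC J {i} * brC I (symmDiff J {i}) + (-1) ^ J.card * (brC I {i} * brC (symmDiff I {i}) J) := by
  decide +kernel

/-- The central term occurs only when the two exponents of `t` entering the outer bracket are zero.
This leaves the exponents `(0,0)`, `(1,0)` and `(0,1)`, one equation for each. -/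
theorem jacobi_consts_cocycle : ∀ (i : Fin 4) (I J : Finset (Fin 4)),
    brC I J * cocZ (symmDiff I J) {i} = brC J {i} * cocZ I (symmDiff J {i})
      + (-1) ^ J.card * (brC I {i} * cocZ (symmDiff I {i}) J) ∧
    brL I J * cocZ (symmDiff I J) {i} =
      (-1) ^ J.card * (brL I {i} * cocZ (symmDiff I {i}) J) ∧
    brR I J * cocZ (symmDiff I J) {i} = brL J {i} * cocZ I (symmDiff J {i}) := by
  decide +kernel

theorem lieBr_gmono_xi (m : ℕ) (I : Finset (Fin 4)) (i : Fin 4) :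
    lieBr (gmono m I) (xi {i}) = ((brL I {i} : ℂ) * m) • gmono (m - 1) (symmDiff I {i})
      + (brC I {i} : ℂ) • gmono m (symmDiff I {i})
      + (if m = 0 then (cocZ I {i} : ℂ) else 0) • cG := by
  rw [xi_eq_gmono, lieBr_gmono]
  simp

theorem jacobi_gmono (m n : ℕ) (I J : Finset (Fin 4)) (i : Fin 4) :
    lieBr (lieBr (gmono m I) (gmono n J)) (xi {i}) =
      lieBr (gmono m I) (lieBr (gmono n J) (xi {i}))
        + lieBr (lieBr (gmono m I) (xi {i})) (parG (gmono n J)) := by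
  obtain ⟨h1, h2, h3, h4, h5, h6⟩ := jacobi_consts i I J
  obtain ⟨c1, c2, c3⟩ := jacobi_consts_cocycle i I J
  apply_fun (Int.cast : ℤ → ℂ) at h1 h2 h3 h4 h5 h6 c1 c2 c3
  push_cast at h1 h2 h3 h4 h5 h6 c1 c2 c3
  have k1 : symmDiff I (symmDiff J {i}) = symmDiff (symmDiff I J) {i} := by
    rw [symmDiff_assoc]
  have k2 : symmDiff (symmDiff I {i}) J = symmDiff (symmDiff I J) {i} := by
    rw [symmDiff_right_comm]
  rw [parG_gmono, lieBr_gmono, lieBr_gmono_xi, lieBr_gmono_xi]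
  simp only [lieBr_add_left, lieBr_add_right, lieBr_smul_left, lieBr_smul_right, lieBr_gmono_xi,
    lieBr_gmono, lieBr_cG_left, lieBr_cG_right, k1, k2]
  -- Small exponents are separated because `m - 1` truncates there and because the cocycle
  -- contributes only for `m + n ≤ 1`. In each case the identity is the combination of the six
  -- coefficient equations with weights `m(m-1)`, `n(n-1)`, `mn`, `m`, `n`, `1`.
  rcases m with _ | m <;> rcases n with _ | n
  · simp only [Nat.cast_zero, mul_zero, zero_smul, add_zero, zero_add, if_true, and_self, smul_zero]
    linear_combination (norm := module) h6 • gmono 0 (symmDiff (symmDiff I J) {i}) + c1 • cG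
  · rcases n with _ | n
    · simp
      linear_combination (norm := module) h6 • gmono 1 (symmDiff (symmDiff I J) {i})
        + h5 • gmono 0 (symmDiff (symmDiff I J) {i}) + c3 • cG
    · simp
      linear_combination (norm := module) h6 • gmono (n + 2) (symmDiff (symmDiff I J) {i})
        + ((n + 2 : ℂ) * h5) • gmono (n + 1) (symmDiff (symmDiff I J) {i})
        + ((n + 1 : ℂ) * (n + 2) * h2) • gmono n (symmDiff (symmDiff I J) {i})
  · rcases m with _ | m
    · simp
      linear_combination (norm := module) h6 • gmono 1 (symmDiff (symmDiff I J) {i})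
        + h4 • gmono 0 (symmDiff (symmDiff I J) {i}) + c2 • cG
    · simp
      linear_combination (norm := module) h6 • gmono (m + 2) (symmDiff (symmDiff I J) {i})
        + ((m + 2 : ℂ) * h4) • gmono (m + 1) (symmDiff (symmDiff I J) {i})
        + ((m + 1 : ℂ) * (m + 2) * h1) • gmono m (symmDiff (symmDiff I J) {i})
  · have e1 : m + 1 + (n + 1) = m + n + 2 := by omega
    have e2 : m + n + 2 - 1 = m + n + 1 := by omega
    have e3 : m + 1 + n = m + n + 1 := by omega
    have e4 : m + (n + 1) = m + n + 1 := by omega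
    simp [e1, e2, e3, e4]
    linear_combination (norm := module) h6 • gmono (m + n + 2) (symmDiff (symmDiff I J) {i})
        + ((m + 1 : ℂ) * h4 + (n + 1 : ℂ) * h5) • gmono (m + n + 1) (symmDiff (symmDiff I J) {i})
        + ((m + 1 : ℂ) * m * h1 + (n + 1 : ℂ) * n * h2 + (m + 1 : ℂ) * (n + 1) * h3) •
          gmono (m + n) (symmDiff (symmDiff I J) {i})

theorem lieL_cG (x : G) : lieL x cG = 0 := by rw [lieL_apply, lieBr_cG_right]

/-- Bilinearity reduces to monomials. The sign of moving `ξ_i` past `y` is carried by `parG`, so `x`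
and `y` need not be homogeneous. As the `ξ_i` generate `𝔤_{<0}`, this instance of the Jacobi
identity is enough to build the action on `H ⊗ F`. -/
theorem jacobi_xi (x y : G) (i : Fin 4) :
    lieBr (lieBr x y) (xi {i}) = lieBr x (lieBr y (xi {i}))
      + lieBr (lieBr x (xi {i})) (parG y) := by
  have : lieL.compr₂ (lieL.flip (xi {i})) =
      lieL.compl₂ (lieL.flip (xi {i})) + lieL.compl₁₂ (lieL.flip (xi {i})) parG := by
    refine hom_ext_G (fun m I => hom_ext_G (fun n J => ?_) ?_) (LinearMap.ext fun y => ?_)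
    · simpa [lieL_apply] using jacobi_gmono m n I J i
    · simp [parG_cG, lieL_cG, lieL_apply cG, lieBr_cG_left]
    · simp [lieL_apply, lieBr_cG_left]
  simpa [lieL_apply] using LinearMap.congr_fun (LinearMap.congr_fun this x) y

/-- The element `1` of `K(1,4)₊`. -/
def oneG : G := gmono 0 ∅

theorem xi_consts : ∀ i j : Fin 4, brC {i} {j} = (if i = j then -1 else 0) ∧
    cocZ {i} {j} = 0 ∧ symmDiff {i} {i} = (∅ : Finset (Fin 4)) ∧ brC ∅ {i} = 0 ∧ cocZ ∅ {i} = 0 := by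
  decide +kernel

theorem lieBr_xi_xi (i j : Fin 4) : lieBr (xi {i}) (xi {j}) = if i = j then -oneG else 0 := by
  obtain ⟨h1, h2, h3, -⟩ := xi_consts i j
  rw [xi_eq_gmono {i}, lieBr_gmono_xi, h1, h2]
  by_cases h : i = j
  · subst h
    simp only [h3, oneG, if_true]
    push_cast
    module
  · simp [h]

theorem lieBr_oneG_xi (i : Fin 4) : lieBr oneG (xi {i}) = 0 := by
  obtain ⟨-, -, -, h1, h2⟩ := xi_consts i i
  rw [oneG, lieBr_gmono_xi, h1, h2]
  simp

theorem parG_xi (i : Fin 4) : parG (xi {i}) = -xi {i} := by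
  rw [xi_eq_gmono, parG_gmono, Finset.card_singleton]; module

theorem parG_oneG : parG oneG = oneG := by
  rw [oneG, parG_gmono, Finset.card_empty, pow_zero, one_smul]

theorem lieBr_xi_left (x : G) (i : Fin 4) : lieBr (xi {i}) x = -lieBr (parG x) (xi {i}) := by
  have : lieL (xi {i}) = -(lieL.flip (xi {i}) ∘ₗ parG) := by
    refine hom_ext_G (fun m I => ?_) ?_
    · simp [lieL_apply, parG_gmono, xi_eq_gmono, lieBr_skew_gmono 0 m {i} I]
    · simp [lieL_apply, parG_cG, lieBr_cG_left, lieBr_cG_right]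
  simpa [lieL_apply] using LinearMap.congr_fun this x

theorem lieBr_oneG_left (x : G) : lieBr oneG x = -lieBr x oneG := by
  have : lieL oneG = -lieL.flip oneG := by
    refine hom_ext_G (fun m I => ?_) ?_
    · simp [lieL_apply, oneG, lieBr_skew_gmono 0 m ∅ I]
    · simp [lieL_apply, lieBr_cG_left, lieBr_cG_right]
  simpa [lieL_apply] using LinearMap.congr_fun this x

/-- The squares and the anticommutators of the operators `[·, ξ_i]`. -/
theorem lieBr_lieBr_xi (x : G) (i j : Fin 4) :
    lieBr (lieBr x (xi {i})) (xi {j}) + lieBr (lieBr x (xi {j})) (xi {i}) =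
      if i = j then -lieBr x oneG else 0 := by
  rw [jacobi_xi, parG_xi, lieBr_neg_right, lieBr_xi_xi]
  split_ifs <;> simp [← lieL_apply]

/-! # A model of `U(𝔤_{<0})` -/

/-- The relations `η_i η_j + η_j η_i = 2 δ_{ij} η_1²`. -/
inductive HRel : FreeAlgebra ℂ (Fin 4) → FreeAlgebra ℂ (Fin 4) → Prop
  | anticomm (i j : Fin 4) :
      HRel (FreeAlgebra.ι ℂ i * FreeAlgebra.ι ℂ j + FreeAlgebra.ι ℂ j * FreeAlgebra.ι ℂ i)
        (if i = j then FreeAlgebra.ι ℂ 0 * FreeAlgebra.ι ℂ 0 + FreeAlgebra.ι ℂ 0 * FreeAlgebra.ι ℂ 0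
          else 0)

/-- The algebra generated by four anticommuting elements with the same square. -/
def H : Type := RingQuot HRel

instance : Ring H := inferInstanceAs (Ring (RingQuot HRel))

instance : Algebra ℂ H := inferInstanceAs (Algebra ℂ (RingQuot HRel))

/-- The projection from the free algebra. -/
def hMk : FreeAlgebra ℂ (Fin 4) →ₐ[ℂ] H :=
  (show FreeAlgebra ℂ (Fin 4) →ₐ[ℂ] RingQuot HRel from RingQuot.mkAlgHom ℂ HRel)

/-- The generators. -/
def hEta (i : Fin 4) : H := hMk (FreeAlgebra.ι ℂ i)

theorem hEta_anticomm (i j : Fin 4) : hEta i * hEta j + hEta j * hEta i =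
    if i = j then hEta 0 * hEta 0 + hEta 0 * hEta 0 else 0 := by
  have := RingQuot.mkAlgHom_rel ℂ (HRel.anticomm i j)
  change hMk _ = hMk _ at this
  rw [apply_ite hMk] at this
  simpa [hEta] using this

/-- The universal property. -/
def hLift {A : Type*} [Semiring A] [Algebra ℂ A] (f : Fin 4 → A)
    (hf : ∀ i j, f i * f j + f j * f i = if i = j then f 0 * f 0 + f 0 * f 0 else 0) : H →ₐ[ℂ] A :=
  (show RingQuot HRel →ₐ[ℂ] A from RingQuot.liftAlgHom ℂ ⟨FreeAlgebra.lift ℂ f, by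
    rintro _ _ ⟨i, j⟩
    rw [apply_ite (FreeAlgebra.lift ℂ f)]
    simpa using hf i j⟩)

theorem hLift_hEta {A : Type*} [Semiring A] [Algebra ℂ A] (f : Fin 4 → A)
    (hf : ∀ i j, f i * f j + f j * f i = if i = j then f 0 * f 0 + f 0 * f 0 else 0) (i : Fin 4) :
    hLift f hf (hEta i) = f i := by
  have : hLift f hf (hEta i) = FreeAlgebra.lift ℂ f (FreeAlgebra.ι ℂ i) :=
    RingQuot.liftAlgHom_mkAlgHom_apply ℂ _ _ _
  simpa using this

theorem hMk_surjective : Function.Surjective hMk := RingQuot.mkAlgHom_surjective ℂ HRel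

theorem adjoin_hEta : Algebra.adjoin ℂ (Set.range hEta) = ⊤ := by
  have h := congrArg (Subalgebra.map hMk) (FreeAlgebra.adjoin_range_ι ℂ (Fin 4))
  rw [AlgHom.map_adjoin, ← Set.range_comp, Algebra.map_top,
    (AlgHom.range_eq_top _).2 hMk_surjective] at h
  exact h

/-- The square of the generators is `-Θ / 2`. -/
def hTheta : H := (-2 : ℂ) • (hEta 0 * hEta 0)

theorem hTheta_eq (i : Fin 4) : hTheta = (-2 : ℂ) • (hEta i * hEta i) := by
  have := hEta_anticomm i i
  rw [if_pos rfl, ← two_smul ℂ, ← two_smul ℂ] at this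
  rw [hTheta, show (-2 : ℂ) = (-1) * 2 by norm_num, mul_smul, mul_smul, this]

theorem hEta_mul_of_ne {i j : Fin 4} (h : i ≠ j) : hEta i * hEta j = -(hEta j * hEta i) := by
  have := hEta_anticomm i j
  rw [if_neg h] at this
  exact eq_neg_of_add_eq_zero_left this

/-- `Θ` is a multiple of the square of every generator, so it commutes with each of them. -/
theorem hTheta_comm (i : Fin 4) : hTheta * hEta i = hEta i * hTheta := by
  rw [hTheta_eq i, smul_mul_assoc, mul_smul_comm, mul_assoc]

/-- The component of an element of `𝔤` in `𝔤_{<0}`, as an element of `H`. -/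
def negH : G →ₗ[ℂ] H :=
  ((Finsupp.lapply ((0, ∅) : ℕ × Finset (Fin 4))).smulRight hTheta
    + ∑ i : Fin 4, (Finsupp.lapply ((0, {i}) : ℕ × Finset (Fin 4))).smulRight (hEta i)) ∘ₗ
    LinearMap.fst ℂ KPlus ℂ

theorem negH_apply (x : G) : negH x = x.1 (0, ∅) • hTheta + ∑ i, x.1 (0, {i}) • hEta i := by
  simp [negH]

theorem negH_of_mem {x : G} (hx : x ∈ gGe) : negH x = 0 := by
  have h : ∀ a : ℕ × Finset (Fin 4), degB a < 0 → x.1 a = 0 := by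
    intro a ha
    by_contra hne
    have h1 : a ∈ {a | 0 ≤ degB a} := hx.1 (Finsupp.mem_support_iff.2 hne)
    exact absurd h1 (not_le.2 ha)
  rw [negH_apply, h _ (by simp [degB]), zero_smul, zero_add]
  exact Finset.sum_eq_zero fun i _ => by rw [h _ (by simp [degB]), zero_smul]

theorem negH_xi (i : Fin 4) : negH (xi {i}) = hEta i := by
  rw [negH_apply]
  simp [xi, mono, Finsupp.single_apply]

theorem negH_oneG : negH oneG = hTheta := by
  rw [negH_apply]
  simp [oneG, gmono, mono]

/-- The part of nonnegative degree of an element of `𝔤`. -/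
def gePart (x : G) : G := x - x.1 (0, ∅) • oneG - ∑ i, x.1 (0, {i}) • xi {i}

theorem gePart_mem (x : G) : gePart x ∈ gGe := by
  refine ⟨?_, Submodule.mem_top⟩
  intro a ha
  by_contra hn
  apply Finsupp.mem_support_iff.1 ha
  obtain ⟨m, I⟩ := a
  have h2 : 2 * (m : ℤ) + I.card - 2 < 0 := not_le.1 hn
  have hm : m = 0 := by omega
  have hI : I.card ≤ 1 := by omega
  subst hm
  rcases Nat.le_one_iff_eq_zero_or_eq_one.1 hI with h0 | h1
  · rw [Finset.card_eq_zero] at h0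
    subst h0
    simp [gePart, oneG, gmono, xi, mono, Prod.fst_sum]
  · obtain ⟨i, rfl⟩ := Finset.card_eq_one.1 h1
    simp [gePart, oneG, gmono, xi, mono, Prod.fst_sum, Finsupp.single_apply]

theorem eq_gePart_add (x : G) :
    x = gePart x + (x.1 (0, ∅) • oneG + ∑ i, x.1 (0, {i}) • xi {i}) := by
  rw [gePart]; abel

/-! # The action of `𝔤` on `H ⊗ F` -/

section Model

variable {F : Type} [AddCommGroup F] [Module ℂ F]

/-- The operator by which `η_i` acts on `Hom(𝔤, H ⊗ F)`. -/
def homEta (i : Fin 4) : Module.End ℂ (G →ₗ[ℂ] H ⊗[ℂ] F) where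
  toFun f :=
    -- Here `f` stands for `x ↦ x.z`, and the formula gives `x ↦ x.(η_i z)`: in the enveloping
    -- algebra `x η_i` equals `η_i x̄ + [x, ξ_i]`, where `x̄` is `x` with the sign of its parity.
    { toFun := fun x => hEta i • f (parG x) + f (lieBr x (xi {i}))
      map_add' := fun x y => by
        rw [map_add, map_add, lieBr_add_left, map_add, smul_add]; abel
      map_smul' := fun c x => by
        rw [map_smul, map_smul, lieBr_smul_left, map_smul, smul_comm, RingHom.id_apply, smul_add] }
  map_add' f g := by
    refine LinearMap.ext fun x => ?_
    simp only [LinearMap.add_apply, LinearMap.coe_mk, AddHom.coe_mk, smul_add]; abel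
  map_smul' c f := by
    refine LinearMap.ext fun x => ?_
    simp only [LinearMap.smul_apply, LinearMap.coe_mk, AddHom.coe_mk, RingHom.id_apply, smul_add]
    rw [smul_comm]

theorem homEta_apply (i : Fin 4) (f : G →ₗ[ℂ] H ⊗[ℂ] F) (x : G) :
    homEta i f x = hEta i • f (parG x) + f (lieBr x (xi {i})) := rfl

/-- The mixed terms cancel because `[·, ξ_k]` anticommutes with the parity involution. What remains
is the anticommutator of `η_i` and `η_j`, together with that of `[·, ξ_i]` and `[·, ξ_j]`, which for
`i = j` does not depend on `i`. Hence `H` acts on `Hom(𝔤, H ⊗ F)` by its universal property, and no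
basis of `H` is needed. -/
theorem homEta_anticomm (i j : Fin 4) :
    homEta (F := F) i * homEta j + homEta j * homEta i =
      if i = j then homEta 0 * homEta 0 + homEta 0 * homEta 0 else 0 := by
  have key : ∀ (i j : Fin 4) (f : G →ₗ[ℂ] H ⊗[ℂ] F) (x : G),
      homEta i (homEta j f) x + homEta j (homEta i f) x =
        (hEta i * hEta j + hEta j * hEta i) • f x + f (if i = j then -lieBr x oneG else 0) := by
    intro i j f x
    have hP : ∀ k, parG (lieBr x (xi {k})) = -lieBr (parG x) (xi {k}) := fun k => by
      rw [parG_lieBr, parG_xi, lieBr_neg_right]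
    rw [← lieBr_lieBr_xi, map_add]
    simp only [homEta_apply, parG_parG, hP, map_neg, smul_neg, smul_add, add_smul, mul_smul]
    abel
  refine LinearMap.ext fun f => LinearMap.ext fun x => ?_
  have h := key i j f x
  have h0 := key 0 0 f x
  rw [hEta_anticomm i j] at h
  by_cases hij : i = j
  · simp only [if_pos hij, if_true] at h h0 ⊢
    exact h.trans h0.symm
  · simp only [if_neg hij, map_zero, zero_smul, add_zero] at h ⊢
    exact h

/-- The action of `H` on `Hom(𝔤, H ⊗ F)`. -/
def homAct : H →ₐ[ℂ] Module.End ℂ (G →ₗ[ℂ] H ⊗[ℂ] F) :=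
  hLift (homEta (F := F)) homEta_anticomm

/-- The map `v ↦ (x ↦ x.(1 ⊗ v))`. -/
def baseHom (r : G →ₗ[ℂ] Module.End ℂ F) : F →ₗ[ℂ] G →ₗ[ℂ] H ⊗[ℂ] F :=
  LinearMap.flip (r.compr₂ (TensorProduct.mk ℂ H F 1) + (TensorProduct.mk ℂ H F) ∘ₗ negH)

theorem baseHom_apply (r : G →ₗ[ℂ] Module.End ℂ F) (v : F) (x : G) : baseHom r v x = 1 ⊗ₜ r x v + negH x ⊗ₜ v := by
  simp [baseHom]

/-- The action of `𝔤` on `H ⊗ F`. -/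
def rhoH (r : G →ₗ[ℂ] Module.End ℂ F) : G →ₗ[ℂ] Module.End ℂ (H ⊗[ℂ] F) :=
  LinearMap.flip (TensorProduct.lift
    (LinearMap.flip ((LinearMap.flip (homAct (F := F)).toLinearMap) ∘ₗ baseHom r)))

theorem rhoH_tmul (r : G →ₗ[ℂ] Module.End ℂ F) (x : G) (u : H) (v : F) : rhoH r x (u ⊗ₜ v) = homAct u (baseHom r v) x := by
  simp [rhoH]

theorem rhoH_one (r : G →ₗ[ℂ] Module.End ℂ F) (x : G) (v : F) : rhoH r x (1 ⊗ₜ v) = 1 ⊗ₜ r x v + negH x ⊗ₜ v := by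
  rw [rhoH_tmul, map_one, Module.End.one_apply, baseHom_apply]

theorem rhoH_smul (r : G →ₗ[ℂ] Module.End ℂ F) (x : G) (i : Fin 4) (z : H ⊗[ℂ] F) :
    rhoH r x (hEta i • z) = hEta i • rhoH r (parG x) z + rhoH r (lieBr x (xi {i})) z := by
  induction z using TensorProduct.induction_on with
  | zero => simp
  | add a b ha hb => simp only [smul_add, map_add, ha, hb]; abel
  | tmul u v =>
    rw [TensorProduct.smul_tmul', smul_eq_mul, rhoH_tmul, map_mul, Module.End.mul_apply, homAct,
      hLift_hEta, homEta_apply, ← homAct, rhoH_tmul, rhoH_tmul]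

/-- The elements of the algebra that preserve `N` form a subalgebra, so it suffices that generators
preserve `N` and that `N` contains the vectors `1 ⊗ v`. -/
theorem tensor_induction {A : Type*} [Ring A] [Algebra ℂ A] {s : Set A}
    (hs : Algebra.adjoin ℂ s = ⊤) (N : Submodule ℂ (A ⊗[ℂ] F)) (h1 : ∀ v : F, 1 ⊗ₜ[ℂ] v ∈ N)
    (hη : ∀ a ∈ s, ∀ z ∈ N, a • z ∈ N) (z : A ⊗[ℂ] F) : z ∈ N := by
  let B : Subalgebra ℂ A :=
    { carrier := {u | ∀ z ∈ N, u • z ∈ N}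
      mul_mem' := fun {a b} ha hb z hz => by rw [mul_smul]; exact ha _ (hb _ hz)
      add_mem' := fun {a b} ha hb z hz => by rw [add_smul]; exact N.add_mem (ha _ hz) (hb _ hz)
      algebraMap_mem' := fun c z hz => by rw [algebraMap_smul]; exact N.smul_mem _ hz }
  have hB : B = ⊤ := by
    rw [eq_top_iff, ← hs]
    exact Algebra.adjoin_le hη
  induction z using TensorProduct.induction_on with
  | zero => exact N.zero_mem
  | add a b ha hb => exact N.add_mem ha hb
  | tmul u v =>
    have hu : u ∈ B := hB ▸ Algebra.mem_top
    have := hu _ (h1 v)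
    rwa [TensorProduct.smul_tmul', smul_eq_mul, mul_one] at this

theorem model_induction (N : Submodule ℂ (H ⊗[ℂ] F)) (h1 : ∀ v : F, 1 ⊗ₜ[ℂ] v ∈ N)
    (hη : ∀ i, ∀ z ∈ N, hEta i • z ∈ N) (z : H ⊗[ℂ] F) : z ∈ N :=
  tensor_induction adjoin_hEta N h1 (by rintro _ ⟨i, rfl⟩; exact hη i) z

/-- Apply the rule for `η_0` twice: `Θ = -2 η_0²`, the two parity signs cancel, and `[x, 1] = -2
[[x, ξ_0], ξ_0]`. -/
theorem rhoH_smul_theta (r : G →ₗ[ℂ] Module.End ℂ F) (x : G) (z : H ⊗[ℂ] F) :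
    rhoH r x (hTheta • z) = hTheta • rhoH r x z + rhoH r (lieBr x oneG) z := by
  have h := lieBr_lieBr_xi x 0 0
  rw [if_pos rfl] at h
  have h' : lieBr x oneG = (-2 : ℂ) • lieBr (lieBr x (xi {0})) (xi {0}) := by
    rw [← neg_neg (lieBr x oneG), ← h]; module
  have hP : parG (lieBr x (xi {0})) = -lieBr (parG x) (xi {0}) := by
    rw [parG_lieBr, parG_xi, lieBr_neg_right]
  rw [hTheta, smul_assoc, mul_smul, map_smul, rhoH_smul, rhoH_smul, rhoH_smul, h', hP, parG_parG,
    smul_assoc, mul_smul]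
  simp only [map_smul, map_neg, LinearMap.neg_apply, LinearMap.smul_apply, smul_add, smul_neg]
  abel

/-- An action of `𝔤_{≥0}`, extended to `𝔤` by `0` on `𝔤_{<0}`, in which the odd elements act by
`0`. -/
structure IsGeRep (r : G →ₗ[ℂ] Module.End ℂ F) : Prop where
  xi : ∀ i, r (xi {i}) = 0
  oneG : r oneG = 0
  par : ∀ x, r (parG x) = r x
  lie : ∀ x ∈ gGe, ∀ y ∈ gGe, r (lieBr x y) = r x * r y - r y * r x

/-- By induction along the generators: for `j ≠ i` this is the anticommutation of `η_i` and `η_j`;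
for `j = i` the bracket `[ξ_i, ξ_i] = -1` adds `-Θ = 2 η_i²` to `-η_i²`. -/
theorem rhoH_xi {r : G →ₗ[ℂ] Module.End ℂ F} (hr : IsGeRep r) (i : Fin 4) (z : H ⊗[ℂ] F) :
    rhoH r (xi {i}) z = hEta i • z := by
  -- The element `1` of `K(1,4)₊` has to be settled first, since the case `j = i` produces it.
  have hθ : ∀ z : H ⊗[ℂ] F, rhoH r oneG z = hTheta • z := by
    refine fun z => model_induction (LinearMap.eqLocus (rhoH r oneG)
      (Module.toModuleEnd ℂ (S := H) (H ⊗[ℂ] F) hTheta)) ?_ ?_ z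
    · intro v
      simp [rhoH_one, hr.oneG, negH_oneG, TensorProduct.smul_tmul']
    · intro i z hz
      have hz : rhoH r oneG z = hTheta • z := hz
      change rhoH r oneG (hEta i • z) = hTheta • (hEta i • z)
      rw [rhoH_smul, parG_oneG, hz, lieBr_oneG_xi, map_zero, LinearMap.zero_apply, add_zero,
        ← mul_smul, ← mul_smul, hTheta_comm]
  refine model_induction (LinearMap.eqLocus (rhoH r (xi {i}))
      (Module.toModuleEnd ℂ (S := H) (H ⊗[ℂ] F) (hEta i))) ?_ ?_ z
  · intro v
    simp [rhoH_one, hr.xi, negH_xi, TensorProduct.smul_tmul']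
  · intro j z hz
    have hz : rhoH r (xi {i}) z = hEta i • z := hz
    change rhoH r (xi {i}) (hEta j • z) = hEta i • (hEta j • z)
    rw [rhoH_smul, parG_xi, map_neg, LinearMap.neg_apply, hz, lieBr_xi_xi]
    split_ifs with h
    · subst h
      rw [map_neg, LinearMap.neg_apply, hθ, hTheta_eq i, smul_assoc, mul_smul, smul_neg]
      generalize hEta i • hEta i • z = w
      module
    · rw [map_zero, LinearMap.zero_apply, add_zero, smul_neg, ← mul_smul, ← mul_smul,
        hEta_mul_of_ne h, neg_smul]

theorem rhoH_oneG {r : G →ₗ[ℂ] Module.End ℂ F} (hr : IsGeRep r) (z : H ⊗[ℂ] F) :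
    rhoH r oneG z = hTheta • z := by
  have h := lieBr_xi_xi 0 0
  rw [if_pos rfl] at h
  have h2 := rhoH_smul r (xi {0}) 0 z
  rw [h, parG_xi, map_neg, LinearMap.neg_apply, map_neg, LinearMap.neg_apply, rhoH_xi hr,
    rhoH_xi hr] at h2
  rw [hTheta, smul_assoc, mul_smul]
  rw [smul_neg] at h2
  generalize hEta 0 • hEta 0 • z = w at h2 ⊢
  generalize rhoH r oneG z = w' at h2 ⊢
  linear_combination (norm := module) h2

theorem rhoH_of_mem {r : G →ₗ[ℂ] Module.End ℂ F} {x : G} (hx : x ∈ gGe) (v : F) :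
    rhoH r x (1 ⊗ₜ v) = 1 ⊗ₜ r x v := by
  rw [rhoH_one, negH_of_mem hx, TensorProduct.zero_tmul, add_zero]

theorem degB_symmDiff : ∀ I J : Finset (Fin 4), (brC I J ≠ 0 →
    (symmDiff I J).card + 2 = I.card + J.card) ∧ (sgnZ I J ≠ 0 →
    (symmDiff I J).card = I.card + J.card) ∧ (cocZ I J ≠ 0 → I.card + J.card = 4) := by
  decide +kernel

/-- The grading is compatible with the bracket. -/
theorem lieBr_gmono_mem (m n : ℕ) (I J : Finset (Fin 4)) (K : Submodule ℂ G)
    (hC : degB (m, I) + degB (n, J) = 0 → cG ∈ K)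
    (h : ∀ k L, degB (k, L) = degB (m, I) + degB (n, J) → gmono k L ∈ K) :
    lieBr (gmono m I) (gmono n J) ∈ K := by
  obtain ⟨h1, h2, h3⟩ := degB_symmDiff I J
  rw [lieBr_gmono]
  refine K.add_mem (K.add_mem ?_ ?_) ?_
  · by_cases hs : sgnZ I J = 0
    · simp [brL, brR, hs]
    -- For `m = n = 0` the truncated exponent `m + n - 1` has the wrong degree, but its coefficient
    -- is zero.
    by_cases hmn : m + n = 0
    · obtain ⟨rfl, rfl⟩ := Nat.add_eq_zero_iff.1 hmn
      simp
    refine K.smul_mem _ (h _ _ ?_)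
    have := h2 hs
    simp only [degB]
    omega
  · by_cases hs : brC I J = 0
    · simp [hs]
    refine K.smul_mem _ (h _ _ ?_)
    have := h1 hs
    simp only [degB]
    omega
  · by_cases hs : cocZ I J = 0
    · simp [hs]
    split_ifs with hmn
    · refine K.smul_mem _ (hC ?_)
      have := h3 hs
      simp only [degB]
      omega
    · simp

theorem gmono_mem_gGe {m : ℕ} {I : Finset (Fin 4)} (h : 0 ≤ degB (m, I)) : gmono m I ∈ gGe :=
  ⟨Finsupp.single_mem_supported ℂ (1 : ℂ) h, Submodule.mem_top⟩

theorem cG_mem_gGe : cG ∈ gGe := ⟨Submodule.zero_mem _, Submodule.mem_top⟩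

/-- `𝔤_{≥0}` is spanned by the basis vectors that it contains. -/
theorem gGe_induction {P : G → Prop} (hz : P 0) (hadd : ∀ x y, P x → P y → P (x + y))
    (hsmul : ∀ (c : ℂ) x, P x → P (c • x)) (hC : P cG)
    (h : ∀ m I, 0 ≤ degB (m, I) → P (gmono m I)) {x : G} (hx : x ∈ gGe) : P x := by
  have hK : ∀ k : KPlus, k ∈ Finsupp.supported ℂ ℂ {a | 0 ≤ degB a} → P (k, 0) := by
    intro k hk
    rw [Finsupp.mem_supported] at hk
    have : (k, (0 : ℂ)) = ∑ a ∈ k.support, k a • gmono a.1 a.2 := by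
      ext1
      · rw [Prod.fst_sum]
        conv_lhs => rw [← Finsupp.sum_single k]
        simp [Finsupp.sum, gmono, mono]
      · rw [Prod.snd_sum]
        simp [gmono]
    rw [this]
    refine Finset.sum_induction _ P hadd hz fun a ha => hsmul _ _ (h _ _ (hk ha))
  have hx2 : x = (x.1, 0) + x.2 • cG := by
    ext1 <;> simp [cG]
  rw [hx2]
  exact hadd _ _ (hK _ hx.1) (hsmul _ _ hC)

theorem lieBr_mem_gGe {x y : G} (hx : x ∈ gGe) (hy : y ∈ gGe) : lieBr x y ∈ gGe := by
  refine gGe_induction (P := fun x => lieBr x y ∈ gGe) (by simp [← lieL_apply])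
    (fun a b ha hb => by rw [lieBr_add_left]; exact gGe.add_mem ha hb)
    (fun c a ha => by rw [lieBr_smul_left]; exact gGe.smul_mem _ ha)
    (by rw [lieBr_cG_left]; exact gGe.zero_mem) (fun m I hI => ?_) hx
  refine gGe_induction (P := fun y => lieBr (gmono m I) y ∈ gGe) (by simp [← lieL_apply])
    (fun a b ha hb => by rw [lieBr_add_right]; exact gGe.add_mem ha hb)
    (fun c a ha => by rw [lieBr_smul_right]; exact gGe.smul_mem _ ha)
    (by rw [lieBr_cG_right]; exact gGe.zero_mem) (fun n J hJ => ?_) hy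
  exact lieBr_gmono_mem m n I J gGe (fun _ => cG_mem_gGe) fun k L hk =>
    gmono_mem_gGe (hk ▸ add_nonneg hI hJ)

end Model

/-! ### Commutation relations for the action on `H ⊗ F` -/

section Model

variable {F : Type} [AddCommGroup F] [Module ℂ F]

/-- Elements of parity `p`. -/
def HasParity (p : ℕ) (x : G) : Prop := parG x = ((-1 : ℂ) ^ p) • x

theorem HasParity.lieBr {p q : ℕ} {x y : G} (hx : HasParity p x) (hy : HasParity q y) :
    HasParity (p + q) (lieBr x y) := by
  unfold HasParity at *
  rw [parG_lieBr, hx, hy, lieBr_smul_left, lieBr_smul_right, smul_smul, pow_add]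

theorem hasParity_xi (i : Fin 4) : HasParity 1 (xi {i}) := by
  rw [HasParity, parG_xi]; module

theorem hasParity_of_mem {p : Fin 2} {x : G} (hx : x ∈ parPart p) : HasParity p x := by
  obtain ⟨h1, h2⟩ := hx
  refine Prod.ext ?_ ?_
  · change parInv x.1 = ((-1 : ℂ) ^ (p : ℕ)) • x.1
    conv_lhs => rw [← Finsupp.sum_single x.1]
    conv_rhs => rw [← Finsupp.sum_single x.1]
    rw [Finsupp.sum, map_sum, Finset.smul_sum]
    refine Finset.sum_congr rfl fun a ha => ?_
    have h3 : a.2.card % 2 = (p : ℕ) := h1 ha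
    have h4 : parInv (mono a.1 a.2) = ((-1 : ℂ) ^ (p : ℕ)) • mono a.1 a.2 := by
      rw [parInv_mono, neg_one_pow_eq_pow_mod_two, h3]
    have h5 : Finsupp.single a (x.1 a) = x.1 a • mono a.1 a.2 := by simp [mono]
    rw [h5, map_smul, h4, smul_comm]
  · change x.2 = ((-1 : ℂ) ^ (p : ℕ)) • x.2
    fin_cases p
    · simp
    · have h3 : x.2 = 0 := by simpa using h2
      simp [h3]

theorem parInv_apply (k : KPlus) (m : ℕ) (I : Finset (Fin 4)) :
    parInv k (m, I) = (-1 : ℂ) ^ I.card * k (m, I) := by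
  induction k using Finsupp.induction_linear with
  | zero => simp
  | add f g hf hg => rw [map_add, Finsupp.add_apply, hf, hg, Finsupp.add_apply, mul_add]
  | single a c =>
    by_cases h : a = (m, I)
    · subst h
      simp [parInv, mono, mul_comm]
    · simp [parInv, mono, h]

theorem HasParity.coeff {p : ℕ} {x : G} (hx : HasParity p x) (m : ℕ) (I : Finset (Fin 4)) :
    (-1 : ℂ) ^ I.card * x.1 (m, I) = (-1) ^ p * x.1 (m, I) := by
  have := congrArg (fun y : G => y.1 (m, I)) hx
  simpa [parG, parInv_apply] using this

theorem HasParity.coeff_smul_oneG {p : ℕ} {x : G} (hx : HasParity p x) :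
    HasParity p (x.1 (0, ∅) • oneG) := by
  have := hx.coeff 0 ∅
  rw [Finset.card_empty, pow_zero, one_mul] at this
  rw [HasParity, map_smul, parG_oneG, smul_smul, ← this]

theorem HasParity.coeff_smul_xi {p : ℕ} {x : G} (hx : HasParity p x) (i : Fin 4) :
    HasParity p (x.1 (0, {i}) • xi {i}) := by
  have := hx.coeff 0 {i}
  rw [Finset.card_singleton, pow_one, neg_one_mul] at this
  rw [HasParity, map_smul, parG_xi, smul_smul, ← this]; module

theorem HasParity.sub {p : ℕ} {x y : G} (hx : HasParity p x) (hy : HasParity p y) :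
    HasParity p (x - y) := by
  unfold HasParity at *
  rw [map_sub, hx, hy, smul_sub]

theorem HasParity.sum {p : ℕ} {x : Fin 4 → G} (hx : ∀ i, HasParity p (x i)) :
    HasParity p (∑ i, x i) := by
  unfold HasParity at *
  rw [map_sum, Finset.smul_sum]
  exact Finset.sum_congr rfl fun i _ => hx i

theorem HasParity.gePart {p : ℕ} {x : G} (hx : HasParity p x) : HasParity p (gePart x) :=
  (hx.sub hx.coeff_smul_oneG).sub (HasParity.sum hx.coeff_smul_xi)

/-- The defect of the commutation relation. -/
def defect (r : G →ₗ[ℂ] Module.End ℂ F) (s : ℂ) (x y : G) : Module.End ℂ (H ⊗[ℂ] F) :=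
  rhoH r x * rhoH r y - s • (rhoH r y * rhoH r x) - rhoH r (lieBr x y)

theorem defect_add_left (r : G →ₗ[ℂ] Module.End ℂ F) (s : ℂ) (x x' y : G) :
    defect r s (x + x') y = defect r s x y + defect r s x' y := by
  simp only [defect, map_add, lieBr_add_left, add_mul, mul_add, smul_add]; abel

theorem defect_add_right (r : G →ₗ[ℂ] Module.End ℂ F) (s : ℂ) (x y y' : G) :
    defect r s x (y + y') = defect r s x y + defect r s x y' := by
  simp only [defect, map_add, lieBr_add_right, add_mul, mul_add, smul_add]; abel

theorem defect_smul_left (r : G →ₗ[ℂ] Module.End ℂ F) (s c : ℂ) (x y : G) :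
    defect r s (c • x) y = c • defect r s x y := by
  refine LinearMap.ext fun z => ?_
  simp only [defect, map_smul, lieBr_smul_left, LinearMap.sub_apply, LinearMap.smul_apply,
    Module.End.mul_apply]
  module

theorem defect_smul_right (r : G →ₗ[ℂ] Module.End ℂ F) (s c : ℂ) (x y : G) :
    defect r s x (c • y) = c • defect r s x y := by
  refine LinearMap.ext fun z => ?_
  simp only [defect, map_smul, lieBr_smul_right, LinearMap.sub_apply, LinearMap.smul_apply,
    Module.End.mul_apply]
  module

theorem defect_sum_left (r : G →ₗ[ℂ] Module.End ℂ F) (s : ℂ) (x : Fin 4 → G) (y : G) :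
    defect r s (∑ i, x i) y = ∑ i, defect r s (x i) y := by
  simp only [Fin.sum_univ_four, defect_add_left]

theorem defect_sum_right (r : G →ₗ[ℂ] Module.End ℂ F) (s : ℂ) (x : G) (y : Fin 4 → G) :
    defect r s x (∑ i, y i) = ∑ i, defect r s x (y i) := by
  simp only [Fin.sum_univ_four, defect_add_right]

theorem defect_xi_left {r : G →ₗ[ℂ] Module.End ℂ F} (hr : IsGeRep r) {q : ℕ} {y : G}
    (hy : HasParity q y) (i : Fin 4) : defect r ((-1) ^ q) (xi {i}) y = 0 := by
  refine LinearMap.ext fun z => ?_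
  unfold HasParity at hy
  simp only [defect, LinearMap.sub_apply, LinearMap.smul_apply, Module.End.mul_apply,
    rhoH_xi hr, rhoH_smul, lieBr_xi_left, hy, lieBr_smul_left, map_neg, map_smul,
    LinearMap.neg_apply, LinearMap.zero_apply, smul_add, smul_smul, ← mul_pow, smul_comm (hEta i)]
  simp

theorem defect_xi_right {r : G →ₗ[ℂ] Module.End ℂ F} (hr : IsGeRep r) {p : ℕ} {x : G}
    (hx : HasParity p x) (i : Fin 4) : defect r ((-1) ^ p) x (xi {i}) = 0 := by
  refine LinearMap.ext fun z => ?_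
  unfold HasParity at hx
  simp only [defect, LinearMap.sub_apply, LinearMap.smul_apply, Module.End.mul_apply,
    rhoH_xi hr, rhoH_smul, hx, map_smul, LinearMap.zero_apply, smul_comm (hEta i)]
  abel

theorem defect_oneG_left {r : G →ₗ[ℂ] Module.End ℂ F} (hr : IsGeRep r) (y : G) :
    defect r 1 oneG y = 0 := by
  refine LinearMap.ext fun z => ?_
  simp only [defect, LinearMap.sub_apply, Module.End.mul_apply,
    rhoH_oneG hr, rhoH_smul_theta, lieBr_oneG_left, map_neg, one_smul,
    LinearMap.neg_apply, LinearMap.zero_apply]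
  abel

theorem defect_oneG_right {r : G →ₗ[ℂ] Module.End ℂ F} (hr : IsGeRep r) (x : G) :
    defect r 1 x oneG = 0 := by
  refine LinearMap.ext fun z => ?_
  simp only [defect, LinearMap.sub_apply, Module.End.mul_apply,
    rhoH_oneG hr, rhoH_smul_theta, one_smul, LinearMap.zero_apply]
  abel

/-- Moving `η_i` to the left through both operators and through the bracket, and expanding `[[x, y],
ξ_i]` by the Jacobi identity, writes the defect at `η_i z` in terms of defects at `z`, for the pairs
`(x, y)`, `(x, [y, ξ_i])` and `([x, ξ_i], y)`. -/
theorem defect_smul {r : G →ₗ[ℂ] Module.End ℂ F} {p q : ℕ} {x y : G}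
    (hx : HasParity p x) (hy : HasParity q y) (i : Fin 4) (z : H ⊗[ℂ] F) :
    defect r ((-1) ^ (p * q)) x y (hEta i • z) =
      ((-1 : ℂ) ^ (p + q)) • hEta i • defect r ((-1) ^ (p * q)) x y z
        + defect r ((-1) ^ (p * (q + 1))) x (lieBr y (xi {i})) z
        + ((-1 : ℂ) ^ q) • defect r ((-1) ^ ((p + 1) * q)) (lieBr x (xi {i})) y z := by
  have hxy := hx.lieBr hy
  unfold HasParity at hx hy hxy
  simp only [defect, LinearMap.sub_apply, LinearMap.smul_apply, Module.End.mul_apply,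
    rhoH_smul, hx, hy, hxy, map_smul, map_add, smul_add, jacobi_xi, lieBr_smul_right,
    LinearMap.add_apply, smul_sub, smul_comm (hEta i)]
  have hL : ∀ w : H ⊗[ℂ] F, hEta i • w = Module.toModuleEnd ℂ (S := H) (H ⊗[ℂ] F) (hEta i) w :=
    fun _ => rfl
  simp only [hL, smul_smul, mul_add, add_mul, mul_one, one_mul, pow_add]
  rcases neg_one_pow_eq_or ℂ q with h | h <;> simp only [h] <;> module

/-- `F` is purely even: an odd `x` equals minus itself in its action, hence acts by zero, and the
supersign is immaterial. -/
theorem IsGeRep.smul_eq {r : G →ₗ[ℂ] Module.End ℂ F} (hr : IsGeRep r) {p : ℕ} {x : G}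
    (hx : HasParity p x) (q : ℕ) (y : G) :
    ((-1 : ℂ) ^ (p * q)) • (r y * r x) = r y * r x := by
  have h1 : r x = ((-1 : ℂ) ^ p) • r x := by rw [← map_smul, ← hx, hr.par]
  rcases neg_one_pow_eq_or ℂ p with h | h
  · rw [pow_mul, h, one_pow, one_smul]
  · rw [h] at h1
    have h2 : r x = 0 := by
      refine LinearMap.ext fun v => ?_
      have := LinearMap.congr_fun h1 v
      rw [LinearMap.smul_apply, neg_one_smul] at this
      have h3 : (2 : ℂ) • r x v = 0 := by rw [two_smul]; nth_rewrite 1 [this]; exact neg_add_cancel _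
      exact (smul_eq_zero.1 h3).resolve_left two_ne_zero
    rw [h2, mul_zero, smul_zero]

theorem HasParity.coeff_oneG {p : ℕ} {x : G} (hx : HasParity p x) :
    (-1 : ℂ) ^ p = 1 ∨ x.1 (0, ∅) = 0 := by
  have := hx.coeff 0 ∅
  rcases neg_one_pow_eq_or ℂ p with h | h
  · exact Or.inl h
  · rw [h, Finset.card_empty, pow_zero, one_mul, neg_one_mul] at this
    exact Or.inr (self_eq_neg.1 this)

theorem HasParity.coeff_xi {p : ℕ} {x : G} (hx : HasParity p x) (i : Fin 4) :
    (-1 : ℂ) ^ p = -1 ∨ x.1 (0, {i}) = 0 := by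
  have := hx.coeff 0 {i}
  rcases neg_one_pow_eq_or ℂ p with h | h
  · rw [h, Finset.card_singleton, pow_one, neg_one_mul, one_mul] at this
    exact Or.inr (neg_eq_self.1 this)
  · exact Or.inl h

/-- A homogeneous `x` has a component along `1` only if it is even and along `ξ_i` only if it is
odd. So whenever a component is nonzero, the sign is the one for which the defect is known to
vanish. -/
theorem defect_neg_left {r : G →ₗ[ℂ] Module.End ℂ F} (hr : IsGeRep r) {p q : ℕ} {x y : G}
    (hx : HasParity p x) (hy : HasParity q y) :
    defect r ((-1) ^ (p * q)) (x.1 (0, ∅) • oneG + ∑ i, x.1 (0, {i}) • xi {i}) y = 0 := by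
  rw [defect_add_left, defect_sum_left, defect_smul_left, pow_mul]
  have h1 : x.1 (0, ∅) • defect r (((-1) ^ p) ^ q) oneG y = 0 := by
    rcases hx.coeff_oneG with h | h
    · rw [h, one_pow, defect_oneG_left hr, smul_zero]
    · rw [h, zero_smul]
  rw [h1, zero_add]
  refine Finset.sum_eq_zero fun i _ => ?_
  rw [defect_smul_left]
  rcases hx.coeff_xi i with h | h
  · rw [h, defect_xi_left hr hy, smul_zero]
  · rw [h, zero_smul]

theorem defect_neg_right {r : G →ₗ[ℂ] Module.End ℂ F} (hr : IsGeRep r) {p q : ℕ} {x y : G}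
    (hx : HasParity p x) (hy : HasParity q y) :
    defect r ((-1) ^ (p * q)) x (y.1 (0, ∅) • oneG + ∑ i, y.1 (0, {i}) • xi {i}) = 0 := by
  rw [defect_add_right, defect_sum_right, defect_smul_right, mul_comm, pow_mul]
  have h1 : y.1 (0, ∅) • defect r (((-1) ^ q) ^ p) x oneG = 0 := by
    rcases hy.coeff_oneG with h | h
    · rw [h, one_pow, defect_oneG_right hr, smul_zero]
    · rw [h, zero_smul]
  rw [h1, zero_add]
  refine Finset.sum_eq_zero fun i _ => ?_
  rw [defect_smul_right]
  rcases hy.coeff_xi i with h | h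
  · rw [h, defect_xi_right hr hx, smul_zero]
  · rw [h, zero_smul]

/-- Modulo the components in `𝔤_{<0}`, whose defects vanish, `x` and `y` lie in `𝔤_{≥0}`. That
subalgebra preserves `1 ⊗ F` and acts there by the given representation. -/
theorem defect_one {r : G →ₗ[ℂ] Module.End ℂ F} (hr : IsGeRep r) {p q : ℕ} {x y : G}
    (hx : HasParity p x) (hy : HasParity q y) (v : F) :
    defect r ((-1) ^ (p * q)) x y (1 ⊗ₜ v) = 0 := by
  have e : defect r ((-1) ^ (p * q)) x y =
      defect r ((-1) ^ (p * q)) (gePart x) (gePart y) := by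
    conv_lhs => rw [eq_gePart_add x]
    rw [defect_add_left, defect_neg_left hr hx hy, add_zero]
    conv_lhs => rw [eq_gePart_add y]
    rw [defect_add_right, defect_neg_right hr hx.gePart hy, add_zero]
  rw [e]
  have h2 := LinearMap.congr_fun (hr.smul_eq hx.gePart q (gePart y)) v
  simp only [LinearMap.smul_apply, Module.End.mul_apply] at h2
  simp only [defect, LinearMap.sub_apply, LinearMap.smul_apply, Module.End.mul_apply,
    rhoH_of_mem (gePart_mem x), rhoH_of_mem (gePart_mem y),
    rhoH_of_mem (lieBr_mem_gGe (gePart_mem x) (gePart_mem y)),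
    hr.lie _ (gePart_mem x) _ (gePart_mem y)]
  rw [← TensorProduct.tmul_smul, h2, TensorProduct.tmul_sub, sub_self]

theorem defect_eq_zero {r : G →ₗ[ℂ] Module.End ℂ F} (hr : IsGeRep r) {p q : ℕ} {x y : G}
    (hx : HasParity p x) (hy : HasParity q y) : defect r ((-1) ^ (p * q)) x y = 0 := by
  -- All pairs `x, y` are quantified inside the induction, because the step replaces them by their
  -- brackets with `ξ_i`.
  let N : Submodule ℂ (H ⊗[ℂ] F) :=
    { carrier := {z | ∀ (p q : ℕ) (x y : G), HasParity p x → HasParity q y →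
        defect r ((-1) ^ (p * q)) x y z = 0}
      add_mem' := fun ha hb p q x y hx hy => by
        rw [map_add, ha p q x y hx hy, hb p q x y hx hy, add_zero]
      zero_mem' := fun p q x y _ _ => map_zero _
      smul_mem' := fun c z hz p q x y hx hy => by rw [map_smul, hz p q x y hx hy, smul_zero] }
  refine LinearMap.ext fun z => ?_
  refine model_induction N (fun v p q x y hx hy => defect_one hr hx hy v) ?_ z p q x y hx hy
  intro i z hz p q x y hx hy
  rw [defect_smul hx hy, hz p q x y hx hy, hz p (q + 1) _ _ hx (hy.lieBr (hasParity_xi i)),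
    hz (p + 1) q _ _ (hx.lieBr (hasParity_xi i)) hy]
  simp

/-- The action of `U(𝔤)` on `H ⊗ F`. -/
def rhoU {r : G →ₗ[ℂ] Module.End ℂ F} (hr : IsGeRep r) : U →ₐ[ℂ] Module.End ℂ (H ⊗[ℂ] F) :=
  (show RingQuot URel →ₐ[ℂ] Module.End ℂ (H ⊗[ℂ] F) from
    RingQuot.liftAlgHom ℂ ⟨TensorAlgebra.lift ℂ (rhoH r), by
      rintro _ _ ⟨hx, hy⟩
      have := defect_eq_zero hr (hasParity_of_mem hx) (hasParity_of_mem hy)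
      refine LinearMap.ext fun z => ?_
      have h := LinearMap.congr_fun this z
      simp only [defect, LinearMap.sub_apply, LinearMap.smul_apply, Module.End.mul_apply,
        LinearMap.zero_apply] at h
      rw [sub_sub, sub_eq_zero] at h
      simpa using h⟩)

theorem rhoU_iota {r : G →ₗ[ℂ] Module.End ℂ F} (hr : IsGeRep r) (x : G) :
    rhoU hr (iota x) = rhoH r x := by
  have : rhoU hr (iota x) = TensorAlgebra.lift ℂ (rhoH r) (TensorAlgebra.ι ℂ x) :=
    RingQuot.liftAlgHom_mkAlgHom_apply ℂ _ _ _
  simpa using this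

end Model

/-! # The Poincaré–Birkhoff–Witt identification -/

/-- The projection from the tensor algebra. -/
def uMk : TensorAlgebra ℂ G →ₐ[ℂ] U :=
  (show TensorAlgebra ℂ G →ₐ[ℂ] RingQuot URel from RingQuot.mkAlgHom ℂ URel)

theorem uMk_ι (x : G) : uMk (TensorAlgebra.ι ℂ x) = iota x := rfl

theorem iota_mul_iota {p q : Fin 2} {x y : G} (hx : x ∈ parPart p) (hy : y ∈ parPart q) :
    iota x * iota y =
      ((-1 : ℂ) ^ ((p : ℕ) * (q : ℕ))) • (iota y * iota x) + iota (lieBr x y) := by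
  have h : uMk _ = uMk _ := RingQuot.mkAlgHom_rel ℂ (URel.comm hx hy)
  simpa [uMk_ι] using h

theorem adjoin_iota : Algebra.adjoin ℂ (Set.range iota) = ⊤ := by
  have hf : Function.Surjective uMk := RingQuot.mkAlgHom_surjective ℂ URel
  have h := congrArg (Subalgebra.map uMk) (TensorAlgebra.adjoin_range_ι (R := ℂ) (M := G))
  rw [AlgHom.map_adjoin, ← Set.range_comp, Algebra.map_top, (AlgHom.range_eq_top _).2 hf] at h
  exact h

theorem xi_mem_parPart (i : Fin 4) : xi {i} ∈ parPart 1 := by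
  refine ⟨?_, by simp [xi]⟩
  exact Finsupp.single_mem_supported ℂ (1 : ℂ) (by simp)

theorem iota_xi_anticomm (i j : Fin 4) :
    iota (xi {i}) * iota (xi {j}) + iota (xi {j}) * iota (xi {i}) =
      if i = j then -iota oneG else 0 := by
  rw [iota_mul_iota (xi_mem_parPart i) (xi_mem_parPart j), lieBr_xi_xi]
  split_ifs <;> simp

/-- The comparison map from the model of `U(𝔤_{<0})`. -/
def hToNeg : H →ₐ[ℂ] UNeg :=
  hLift eta fun i j => by
    refine Subtype.ext ?_
    have h := iota_xi_anticomm i j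
    have h0 := iota_xi_anticomm 0 0
    by_cases hij : i = j
    · rw [if_pos hij] at h ⊢
      rw [if_pos rfl] at h0
      exact h.trans h0.symm
    · rw [if_neg hij] at h ⊢
      exact h

theorem hToNeg_hEta (i : Fin 4) : hToNeg (hEta i) = eta i := hLift_hEta _ _ i

theorem coe_hToNeg_hEta (i : Fin 4) : (hToNeg (hEta i) : U) = iota (xi {i}) := by
  rw [hToNeg_hEta]; rfl

theorem coe_hToNeg_hTheta : (hToNeg hTheta : U) = iota oneG := by
  have h := iota_xi_anticomm 0 0
  rw [if_pos rfl, ← two_smul ℂ] at h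
  rw [hTheta, map_smul, map_mul]
  change (-2 : ℂ) • ((hToNeg (hEta 0) : U) * (hToNeg (hEta 0) : U)) = _
  rw [coe_hToNeg_hEta, show (-2 : ℂ) = (-1) * 2 by norm_num, mul_smul, h]
  simp

theorem oneG_mem_gNeg : oneG ∈ gNeg :=
  ⟨Finsupp.single_mem_supported ℂ (1 : ℂ) (by simp [degB]), Submodule.zero_mem _⟩

theorem xi_mem_gNeg (i : Fin 4) : xi {i} ∈ gNeg :=
  ⟨Finsupp.single_mem_supported ℂ (1 : ℂ) (by simp [degB]), Submodule.zero_mem _⟩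

theorem gePart_eq_zero {x : G} (hx : x ∈ gNeg) : gePart x = 0 := by
  have h1 : gePart x ∈ gNeg :=
    gNeg.sub_mem (gNeg.sub_mem hx (gNeg.smul_mem _ oneG_mem_gNeg))
      (gNeg.sum_mem fun i _ => gNeg.smul_mem _ (xi_mem_gNeg i))
  have h2 := gePart_mem x
  refine Prod.ext ?_ h1.2
  refine Finsupp.support_eq_empty.1 (Finset.eq_empty_of_forall_notMem fun a ha => ?_)
  have h3 : degB a < 0 := h1.1 ha
  have h4 : 0 ≤ degB a := h2.1 ha
  exact absurd h3 (not_lt.2 h4)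

/-- `𝔤_{<0}` is spanned by `1` and the `ξ_i`, which are the images of `Θ` and of the generators
`η_i`. -/
theorem hToNeg_surjective : Function.Surjective hToNeg := by
  have h : UNeg ≤ (UNeg.val.comp hToNeg).range := by
    refine Algebra.adjoin_le ?_
    rintro _ ⟨x, hx, rfl⟩
    have h1 := eq_gePart_add x
    rw [gePart_eq_zero hx, zero_add] at h1
    rw [h1, map_add, map_sum, map_smul]
    have hθ : iota oneG ∈ (UNeg.val.comp hToNeg).range := ⟨hTheta, coe_hToNeg_hTheta⟩
    have hη : ∀ i, iota (xi {i}) ∈ (UNeg.val.comp hToNeg).range :=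
      fun i => ⟨hEta i, coe_hToNeg_hEta i⟩
    refine Subalgebra.add_mem _ (Subalgebra.smul_mem _ hθ _)
      (Subalgebra.sum_mem _ fun i _ => ?_)
    rw [map_smul]
    exact Subalgebra.smul_mem _ (hη i) _
  intro u
  obtain ⟨a, ha⟩ := h u.2
  exact ⟨a, Subtype.ext ha⟩

section Model

variable {F : Type} [AddCommGroup F] [Module ℂ F]

/-- The map `U(𝔤) ⊗ F → H ⊗ F`, `u ⊗ v ↦ u.(1 ⊗ v)`. -/
def indToModel {r : G →ₗ[ℂ] Module.End ℂ F} (hr : IsGeRep r) : U ⊗[ℂ] F →ₗ[ℂ] H ⊗[ℂ] F :=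
  TensorProduct.lift
    (((rhoU hr).toLinearMap.flip ∘ₗ (TensorProduct.mk ℂ H F 1)).flip)

theorem indToModel_tmul {r : G →ₗ[ℂ] Module.End ℂ F} (hr : IsGeRep r) (u : U) (v : F) :
    indToModel hr (u ⊗ₜ v) = rhoU hr u (1 ⊗ₜ v) := rfl

theorem indToModel_smul {r : G →ₗ[ℂ] Module.End ℂ F} (hr : IsGeRep r) (a : U) (z : U ⊗[ℂ] F) :
    indToModel hr (a • z) = rhoU hr a (indToModel hr z) := by
  induction z using TensorProduct.induction_on with
  | zero => simp
  | add a b ha hb => simp only [smul_add, map_add, ha, hb]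
  | tmul u v =>
    rw [TensorProduct.smul_tmul', smul_eq_mul, indToModel_tmul, indToModel_tmul, map_mul,
      Module.End.mul_apply]

theorem indToModel_of_mem {r : G →ₗ[ℂ] Module.End ℂ F} (hr : IsGeRep r) {z : U ⊗[ℂ] F}
    (hz : z ∈ indRel (r ∘ₗ gGe.subtype)) : indToModel hr z = 0 := by
  refine Submodule.span_induction ?_ (map_zero _) (fun a b _ _ ha hb => by
    rw [map_add, ha, hb, add_zero]) (fun a z _ hz => by rw [indToModel_smul, hz, map_zero]) hz
  rintro _ ⟨u, x, v, rfl⟩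
  rw [map_sub, indToModel_tmul, indToModel_tmul, map_mul, Module.End.mul_apply, rhoU_iota,
    rhoH_of_mem x.2, sub_eq_zero]
  rfl

theorem rhoU_hToNeg {r : G →ₗ[ℂ] Module.End ℂ F} (hr : IsGeRep r) (h : H) (z : H ⊗[ℂ] F) :
    rhoU hr (hToNeg h) z = h • z := by
  let B : Subalgebra ℂ H :=
    { carrier := {h | ∀ z, rhoU hr (hToNeg h) z = h • z}
      mul_mem' := fun {a b} ha hb z => by
        change rhoU hr (hToNeg (a * b)) z = (a * b) • z
        rw [map_mul, Subalgebra.coe_mul, map_mul, Module.End.mul_apply, hb, ha, mul_smul]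
      add_mem' := fun {a b} ha hb z => by
        change rhoU hr (hToNeg (a + b)) z = (a + b) • z
        rw [map_add, Subalgebra.coe_add, map_add, LinearMap.add_apply, hb, ha, add_smul]
      algebraMap_mem' := fun c z => by
        rw [AlgHom.commutes, Subalgebra.coe_algebraMap, AlgHom.commutes, algebraMap_smul]
        rfl }
  have hB : B = ⊤ := by
    rw [eq_top_iff, ← adjoin_hEta]
    refine Algebra.adjoin_le ?_
    rintro _ ⟨i, rfl⟩ z
    rw [coe_hToNeg_hEta, rhoU_iota, rhoH_xi hr]
  have hh : h ∈ B := hB ▸ Algebra.mem_top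
  exact hh z

/-- The elements of `U(𝔤_{<0})` act on the model by left multiplication, so applying `u` to `1 ⊗ v`
recovers `u ⊗ v`. The map back from the induced module is thus a left inverse of the map out of `H ⊗
F`. -/
theorem indToModel_hToNeg {r : G →ₗ[ℂ] Module.End ℂ F} (hr : IsGeRep r) (z : H ⊗[ℂ] F) :
    indToModel hr (TensorProduct.map UNeg.val.toLinearMap LinearMap.id
      (TensorProduct.map hToNeg.toLinearMap LinearMap.id z)) = z := by
  induction z using TensorProduct.induction_on with
  | zero => simp
  | add a b ha hb => simp only [map_add, ha, hb]
  | tmul u v =>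
    simp only [TensorProduct.map_tmul, LinearMap.id_apply, indToModel_tmul]
    change rhoU hr (hToNeg u) _ = _
    rw [rhoU_hToNeg, TensorProduct.smul_tmul', smul_eq_mul, mul_one]

/-- Lift an element of the kernel to `H ⊗ F`; the map back to the model kills the defining
relations, so this lift is zero. Only surjectivity of `H → U(𝔤_{<0})` enters. -/
theorem pbwInd_injective {r : G →ₗ[ℂ] Module.End ℂ F} (hr : IsGeRep r) :
    Function.Injective (pbwInd (r ∘ₗ gGe.subtype)) := by
  rw [injective_iff_map_eq_zero]
  intro z hz
  obtain ⟨h, rfl⟩ := TensorProduct.map_surjective (g := hToNeg.toLinearMap)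
    (g' := (LinearMap.id : F →ₗ[ℂ] F)) hToNeg_surjective Function.surjective_id z
  have h1 := indToModel_of_mem hr ((Submodule.Quotient.mk_eq_zero _).1 hz)
  rw [indToModel_hToNeg] at h1
  rw [h1, map_zero]

/-- The left inverse above for `F = ℂ` with zero action. It makes nonvanishing in `U(𝔤_{<0})`
testable in representations of `H`. -/
theorem hToNeg_injective : Function.Injective hToNeg := by
  have hr : IsGeRep (0 : G →ₗ[ℂ] Module.End ℂ ℂ) :=
    ⟨fun _ => rfl, rfl, fun _ => rfl, fun _ _ _ _ => by simp⟩
  rw [injective_iff_map_eq_zero]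
  intro h hh
  have h1 := indToModel_hToNeg hr (h ⊗ₜ 1)
  rw [TensorProduct.map_tmul] at h1
  have h2 : hToNeg.toLinearMap h = 0 := hh
  rw [h2, TensorProduct.zero_tmul, map_zero, map_zero] at h1
  have := congrArg (TensorProduct.rid ℂ H) h1
  simpa using this.symm

/-- The canonical map `F → Ind F`. -/
def indMk (ρ : gGe →ₗ[ℂ] Module.End ℂ F) : F →ₗ[ℂ] Ind ρ :=
  ((indRel ρ).mkQ.restrictScalars ℂ) ∘ₗ TensorProduct.mk ℂ U F 1

theorem mkQ_tmul (ρ : gGe →ₗ[ℂ] Module.End ℂ F) (u : U) (v : F) :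
    (indRel ρ).mkQ (u ⊗ₜ v) = u • indMk ρ v := by
  rw [indMk, LinearMap.comp_apply, TensorProduct.mk_apply, LinearMap.restrictScalars_apply,
    ← map_smul, TensorProduct.smul_tmul', smul_eq_mul, mul_one]

theorem pbwInd_tmul (ρ : gGe →ₗ[ℂ] Module.End ℂ F) (u : UNeg) (v : F) :
    pbwInd ρ (u ⊗ₜ v) = (u : U) • indMk ρ v := mkQ_tmul ρ _ _

theorem iota_smul_indMk (ρ : gGe →ₗ[ℂ] Module.End ℂ F) (x : gGe) (v : F) :
    iota (x : G) • indMk ρ v = indMk ρ (ρ x v) := by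
  have h : (indRel ρ).mkQ ((1 * iota (x : G)) ⊗ₜ v - 1 ⊗ₜ (ρ x v)) = 0 :=
    (Submodule.Quotient.mk_eq_zero _).2 (Submodule.subset_span ⟨1, x, v, rfl⟩)
  rw [map_sub, mkQ_tmul, mkQ_tmul, one_mul, one_smul, sub_eq_zero] at h
  exact h

theorem coe_smul_pbwInd (ρ : gGe →ₗ[ℂ] Module.End ℂ F) (u : UNeg) (z : UNeg ⊗[ℂ] F) :
    (u : U) • pbwInd ρ z = pbwInd ρ (u • z) := by
  induction z using TensorProduct.induction_on with
  | zero => simp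
  | add a b ha hb => simp only [smul_add, map_add, ha, hb]
  | tmul w v =>
    rw [TensorProduct.smul_tmul', pbwInd_tmul, pbwInd_tmul, smul_eq_mul, Subalgebra.coe_mul,
      mul_smul]

theorem gmono_mem_parPart (m : ℕ) (I : Finset (Fin 4)) :
    gmono m I ∈ parPart ⟨I.card % 2, Nat.mod_lt _ two_pos⟩ := by
  refine ⟨Finsupp.single_mem_supported ℂ (1 : ℂ) rfl, ?_⟩
  split_ifs <;> exact Submodule.zero_mem _

theorem cG_mem_parPart : cG ∈ parPart 0 := by
  refine ⟨Submodule.zero_mem _, ?_⟩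
  rw [if_pos rfl]
  exact Submodule.mem_top

/-- The defining relation of `U(𝔤)` with the sign absorbed in `parG`; both sides being linear in
`x`, homogeneity is not needed. -/
theorem iota_mul_xi (x : G) (i : Fin 4) :
    iota x * iota (xi {i}) = iota (xi {i}) * iota (parG x) + iota (lieBr x (xi {i})) := by
  have : (LinearMap.mulRight ℂ (iota (xi {i}))) ∘ₗ iota =
      (LinearMap.mulLeft ℂ (iota (xi {i}))) ∘ₗ iota ∘ₗ parG + iota ∘ₗ lieL.flip (xi {i}) := by
    refine hom_ext_G (fun m I => ?_) ?_
    · have := iota_mul_iota (gmono_mem_parPart m I) (xi_mem_parPart i)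
      simp only [Fin.val_one, mul_one, ← neg_one_pow_eq_pow_mod_two] at this
      simpa [lieL_apply, parG_gmono] using this
    · have := iota_mul_iota cG_mem_parPart (xi_mem_parPart i)
      simpa [lieL_apply, parG_cG] using this
  simpa [lieL_apply] using LinearMap.congr_fun this x

theorem adjoin_eta : Algebra.adjoin ℂ (Set.range eta) = ⊤ := by
  have h := congrArg (Subalgebra.map hToNeg) adjoin_hEta
  rw [AlgHom.map_adjoin, ← Set.range_comp, Algebra.map_top,
    (AlgHom.range_eq_top _).2 hToNeg_surjective] at h
  rw [← h]
  congr 2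
  funext i
  exact (hToNeg_hEta i).symm

/-- For vectors `1 ⊗ v`, the part of `x` in `𝔤_{≥0}` acts on `v` and the rest lies in `U(𝔤_{<0})`.
The general case follows by moving `x` to the right past a generator `η_i`, at the price of `[x,
ξ_i]`; hence the induction is on a statement for all `x`. -/
theorem iota_smul_pbwInd_mem (ρ : gGe →ₗ[ℂ] Module.End ℂ F) (x : G) (z : UNeg ⊗[ℂ] F) :
    iota x • pbwInd ρ z ∈ LinearMap.range (pbwInd ρ) := by
  have hη : ∀ i, ∀ w ∈ LinearMap.range (pbwInd ρ), iota (xi {i}) • w ∈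
      LinearMap.range (pbwInd ρ) := by
    rintro i _ ⟨w, rfl⟩
    exact ⟨eta i • w, (coe_smul_pbwInd ρ (eta i) w).symm⟩
  have hθ : ∀ w ∈ LinearMap.range (pbwInd ρ), iota oneG • w ∈ LinearMap.range (pbwInd ρ) := by
    rintro _ ⟨w, rfl⟩
    exact ⟨hToNeg hTheta • w, by rw [← coe_smul_pbwInd, coe_hToNeg_hTheta]⟩
  have h1 : ∀ v, indMk ρ v ∈ LinearMap.range (pbwInd ρ) := fun v =>
    ⟨1 ⊗ₜ v, by rw [pbwInd_tmul, Subalgebra.coe_one, one_smul]⟩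
  let N : Submodule ℂ (UNeg ⊗[ℂ] F) :=
    { carrier := {z | ∀ x : G, iota x • pbwInd ρ z ∈ LinearMap.range (pbwInd ρ)}
      add_mem' := fun ha hb x => by
        rw [map_add, smul_add]; exact Submodule.add_mem _ (ha x) (hb x)
      zero_mem' := fun x => by rw [map_zero, smul_zero]; exact Submodule.zero_mem _
      smul_mem' := fun c z hz x => by
        rw [map_smul, smul_comm]; exact Submodule.smul_mem _ _ (hz x) }
  refine tensor_induction adjoin_eta N (fun v x => ?_) ?_ z x
  · rw [pbwInd_tmul, Subalgebra.coe_one, one_smul, eq_gePart_add x, map_add, map_add, map_sum,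
      add_smul, add_smul, Finset.sum_smul]
    refine Submodule.add_mem _ ?_ (Submodule.add_mem _ ?_ (Submodule.sum_mem _ fun i _ => ?_))
    · rw [iota_smul_indMk ρ ⟨gePart x, gePart_mem x⟩]
      exact h1 _
    · rw [map_smul, smul_assoc]
      exact Submodule.smul_mem _ _ (hθ _ (h1 v))
    · rw [map_smul, smul_assoc]
      exact Submodule.smul_mem _ _ (hη i _ (h1 v))
  · rintro _ ⟨i, rfl⟩ z hz x
    rw [← coe_smul_pbwInd]
    change iota x • iota (xi {i}) • _ ∈ _
    rw [← mul_smul, iota_mul_xi, add_smul, mul_smul]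
    exact Submodule.add_mem _ (hη i _ (hz _)) (hz _)

/-- The range is stable under `𝔤`, hence under `U(𝔤)`, and contains the vectors `1 ⊗ v`, which
generate the induced module. -/
theorem pbwInd_surjective (ρ : gGe →ₗ[ℂ] Module.End ℂ F) : Function.Surjective (pbwInd ρ) := by
  have hstab : ∀ (u : U), ∀ w ∈ LinearMap.range (pbwInd ρ), u • w ∈ LinearMap.range (pbwInd ρ) := by
    let B : Subalgebra ℂ U :=
      { carrier := {u | ∀ w ∈ LinearMap.range (pbwInd ρ), u • w ∈ LinearMap.range (pbwInd ρ)}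
        mul_mem' := fun {a b} ha hb z hz => by rw [mul_smul]; exact ha _ (hb _ hz)
        add_mem' := fun {a b} ha hb z hz => by
          rw [add_smul]; exact Submodule.add_mem _ (ha _ hz) (hb _ hz)
        algebraMap_mem' := fun c z hz => by
          rw [algebraMap_smul]; exact Submodule.smul_mem _ _ hz }
    have hB : B = ⊤ := by
      rw [eq_top_iff, ← adjoin_iota]
      refine Algebra.adjoin_le ?_
      rintro _ ⟨x, rfl⟩ _ ⟨z, rfl⟩
      exact iota_smul_pbwInd_mem ρ x z
    intro u
    have hu : u ∈ B := hB ▸ Algebra.mem_top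
    exact hu
  rw [← LinearMap.range_eq_top, eq_top_iff]
  intro w _
  obtain ⟨z, rfl⟩ := Submodule.Quotient.mk_surjective _ w
  change (indRel ρ).mkQ z ∈ _
  induction z using TensorProduct.induction_on with
  | zero => rw [map_zero]; exact Submodule.zero_mem _
  | add a b ha hb => rw [map_add]; exact Submodule.add_mem _ (ha trivial) (hb trivial)
  | tmul u v =>
    rw [mkQ_tmul]
    exact hstab u _ ⟨1 ⊗ₜ v, by rw [pbwInd_tmul, Subalgebra.coe_one, one_smul]⟩

end Model

/-! # The modules `V_X` -/

theorem act_gmono (q : Quadrant) (m : ℕ) (I : Finset (Fin 4)) :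
    act q (gmono m I) = actB q (m, I) := by
  simp [act, gmono, mono]

theorem pair_cases : ∀ I : Finset (Fin 4), I.card = 2 →
    I = {0, 1} ∨ I = {2, 3} ∨ I = {0, 2} ∨ I = {1, 3} ∨ I = {0, 3} ∨ I = {1, 2} := by
  decide +kernel

theorem actXi_eq_zero (q : Quadrant) {I : Finset (Fin 4)} (hI : I.card ≠ 2) : actXi q I = 0 := by
  have h : ∀ J : Finset (Fin 4), J.card = 2 → I ≠ J := fun J hJ h => hI (h ▸ hJ)
  rw [actXi, if_neg (h _ rfl), if_neg (h _ rfl), if_neg (h _ rfl), if_neg (h _ rfl),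
    if_neg (h _ rfl), if_neg (h _ rfl)]

theorem actB_eq_zero (q : Quadrant) (m : ℕ) (I : Finset (Fin 4)) (h : degB (m, I) ≠ 0) :
    actB q (m, I) = 0 := by
  have h1 : 2 * (m : ℤ) + I.card - 2 ≠ 0 := h
  clear h
  rw [actB, if_neg]
  · split_ifs with hm
    · have hm' : m = 0 := hm
      rw [actXi_eq_zero q (I := I) (by omega)]
      rfl
    · rfl
  · rintro ⟨⟩
    simp at h1

theorem actB_pair (q : Quadrant) (I : Finset (Fin 4)) :
    actB q (0, I) = (actXi q I).toLinearMap := by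
  simp [actB]

theorem glX_lie_glX (q : Quadrant) (i j k l : Fin 2) : ⁅glX q i j, glX q k l⁆ =
    (if j = k then glX q i l else 0) - (if i = l then glX q k j else 0) := by
  refine MvPolynomial.derivation_ext fun s => ?_
  rw [Derivation.commutator_apply]
  rcases s with s | s
  · cases h : q.xDual <;> fin_cases i <;> fin_cases j <;> fin_cases k <;> fin_cases l <;>
      fin_cases s <;> simp [glX, MvPolynomial.mkDerivation_X, lx, h]
  · have h0 : ∀ i j, glX q i j (MvPolynomial.X (Sum.inr s)) = 0 := by
      intro i j; simp [glX, MvPolynomial.mkDerivation_X]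
    rw [h0, h0, Derivation.sub_apply]
    split_ifs <;> simp [h0]

theorem glY_lie_glY (q : Quadrant) (i j k l : Fin 2) : ⁅glY q i j, glY q k l⁆ =
    (if j = k then glY q i l else 0) - (if i = l then glY q k j else 0) := by
  refine MvPolynomial.derivation_ext fun s => ?_
  rw [Derivation.commutator_apply]
  rcases s with s | s
  · have h0 : ∀ i j, glY q i j (MvPolynomial.X (Sum.inl s)) = 0 := by
      intro i j; simp [glY, MvPolynomial.mkDerivation_X]
    rw [h0, h0, Derivation.sub_apply]
    split_ifs <;> simp [h0]
  · cases h : q.yDual <;> fin_cases i <;> fin_cases j <;> fin_cases k <;> fin_cases l <;>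
      fin_cases s <;> simp [glY, MvPolynomial.mkDerivation_X, ly, h]

theorem glX_lie_glY (q : Quadrant) (i j k l : Fin 2) : ⁅glX q i j, glY q k l⁆ = 0 := by
  refine MvPolynomial.derivation_ext fun s => ?_
  rw [Derivation.commutator_apply]
  rcases s with s | s
  · cases h : q.xDual <;> fin_cases i <;> fin_cases j <;>
      fin_cases s <;> simp [glX, glY, MvPolynomial.mkDerivation_X, lx, h]
  · cases h : q.yDual <;> fin_cases k <;> fin_cases l <;>
      fin_cases s <;> simp [glX, glY, MvPolynomial.mkDerivation_X, ly, h]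

theorem pair_br_cases : ∀ I J : Finset (Fin 4), I.card = 2 → J.card = 2 →
    brC I J = 0 ∨ (brC I J = 1 ∨ brC I J = -1) ∧
      (symmDiff I J = {0, 1} ∨ symmDiff I J = {2, 3} ∨ symmDiff I J = {0, 2} ∨
        symmDiff I J = {1, 3} ∨ symmDiff I J = {0, 3} ∨ symmDiff I J = {1, 2}) := by
  decide +kernel

/-- The bracket relations of `𝔰𝔬₄`, for elements built from two commuting copies of `𝔰𝔬₃`. -/
theorem so_four_lie {L : Type*} [LieRing L] [LieAlgebra ℂ L] {a b c a' b' c' : L}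
    (hab : ⁅a, b⁆ = -c) (hbc : ⁅b, c⁆ = -a) (hca : ⁅c, a⁆ = -b)
    (hab' : ⁅a', b'⁆ = -c') (hbc' : ⁅b', c'⁆ = -a') (hca' : ⁅c', a'⁆ = -b')
    (haa : ⁅a, a'⁆ = 0) (hab1 : ⁅a, b'⁆ = 0) (hac : ⁅a, c'⁆ = 0)
    (hba : ⁅b, a'⁆ = 0) (hbb : ⁅b, b'⁆ = 0) (hbc1 : ⁅b, c'⁆ = 0)
    (hca1 : ⁅c, a'⁆ = 0) (hcb : ⁅c, b'⁆ = 0) (hcc : ⁅c, c'⁆ = 0) {X : Finset (Fin 4) → L}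
    (h01 : X {0, 1} = a + a') (h23 : X {2, 3} = a' - a) (h02 : X {0, 2} = b + b')
    (h13 : X {1, 3} = b - b') (h03 : X {0, 3} = c - c') (h12 : X {1, 2} = -c - c')
    (I J : Finset (Fin 4)) (hI : I.card = 2) (hJ : J.card = 2) :
    ⁅X I, X J⁆ = (brC I J : ℂ) • X (symmDiff I J) := by
  have hba2 : ⁅b, a⁆ = c := by rw [← lie_skew, hab, neg_neg]
  have hcb2 : ⁅c, b⁆ = a := by rw [← lie_skew, hbc, neg_neg]
  have hac2 : ⁅a, c⁆ = b := by rw [← lie_skew, hca, neg_neg]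
  have hba2' : ⁅b', a'⁆ = c' := by rw [← lie_skew, hab', neg_neg]
  have hcb2' : ⁅c', b'⁆ = a' := by rw [← lie_skew, hbc', neg_neg]
  have hac2' : ⁅a', c'⁆ = b' := by rw [← lie_skew, hca', neg_neg]
  have s1 : ⁅a', a⁆ = 0 := by rw [← lie_skew, haa, neg_zero]
  have s2 : ⁅b', a⁆ = 0 := by rw [← lie_skew, hab1, neg_zero]
  have s3 : ⁅c', a⁆ = 0 := by rw [← lie_skew, hac, neg_zero]
  have s4 : ⁅a', b⁆ = 0 := by rw [← lie_skew, hba, neg_zero]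
  have s5 : ⁅b', b⁆ = 0 := by rw [← lie_skew, hbb, neg_zero]
  have s6 : ⁅c', b⁆ = 0 := by rw [← lie_skew, hbc1, neg_zero]
  have s7 : ⁅a', c⁆ = 0 := by rw [← lie_skew, hca1, neg_zero]
  have s8 : ⁅b', c⁆ = 0 := by rw [← lie_skew, hcb, neg_zero]
  have s9 : ⁅c', c⁆ = 0 := by rw [← lie_skew, hcc, neg_zero]
  have key := pair_br_cases I J hI hJ
  -- There are 36 pairs. For each, `key` supplies the structure constant and the resulting set, the
  -- alternatives contradicting the actual values being discarded by evaluation.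
  rcases pair_cases I hI with rfl | rfl | rfl | rfl | rfl | rfl <;>
  rcases pair_cases J hJ with rfl | rfl | rfl | rfl | rfl | rfl <;>
  rcases key with h | ⟨h | h, h' | h' | h' | h' | h' | h'⟩ <;>
  (try (exfalso; revert h; decide)) <;> (try (exfalso; revert h'; decide)) <;>
  rw [h] <;> (try rw [h']) <;>
  simp only [h01, h23, h02, h13, h03, h12, add_lie, lie_add, sub_lie, lie_sub, neg_lie, lie_neg,
    lie_self, hab, hbc, hca, hab', hbc', hca', haa, hab1, hac, hba, hbb, hbc1, hca1, hcb, hcc,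
    hba2, hcb2, hac2, hba2', hcb2', hac2', s1, s2, s3, s4, s5, s6, s7, s8, s9] <;>
  push_cast <;> module

/-- The bracket relations of `𝔰𝔬₄`, for elements built from two commuting copies of `𝔤𝔩₂`. -/
theorem so_four_lie_of_gl {L : Type*} [LieRing L] [LieAlgebra ℂ L] {x y : Fin 2 → Fin 2 → L}
    (hx : ∀ i j k l, ⁅x i j, x k l⁆ = (if j = k then x i l else 0) - (if i = l then x k j else 0))
    (hy : ∀ i j k l, ⁅y i j, y k l⁆ = (if j = k then y i l else 0) - (if i = l then y k j else 0))
    (hxy : ∀ i j k l, ⁅x i j, y k l⁆ = 0) {X : Finset (Fin 4) → L}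
    (h01 : X {0, 1} = (Complex.I / 2) • (x 0 0 - x 1 1 + (y 0 0 - y 1 1)))
    (h23 : X {2, 3} = (-Complex.I / 2) • (x 0 0 - x 1 1 - (y 0 0 - y 1 1)))
    (h02 : X {0, 2} = (1 / 2 : ℂ) • (x 1 0 + y 1 0 - x 0 1 - y 0 1))
    (h13 : X {1, 3} = (1 / 2 : ℂ) • (x 1 0 - y 1 0 - x 0 1 + y 0 1))
    (h03 : X {0, 3} = (Complex.I / 2) • (x 0 1 - y 0 1 + x 1 0 - y 1 0))
    (h12 : X {1, 2} = (-Complex.I / 2) • (x 0 1 + y 0 1 + x 1 0 + y 1 0))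
    (I J : Finset (Fin 4)) (hI : I.card = 2) (hJ : J.card = 2) :
    ⁅X I, X J⁆ = (brC I J : ℂ) • X (symmDiff I J) := by
  -- In each copy of `𝔰𝔩₂` the triple `(i/2) h`, `(1/2)(f - e)`, `(i/2)(e + f)` satisfies the `𝔰𝔬₃`
  -- relations, and every `ξ_{ij}` acts as a signed sum of one vector from each triple.
  refine so_four_lie (a := (Complex.I / 2) • (x 0 0 - x 1 1)) (b := (1 / 2 : ℂ) • (x 1 0 - x 0 1))
    (c := (Complex.I / 2) • (x 0 1 + x 1 0)) (a' := (Complex.I / 2) • (y 0 0 - y 1 1))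
    (b' := (1 / 2 : ℂ) • (y 1 0 - y 0 1)) (c' := (Complex.I / 2) • (y 0 1 + y 1 0))
    ?_ ?_ ?_ ?_ ?_ ?_ ?_ ?_ ?_ ?_ ?_ ?_ ?_ ?_ ?_
    (h01.trans (by module)) (h23.trans (by module)) (h02.trans (by module))
    (h13.trans (by module)) (h03.trans (by module)) (h12.trans (by module)) I J hI hJ
  all_goals
    simp only [smul_lie, lie_smul, add_lie, lie_add, sub_lie, lie_sub, hx, hy, hxy,
      Fin.reduceEq, if_true, if_false, smul_zero, sub_zero, add_zero, zero_sub]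
  all_goals
    match_scalars <;> ring_nf <;> norm_num [Complex.I_sq]

theorem actXi_lie (q : Quadrant) (I J : Finset (Fin 4)) (hI : I.card = 2) (hJ : J.card = 2) :
    ⁅actXi q I, actXi q J⁆ = (brC I J : ℂ) • actXi q (symmDiff I J) :=
  so_four_lie_of_gl (glX_lie_glX q) (glY_lie_glY q) (glX_lie_glY q) (actXi_01 q) (actXi_23 q)
    (actXi_02 q) (actXi_13 q) (actXi_03 q) (actXi_12 q) I J hI hJ

theorem apply_comm_of_lie {D E : Derivation ℂ V V} (h : ⁅D, E⁆ = 0) (f : V) :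
    D (E f) = E (D f) := by
  have := congrArg (fun E : Derivation ℂ V V => E f) h
  simpa only [Derivation.commutator_apply, Derivation.zero_apply, sub_eq_zero] using this

theorem eulX_actXi (q : Quadrant) (I : Finset (Fin 4)) (f : V) :
    eulX q (actXi q I f) = actXi q I (eulX q f) := by
  have h1 := fun i j => apply_comm_of_lie (eulX_comm_glX q i j) f
  have h2 := fun i j => apply_comm_of_lie (eulX_comm_glY q i j) f
  unfold actXi
  split_ifs <;> simp [cartX, cartY, h1, h2]

theorem eulY_actXi (q : Quadrant) (I : Finset (Fin 4)) (f : V) :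
    eulY q (actXi q I f) = actXi q I (eulY q f) := by
  have h1 := fun i j => apply_comm_of_lie (eulY_comm_glX q i j) f
  have h2 := fun i j => apply_comm_of_lie (eulY_comm_glY q i j) f
  unfold actXi
  split_ifs <;> simp [cartX, cartY, h1, h2]

theorem eulX_eulY (q : Quadrant) (f : V) : eulX q (eulY q f) = eulY q (eulX q f) := by
  have h1 := fun i j => apply_comm_of_lie (eulX_comm_glY q i j) f
  simp only [eulY, Derivation.add_apply, map_add, h1]

theorem actT_actXi (q : Quadrant) (I : Finset (Fin 4)) (f : V) :
    actT q (actXi q I f) = actXi q I (actT q f) := by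
  simp [actT, eulX_actXi, eulY_actXi]

theorem actC_actXi (q : Quadrant) (I : Finset (Fin 4)) (f : V) :
    actC q (actXi q I f) = actXi q I (actC q f) := by
  simp [actC, eulX_actXi, eulY_actXi]

theorem actC_actT (q : Quadrant) (f : V) : actC q (actT q f) = actT q (actC q f) := by
  simp only [actC, actT, LinearMap.add_apply, LinearMap.sub_apply, LinearMap.smul_apply,
    LinearMap.id_apply, map_add, map_sub, map_smul, Derivation.coeFn_coe, eulX_eulY]
  module

theorem actC_act (q : Quadrant) (x : G) : actC q * act q x = act q x * actC q := by
  have : (LinearMap.mulLeft ℂ (actC q)) ∘ₗ act q = (LinearMap.mulRight ℂ (actC q)) ∘ₗ act q := by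
    refine hom_ext_G (fun m I => LinearMap.ext fun f => ?_) (LinearMap.ext fun f => ?_)
    · simp only [LinearMap.comp_apply, LinearMap.mulLeft_apply, LinearMap.mulRight_apply,
        Module.End.mul_apply, act_gmono, actB]
      split_ifs
      · exact actC_actT q f
      · exact actC_actXi q I f
      · simp
    · simp [act_cG]
  exact LinearMap.congr_fun this x

theorem pair_t_consts : ∀ J : Finset (Fin 4), J.card = 2 →
    brL ∅ J = 0 ∧ brC ∅ J = 0 ∧ brR J ∅ = 0 ∧ brC J ∅ = 0 := by
  decide +kernel

theorem pair_coc : ∀ I J : Finset (Fin 4), I.card = 2 → J.card = 2 → cocZ I J = 0 := by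
  decide +kernel

theorem degB_eq_zero_cases {m : ℕ} {I : Finset (Fin 4)} (h : degB (m, I) = 0) :
    (m = 1 ∧ I = ∅) ∨ (m = 0 ∧ I.card = 2) := by
  have h1 : 2 * (m : ℤ) + I.card - 2 = 0 := h
  have : m = 0 ∨ m = 1 := by omega
  rcases this with rfl | rfl
  · exact Or.inr ⟨rfl, by omega⟩
  · refine Or.inl ⟨rfl, Finset.card_eq_zero.1 (by omega)⟩

/-- Only degree 0 acts nontrivially, so both sides vanish unless both arguments have degree 0. Such
monomials are `t`, which commutes with everything in sight, and the `ξ_{ij}`, for which the relation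
is that of `𝔰𝔬₄`. -/
theorem act_lieBr_gmono (q : Quadrant) {m n : ℕ} {I J : Finset (Fin 4)} (hI : 0 ≤ degB (m, I))
    (hJ : 0 ≤ degB (n, J)) : act q (lieBr (gmono m I) (gmono n J)) =
      act q (gmono m I) * act q (gmono n J) - act q (gmono n J) * act q (gmono m I) := by
  rcases eq_or_ne (degB (m, I) + degB (n, J)) 0 with h | h
  · rcases degB_eq_zero_cases (m := m) (I := I) (by omega) with ⟨rfl, rfl⟩ | ⟨rfl, hI2⟩ <;>
    rcases degB_eq_zero_cases (m := n) (I := J) (by omega) with ⟨rfl, rfl⟩ | ⟨rfl, hJ2⟩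
    · rw [sub_self, lieBr_gmono, show brC ∅ ∅ = 0 by decide, show brL ∅ ∅ = -brR ∅ ∅ by decide]
      simp
    · obtain ⟨h1, h2, -⟩ := pair_t_consts J hJ2
      refine LinearMap.ext fun f => ?_
      rw [lieBr_gmono, h1, h2]
      simp [act_gmono, actB_pair, ← tG_eq_gmono, act_tG, actT_actXi]
    · obtain ⟨-, -, h2, h3⟩ := pair_t_consts I hI2
      refine LinearMap.ext fun f => ?_
      rw [lieBr_gmono, h2, h3]
      simp [act_gmono, actB_pair, ← tG_eq_gmono, act_tG, actT_actXi]
    · refine LinearMap.ext fun f => ?_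
      have := congrArg (fun E : Derivation ℂ V V => E f) (actXi_lie q I J hI2 hJ2)
      rw [lieBr_gmono, pair_coc I J hI2 hJ2]
      simp only [Derivation.commutator_apply, Derivation.smul_apply] at this
      simp [act_gmono, actB_pair, this]
  · have h1 : act q (lieBr (gmono m I) (gmono n J)) = 0 :=
      lieBr_gmono_mem m n I J (LinearMap.ker (act q)) (fun h' => absurd h' h) fun k L hk => by
        rw [LinearMap.mem_ker, act_gmono, actB_eq_zero q k L (hk ▸ h)]
    rcases eq_or_ne (degB (m, I)) 0 with h2 | h2
    · rw [h1, act_gmono q n J, actB_eq_zero q n J (by omega), mul_zero, zero_mul, sub_zero]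
    · rw [h1, act_gmono q m I, actB_eq_zero q m I h2, mul_zero, zero_mul, sub_zero]

theorem act_lieBr (q : Quadrant) {x y : G} (hx : x ∈ gGe) (hy : y ∈ gGe) :
    act q (lieBr x y) = act q x * act q y - act q y * act q x := by
  refine gGe_induction (P := fun x => act q (lieBr x y) = act q x * act q y - act q y * act q x)
    (by simp [← lieL_apply])
    (fun a b ha hb => by rw [lieBr_add_left, map_add, ha, hb, map_add, add_mul, mul_add]; abel)
    (fun c a ha => by
      rw [lieBr_smul_left, map_smul, ha, map_smul, smul_mul_assoc, mul_smul_comm]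
      exact smul_sub _ _ _)
    (by rw [lieBr_cG_left, map_zero, act_cG, actC_act, sub_self]) (fun m I hI => ?_) hx
  refine gGe_induction (P := fun y => act q (lieBr (gmono m I) y) =
      act q (gmono m I) * act q y - act q y * act q (gmono m I)) (by simp [← lieL_apply])
    (fun a b ha hb => by rw [lieBr_add_right, map_add, ha, hb, map_add, add_mul, mul_add]; abel)
    (fun c a ha => by
      rw [lieBr_smul_right, map_smul, ha, map_smul, smul_mul_assoc, mul_smul_comm]
      exact smul_sub _ _ _)
    (by rw [lieBr_cG_right, map_zero, act_cG, actC_act, sub_self]) (fun n J hJ => ?_) hy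
  exact act_lieBr_gmono q hI hJ

theorem act_parG (q : Quadrant) (x : G) : act q (parG x) = act q x := by
  have : act q ∘ₗ parG = act q := by
    refine hom_ext_G (fun m I => ?_) (by simp [parG_cG])
    rw [LinearMap.comp_apply, parG_gmono, map_smul, act_gmono]
    rcases eq_or_ne (degB (m, I)) 0 with h | h
    · rcases degB_eq_zero_cases h with ⟨-, rfl⟩ | ⟨-, h2⟩
      · simp
      · simp [h2]
    · rw [actB_eq_zero q m I h, smul_zero]
  exact LinearMap.congr_fun this x

/-- The action of `𝔤_{≥0}` on a submodule of `V_X`, extended by `0` to `𝔤`. -/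
def SubRep.actR {q : Quadrant} (S : SubRep q) : G →ₗ[ℂ] Module.End ℂ S.carrier where
  toFun x := (act q x).restrict fun _ hf => S.stable x hf
  map_add' x y := by ext v; simp [LinearMap.restrict_apply]
  map_smul' c x := by ext v; simp [LinearMap.restrict_apply]

theorem SubRep.coe_actR {q : Quadrant} (S : SubRep q) (x : G) (v : S.carrier) :
    (S.actR x v : V) = act q x v := rfl

theorem SubRep.isGeRep {q : Quadrant} (S : SubRep q) : IsGeRep S.actR where
  xi i := by
    ext v
    rw [S.coe_actR, xi_eq_gmono, act_gmono, actB_eq_zero q _ _ (by simp [degB])]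
    rfl
  oneG := by
    ext v
    rw [S.coe_actR, oneG, act_gmono, actB_eq_zero q _ _ (by simp [degB])]
    rfl
  par x := by
    ext v
    rw [S.coe_actR, act_parG]
    rfl
  lie x hx y hy := by
    ext v
    rw [S.coe_actR, act_lieBr q hx hy]
    rfl

theorem SubRep.rho_eq {q : Quadrant} (S : SubRep q) : S.rho = S.actR ∘ₗ gGe.subtype :=
  LinearMap.ext fun _ => rfl

theorem pbwInd_injective_of_eq {F : Type} [AddCommGroup F] [Module ℂ F]
    {r : G →ₗ[ℂ] Module.End ℂ F} (hr : IsGeRep r) {rho : gGe →ₗ[ℂ] Module.End ℂ F}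
    (h : rho = r ∘ₗ gGe.subtype) : Function.Injective (pbwInd rho) := by
  subst h
  exact pbwInd_injective hr

theorem SubRep.pbw_bijective {q : Quadrant} (S : SubRep q) : Function.Bijective S.pbw :=
  ⟨pbwInd_injective_of_eq S.isGeRep S.rho_eq, pbwInd_surjective _⟩

/-! # Bases of `𝔤_{-1}`, `𝔤₀` and `𝔤₁` adapted to `𝔤𝔩₂ ⊕ 𝔤𝔩₂` -/

/-- The antisymmetric form on `ℂ²`. -/
def eps : Fin 2 → Fin 2 → ℂ := ![![0, 1], ![-1, 0]]

/-- The elements `w_{ij}`, as elements of `𝔤_{-1}`. -/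
def wG : Fin 2 → Fin 2 → G :=
  ![![xi {1} + Complex.I • xi {0}, -xi {3} + Complex.I • xi {2}],
    ![xi {3} + Complex.I • xi {2}, xi {1} - Complex.I • xi {0}]]

/-- The elements of `𝔤₀` which act as `x_i ∂_{x_j}`, in normal order. -/
def XG : Fin 2 → Fin 2 → G :=
  ![![(1 / 2 : ℂ) • (cG - tG + hX), eX], ![fX, (1 / 2 : ℂ) • (cG - tG - hX)]]

/-- The elements of `𝔤₀` which act as `y_i ∂_{y_j}`, in normal order. -/
def YG : Fin 2 → Fin 2 → G :=
  ![![(1 / 2 : ℂ) • (-cG - tG + hY), eY], ![fY, (1 / 2 : ℂ) • (-cG - tG - hY)]]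

/-- `∂_i ξ₁₂₃₄`. -/
def xiStar (i : Fin 4) : G := ((-1 : ℂ) ^ (i : ℕ)) • xi {i}ᶜ

/-- `t ξ_i - ∂_i ξ₁₂₃₄`. -/
def pX (i : Fin 4) : G := gmono 1 {i} - xiStar i

/-- `t ξ_i + ∂_i ξ₁₂₃₄`. -/
def pY (i : Fin 4) : G := gmono 1 {i} + xiStar i

/-- The image of `w_{ij}` under `ξ_i ↦ t ξ_i - ∂_i ξ₁₂₃₄`. -/
def PX : Fin 2 → Fin 2 → G :=
  ![![pX 1 + Complex.I • pX 0, -pX 3 + Complex.I • pX 2],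
    ![pX 3 + Complex.I • pX 2, pX 1 - Complex.I • pX 0]]

/-- The image of `w_{ij}` under `ξ_i ↦ t ξ_i + ∂_i ξ₁₂₃₄`. -/
def PY : Fin 2 → Fin 2 → G :=
  ![![pY 1 + Complex.I • pY 0, -pY 3 + Complex.I • pY 2],
    ![pY 3 + Complex.I • pY 2, pY 1 - Complex.I • pY 0]]

theorem lieBr_tG_xi (k : Fin 4) : lieBr tG (xi {k}) = -xi {k} := by
  have : ∀ k : Fin 4, brL ∅ {k} = -1 ∧ brC ∅ {k} = 0 ∧
      symmDiff ∅ {k} = ({k} : Finset (Fin 4)) := by decide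
  obtain ⟨h1, h2, h3⟩ := this k
  rw [tG_eq_gmono, lieBr_gmono_xi, h1, h2, h3, xi_eq_gmono]
  simp only [Int.cast_neg, Int.cast_one, Nat.cast_one, Int.cast_zero, one_ne_zero, if_false]
  module

theorem lieBr_pair_xi {i j : Fin 4} (h : i < j) (k : Fin 4) : lieBr (xi {i, j}) (xi {k}) =
    ((if k = i then 1 else 0 : ℤ) : ℂ) • xi {j} - ((if k = j then 1 else 0 : ℤ) : ℂ) • xi {i} := by
  have : ∀ i j k : Fin 4, i < j →
      brC {i, j} {k} = (if k = i then 1 else 0) - (if k = j then 1 else 0) ∧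
      cocZ {i, j} {k} = 0 ∧ (k = i → symmDiff {i, j} {k} = ({j} : Finset (Fin 4))) ∧
      (k = j → symmDiff {i, j} {k} = ({i} : Finset (Fin 4))) := by decide +kernel
  obtain ⟨h1, h2, h3, h4⟩ := this i j k h
  rw [xi_eq_gmono {i, j}, lieBr_gmono_xi, h1, h2]
  by_cases hi : k = i
  · rw [h3 hi, if_pos hi, if_neg (hi ▸ h.ne), xi_eq_gmono]
    simp
  · by_cases hj : k = j
    · rw [h4 hj, if_pos hj, if_neg hi]
      simp only [xi_eq_gmono, Int.cast_sub, Int.cast_one, Nat.cast_zero, Int.cast_zero, if_true]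
      module
    · simp [hi, hj]

theorem lieBr_txi_self (i : Fin 4) : lieBr (gmono 1 {i}) (xi {i}) = -tG := by
  have : ∀ i : Fin 4, brL {i} {i} = 0 ∧ brC {i} {i} = -1 ∧
      symmDiff {i} {i} = (∅ : Finset (Fin 4)) := by decide
  obtain ⟨h1, h2, h3⟩ := this i
  rw [tG_eq_gmono, lieBr_gmono_xi, h1, h2, h3]
  simp only [Int.cast_neg, Int.cast_one, Nat.cast_one, Int.cast_zero, one_ne_zero, if_false]
  module

theorem lieBr_txi_xi_lt {i k : Fin 4} (h : i < k) :
    lieBr (gmono 1 {i}) (xi {k}) = -xi {i, k} := by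
  have : ∀ i k : Fin 4, i < k → brL {i} {k} = -1 ∧ brC {i} {k} = 0 ∧
      symmDiff {i} {k} = ({i, k} : Finset (Fin 4)) := by decide +kernel
  obtain ⟨h1, h2, h3⟩ := this i k h
  rw [lieBr_gmono_xi, h1, h2, h3, xi_eq_gmono]
  simp only [Int.cast_neg, Int.cast_one, Nat.cast_one, Int.cast_zero, one_ne_zero, if_false]
  module

theorem lieBr_txi_xi_gt {i k : Fin 4} (h : k < i) :
    lieBr (gmono 1 {i}) (xi {k}) = xi {k, i} := by
  have : ∀ i k : Fin 4, k < i → brL {i} {k} = 1 ∧ brC {i} {k} = 0 ∧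
      symmDiff {i} {k} = ({k, i} : Finset (Fin 4)) := by decide +kernel
  obtain ⟨h1, h2, h3⟩ := this i k h
  rw [lieBr_gmono_xi, h1, h2, h3, xi_eq_gmono]
  simp

theorem lieBr_xiStar_self (i : Fin 4) : lieBr (xiStar i) (xi {i}) = -cG := by
  have : ∀ i : Fin 4, brC {i}ᶜ {i} = 0 ∧ (-1) ^ (i : ℕ) * cocZ {i}ᶜ {i} = -1 := by decide +kernel
  obtain ⟨h1, h2⟩ := this i
  have h2' : ((-1 : ℂ) ^ (i : ℕ)) * (cocZ {i}ᶜ {i} : ℂ) = -1 := by exact_mod_cast h2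
  rw [xiStar, lieBr_smul_left, xi_eq_gmono {i}ᶜ, lieBr_gmono_xi, h1]
  simp only [Nat.cast_zero, mul_zero, zero_smul, Int.cast_zero, zero_add, if_true, smul_smul, h2']
  module

theorem lieBr_xiStar_xi {i k : Fin 4} (s : ℤ) {J : Finset (Fin 4)}
    (h : (-1) ^ (i : ℕ) * brC {i}ᶜ {k} = s ∧ cocZ {i}ᶜ {k} = 0 ∧ symmDiff {i}ᶜ {k} = J) :
    lieBr (xiStar i) (xi {k}) = (s : ℂ) • xi J := by
  obtain ⟨h1, h2, h3⟩ := h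
  have h1' : ((-1 : ℂ) ^ (i : ℕ)) * (brC {i}ᶜ {k} : ℂ) = s := by exact_mod_cast h1
  rw [xiStar, lieBr_smul_left, xi_eq_gmono {i}ᶜ, lieBr_gmono_xi, h2, h3]
  simp only [Nat.cast_zero, mul_zero, zero_smul, Int.cast_zero, zero_add, if_true, smul_smul,
    add_zero, h1', xi_eq_gmono]

theorem lieBr_xiStar_table :
    lieBr (xiStar 0) (xi {1}) = ((-1 : ℤ) : ℂ) • xi {2, 3} ∧
    lieBr (xiStar 0) (xi {2}) = ((1 : ℤ) : ℂ) • xi {1, 3} ∧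
    lieBr (xiStar 0) (xi {3}) = ((-1 : ℤ) : ℂ) • xi {1, 2} ∧
    lieBr (xiStar 1) (xi {0}) = ((1 : ℤ) : ℂ) • xi {2, 3} ∧
    lieBr (xiStar 1) (xi {2}) = ((-1 : ℤ) : ℂ) • xi {0, 3} ∧
    lieBr (xiStar 1) (xi {3}) = ((1 : ℤ) : ℂ) • xi {0, 2} ∧
    lieBr (xiStar 2) (xi {0}) = ((-1 : ℤ) : ℂ) • xi {1, 3} ∧
    lieBr (xiStar 2) (xi {1}) = ((1 : ℤ) : ℂ) • xi {0, 3} ∧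
    lieBr (xiStar 2) (xi {3}) = ((-1 : ℤ) : ℂ) • xi {0, 1} ∧
    lieBr (xiStar 3) (xi {0}) = ((1 : ℤ) : ℂ) • xi {1, 2} ∧
    lieBr (xiStar 3) (xi {1}) = ((-1 : ℤ) : ℂ) • xi {0, 2} ∧
    lieBr (xiStar 3) (xi {2}) = ((1 : ℤ) : ℂ) • xi {0, 1} := by
  refine ⟨?_, ?_, ?_, ?_, ?_, ?_, ?_, ?_, ?_, ?_, ?_, ?_⟩ <;>
    exact lieBr_xiStar_xi _ (by decide +kernel)

theorem wG_eq :
    wG 0 0 = xi {1} + Complex.I • xi {0} ∧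
    wG 0 1 = -xi {3} + Complex.I • xi {2} ∧
    wG 1 0 = xi {3} + Complex.I • xi {2} ∧
    wG 1 1 = xi {1} - Complex.I • xi {0} :=
  ⟨rfl, rfl, rfl, rfl⟩

theorem XG_eq :
    XG 0 0 = (1 / 2 : ℂ) • (cG - tG + hX) ∧
    XG 0 1 = eX ∧
    XG 1 0 = fX ∧
    XG 1 1 = (1 / 2 : ℂ) • (cG - tG - hX) :=
  ⟨rfl, rfl, rfl, rfl⟩

theorem YG_eq :
    YG 0 0 = (1 / 2 : ℂ) • (-cG - tG + hY) ∧
    YG 0 1 = eY ∧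
    YG 1 0 = fY ∧
    YG 1 1 = (1 / 2 : ℂ) • (-cG - tG - hY) :=
  ⟨rfl, rfl, rfl, rfl⟩

theorem PX_eq :
    PX 0 0 = pX 1 + Complex.I • pX 0 ∧
    PX 0 1 = -pX 3 + Complex.I • pX 2 ∧
    PX 1 0 = pX 3 + Complex.I • pX 2 ∧
    PX 1 1 = pX 1 - Complex.I • pX 0 :=
  ⟨rfl, rfl, rfl, rfl⟩

theorem PY_eq :
    PY 0 0 = pY 1 + Complex.I • pY 0 ∧
    PY 0 1 = -pY 3 + Complex.I • pY 2 ∧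
    PY 1 0 = pY 3 + Complex.I • pY 2 ∧
    PY 1 1 = pY 1 - Complex.I • pY 0 :=
  ⟨rfl, rfl, rfl, rfl⟩

theorem eps_eq : eps 0 0 = 0 ∧ eps 0 1 = 1 ∧ eps 1 0 = -1 ∧ eps 1 1 = 0 := by
  simp [eps]

set_option linter.unusedSimpArgs false

/-- `𝔤_{-1}` is the tensor product of the two standard representations of `𝔤𝔩₂ ⊕ 𝔤𝔩₂`, with `w_{ab}`
in the role of `x_a ⊗ y_b`. The multiple of `t` in `XG` and `YG`, with `t` acting as `-1` on
`𝔤_{-1}`, turns the `𝔰𝔩₂`-actions into `𝔤𝔩₂`-actions. -/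
theorem lieBr_XG_wG : ∀ i j a b : Fin 2,
    lieBr (XG i j) (wG a b) = if j = a then wG i b else 0 := by
  simp only [Fin.forall_fin_two, XG_eq, wG_eq, if_true, zero_ne_one, one_ne_zero, if_false]
  refine ⟨⟨⟨⟨?_, ?_⟩, ⟨?_, ?_⟩⟩, ⟨⟨?_, ?_⟩, ⟨?_, ?_⟩⟩⟩, ⟨⟨⟨?_, ?_⟩, ⟨?_, ?_⟩⟩, ⟨⟨?_, ?_⟩, ⟨?_, ?_⟩⟩⟩⟩ <;>
    simp (decide := true) only [eX, fX, hX, eY, fY, hY, pX, pY,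
      lieBr_add_left, lieBr_sub_left, lieBr_smul_left, lieBr_neg_left, lieBr_add_right,
      lieBr_sub_right, lieBr_smul_right, lieBr_neg_right, lieBr_cG_left, lieBr_tG_xi,
      lieBr_pair_xi, lieBr_txi_self, lieBr_txi_xi_lt, lieBr_txi_xi_gt, lieBr_xiStar_self,
      lieBr_xiStar_table, if_true, if_false, Int.cast_one, Int.cast_zero, Int.cast_neg] <;>
    match_scalars <;> ring_nf <;> (try simp only [Complex.I_sq]) <;> ring_nf

theorem lieBr_YG_wG : ∀ i j a b : Fin 2,
    lieBr (YG i j) (wG a b) = if j = b then wG a i else 0 := by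
  simp only [Fin.forall_fin_two, YG_eq, wG_eq, if_true, zero_ne_one, one_ne_zero, if_false]
  refine ⟨⟨⟨⟨?_, ?_⟩, ⟨?_, ?_⟩⟩, ⟨⟨?_, ?_⟩, ⟨?_, ?_⟩⟩⟩, ⟨⟨⟨?_, ?_⟩, ⟨?_, ?_⟩⟩, ⟨⟨?_, ?_⟩, ⟨?_, ?_⟩⟩⟩⟩ <;>
    simp (decide := true) only [eX, fX, hX, eY, fY, hY, pX, pY,
      lieBr_add_left, lieBr_sub_left, lieBr_smul_left, lieBr_neg_left, lieBr_add_right,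
      lieBr_sub_right, lieBr_smul_right, lieBr_neg_right, lieBr_cG_left, lieBr_tG_xi,
      lieBr_pair_xi, lieBr_txi_self, lieBr_txi_xi_lt, lieBr_txi_xi_gt, lieBr_xiStar_self,
      lieBr_xiStar_table, if_true, if_false, Int.cast_one, Int.cast_zero, Int.cast_neg] <;>
    match_scalars <;> ring_nf <;> (try simp only [Complex.I_sq]) <;> ring_nf

/-- The combinations `t ξ_i ∓ ∂_i ξ₁₂₃₄` split `𝔤₁` so that bracketing with `𝔤_{-1}` reaches only
one copy of `𝔤𝔩₂`: the traces `C - t` or `-C - t` and the corresponding half of the `ξ_{ij}`. The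
factors `ε` drive all later cancellations. -/
theorem lieBr_PX_wG : ∀ i j a b : Fin 2,
    lieBr (PX i j) (wG a b) = (-4 * eps j b) • (eps a 0 • XG i 0 + eps a 1 • XG i 1) := by
  simp only [Fin.forall_fin_two, PX_eq, wG_eq, if_true, zero_ne_one, one_ne_zero, if_false, XG_eq, eps_eq]
  refine ⟨⟨⟨⟨?_, ?_⟩, ⟨?_, ?_⟩⟩, ⟨⟨?_, ?_⟩, ⟨?_, ?_⟩⟩⟩, ⟨⟨⟨?_, ?_⟩, ⟨?_, ?_⟩⟩, ⟨⟨?_, ?_⟩, ⟨?_, ?_⟩⟩⟩⟩ <;>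
    simp (decide := true) only [eX, fX, hX, eY, fY, hY, pX, pY,
      lieBr_add_left, lieBr_sub_left, lieBr_smul_left, lieBr_neg_left, lieBr_add_right,
      lieBr_sub_right, lieBr_smul_right, lieBr_neg_right, lieBr_cG_left, lieBr_tG_xi,
      lieBr_pair_xi, lieBr_txi_self, lieBr_txi_xi_lt, lieBr_txi_xi_gt, lieBr_xiStar_self,
      lieBr_xiStar_table, if_true, if_false, Int.cast_one, Int.cast_zero, Int.cast_neg] <;>
    match_scalars <;> ring_nf <;> (try simp only [Complex.I_sq]) <;> ring_nf

theorem lieBr_PY_wG : ∀ i j a b : Fin 2,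
    lieBr (PY i j) (wG a b) = (-4 * eps i a) • (eps b 0 • YG j 0 + eps b 1 • YG j 1) := by
  simp only [Fin.forall_fin_two, PY_eq, wG_eq, if_true, zero_ne_one, one_ne_zero, if_false, YG_eq, eps_eq]
  refine ⟨⟨⟨⟨?_, ?_⟩, ⟨?_, ?_⟩⟩, ⟨⟨?_, ?_⟩, ⟨?_, ?_⟩⟩⟩, ⟨⟨⟨?_, ?_⟩, ⟨?_, ?_⟩⟩, ⟨⟨?_, ?_⟩, ⟨?_, ?_⟩⟩⟩⟩ <;>
    simp (decide := true) only [eX, fX, hX, eY, fY, hY, pX, pY,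
      lieBr_add_left, lieBr_sub_left, lieBr_smul_left, lieBr_neg_left, lieBr_add_right,
      lieBr_sub_right, lieBr_smul_right, lieBr_neg_right, lieBr_cG_left, lieBr_tG_xi,
      lieBr_pair_xi, lieBr_txi_self, lieBr_txi_xi_lt, lieBr_txi_xi_gt, lieBr_xiStar_self,
      lieBr_xiStar_table, if_true, if_false, Int.cast_one, Int.cast_zero, Int.cast_neg] <;>
    match_scalars <;> ring_nf <;> (try simp only [Complex.I_sq]) <;> ring_nf

theorem parG_xi_of_card {I : Finset (Fin 4)} (h : I.card = 2) : parG (xi I) = xi I := by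
  rw [xi_eq_gmono, parG_gmono, h]; module

theorem parG_tG : parG tG = tG := by
  rw [tG_eq_gmono, parG_gmono, Finset.card_empty]; module

theorem parG_pX (i : Fin 4) : parG (pX i) = -pX i := by
  have h : ({i}ᶜ : Finset (Fin 4)).card = 3 := by revert i; decide
  rw [pX, xiStar, xi_eq_gmono, map_sub, map_smul, parG_gmono, parG_gmono, h,
    Finset.card_singleton]
  module

theorem parG_pY (i : Fin 4) : parG (pY i) = -pY i := by
  have h : ({i}ᶜ : Finset (Fin 4)).card = 3 := by revert i; decide
  rw [pY, xiStar, xi_eq_gmono, map_add, map_smul, parG_gmono, parG_gmono, h,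
    Finset.card_singleton]
  module

theorem parG_XG : ∀ i j, parG (XG i j) = XG i j := by
  simp only [Fin.forall_fin_two, XG_eq]
  refine ⟨⟨?_, ?_⟩, ⟨?_, ?_⟩⟩ <;>
    simp (decide := true) only [eX, fX, hX, map_add, map_sub, map_smul, map_neg, parG_tG, parG_cG,
      parG_xi_of_card]

theorem parG_YG : ∀ i j, parG (YG i j) = YG i j := by
  simp only [Fin.forall_fin_two, YG_eq]
  refine ⟨⟨?_, ?_⟩, ⟨?_, ?_⟩⟩ <;>
    simp (decide := true) only [eY, fY, hY, map_add, map_sub, map_smul, map_neg, parG_tG, parG_cG,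
      parG_xi_of_card]

theorem parG_PX : ∀ i j, parG (PX i j) = -PX i j := by
  simp only [Fin.forall_fin_two, PX_eq]
  refine ⟨⟨?_, ?_⟩, ⟨?_, ?_⟩⟩ <;>
    simp only [map_add, map_sub, map_smul, map_neg, parG_pX] <;> module

theorem parG_PY : ∀ i j, parG (PY i j) = -PY i j := by
  simp only [Fin.forall_fin_two, PY_eq]
  refine ⟨⟨?_, ?_⟩, ⟨?_, ?_⟩⟩ <;>
    simp only [map_add, map_sub, map_smul, map_neg, parG_pY] <;> module

/-! ### The `w_{ij}` inside `U(𝔤_{<0})` -/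

/-- The elements `w_{ij}`. -/
def wU : Fin 2 → Fin 2 → UNeg := ![![w11, w12], ![w21, w22]]

theorem wU_eq : wU 0 0 = w11 ∧ wU 0 1 = w12 ∧ wU 1 0 = w21 ∧ wU 1 1 = w22 :=
  ⟨rfl, rfl, rfl, rfl⟩

theorem coe_wU : ∀ a b, (wU a b : U) = iota (wG a b) := by
  simp only [Fin.forall_fin_two, wU_eq, wG_eq, w11, w12, w21, w22, map_add, map_sub, map_smul,
    map_neg]
  exact ⟨⟨rfl, rfl⟩, ⟨rfl, rfl⟩⟩

theorem iota_mul_wG (x : G) : ∀ a b, iota x * iota (wG a b) =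
    iota (wG a b) * iota (parG x) + iota (lieBr x (wG a b)) := by
  simp only [Fin.forall_fin_two, wG_eq, map_add, map_sub, map_smul, map_neg, lieBr_add_right,
    lieBr_sub_right, lieBr_smul_right, lieBr_neg_right, mul_add, mul_sub, add_mul, sub_mul,
    mul_smul_comm, smul_mul_assoc, mul_neg, neg_mul, iota_mul_xi, smul_add, neg_add]
  refine ⟨⟨?_, ?_⟩, ⟨?_, ?_⟩⟩ <;> abel

theorem eta_anticomm (i j : Fin 4) : eta i * eta j + eta j * eta i =
    if i = j then eta 0 * eta 0 + eta 0 * eta 0 else 0 := by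
  have := congrArg hToNeg (hEta_anticomm i j)
  rw [apply_ite hToNeg] at this
  simpa only [map_add, map_mul, map_zero, hToNeg_hEta] using this

theorem eta_sq (i : Fin 4) : eta i * eta i = eta 0 * eta 0 := by
  have := eta_anticomm i i
  rw [if_pos rfl, ← two_smul ℂ, ← two_smul ℂ] at this
  exact smul_right_injective UNeg (two_ne_zero (α := ℂ)) this

theorem eta_mul_of_lt {i j : Fin 4} (h : j < i) : eta i * eta j = -(eta j * eta i) := by
  have := eta_anticomm i j
  rw [if_neg h.ne'] at this
  exact eq_neg_of_add_eq_zero_left this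

/-- The anticommutator of `w₁₁` and `w₂₂`, which is central. -/
def kappa : UNeg := (4 : ℂ) • (eta 0 * eta 0)

/-- The bracket on `𝔤_{-1}` is a symmetric form with values in multiples of `1`; in the basis
`w_{ab}` it is the determinant form on `2 × 2` matrices, so each `w_{ab}` is isotropic. -/
theorem wU_anticomm : ∀ a b c d, wU a b * wU c d =
    -(wU c d * wU a b) + (eps a c * eps b d) • kappa := by
  simp only [Fin.forall_fin_two, wU_eq, eps_eq, kappa]
  refine ⟨⟨⟨⟨?_, ?_⟩, ⟨?_, ?_⟩⟩, ⟨⟨?_, ?_⟩, ⟨?_, ?_⟩⟩⟩, ⟨⟨⟨?_, ?_⟩, ⟨?_, ?_⟩⟩, ⟨⟨?_, ?_⟩, ⟨?_, ?_⟩⟩⟩⟩ <;>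
    simp (decide := true) only [w11, w12, w21, w22, mul_add, add_mul, mul_sub, sub_mul, neg_mul,
      mul_neg, smul_mul_assoc, mul_smul_comm, eta_sq 1, eta_sq 2, eta_sq 3, eta_mul_of_lt] <;>
    match_scalars <;> ring_nf <;> (try simp only [Complex.I_sq]) <;> ring_nf

theorem kappa_comm (u : UNeg) : kappa * u = u * kappa := by
  have h : u ∈ Algebra.adjoin ℂ (Set.range eta) := by rw [adjoin_eta]; trivial
  have h0 : ∀ i, kappa * eta i = eta i * kappa := fun i => by
    rw [kappa, ← eta_sq i, smul_mul_assoc, mul_smul_comm, mul_assoc]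
  induction h using Algebra.adjoin_induction with
  | mem x hx => obtain ⟨i, rfl⟩ := hx; exact h0 i
  | algebraMap r => exact (Algebra.commutes r kappa).symm
  | add x y _ _ hx hy => rw [mul_add, add_mul, hx, hy]
  | mul x y _ _ hx hy => rw [← mul_assoc, hx, mul_assoc, hy, mul_assoc]

/-! # Generation of `𝔤_{>0}` and `𝔤_{≥0}` -/

/-- For `i ∉ J` the bracket of `t ξ_i` with `t^n ξ_{J ∪ i}` is `± t^{n+1} ξ_J`: the common letter
`ξ_i` is contracted. -/
theorem gmono_succ_mem {K : Submodule ℂ G}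
    (hbr : ∀ i, ∀ x ∈ K, lieBr (gmono 1 {i}) x ∈ K) {n : ℕ} {J : Finset (Fin 4)} {i : Fin 4}
    (hi : i ∉ J) (h : gmono n (insert i J) ∈ K) : gmono (n + 1) J ∈ K := by
  have : ∀ (i : Fin 4) (J : Finset (Fin 4)), i ∉ J → brL {i} (insert i J) = 0 ∧
      brR {i} (insert i J) = 0 ∧ (brC {i} (insert i J)) * (brC {i} (insert i J)) = 1 ∧
      symmDiff {i} (insert i J) = J := by decide +kernel
  obtain ⟨h1, h2, h3, h4⟩ := this i J hi
  have h5 := K.smul_mem (brC {i} (insert i J) : ℂ) (hbr i _ h)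
  have h3' : (brC {i} (insert i J) : ℂ) * (brC {i} (insert i J) : ℂ) = 1 := by exact_mod_cast h3
  rw [lieBr_gmono, h1, h2, h4] at h5
  simpa [smul_smul, h3', add_comm 1 n] using h5

/-- The full set has no missing letter for the previous step to use. Instead `[t ξ_1, t^n ξ_{234}] =
(n + 1) t^n ξ_{1234}`, and `n + 1` is invertible. -/
theorem gmono_univ_mem {K : Submodule ℂ G}
    (hbr : ∀ i, ∀ x ∈ K, lieBr (gmono 1 {i}) x ∈ K) {n : ℕ} (h : gmono n {0}ᶜ ∈ K) :
    gmono n Finset.univ ∈ K := by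
  have : brL {0} {0}ᶜ = 1 ∧ brR {0} {0}ᶜ = 1 ∧ brC {0} {0}ᶜ = 0 ∧
      symmDiff {0} {0}ᶜ = (Finset.univ : Finset (Fin 4)) := by decide +kernel
  obtain ⟨h1, h2, h3, h4⟩ := this
  have h5 := hbr 0 _ h
  have hn : (1 : ℂ) + n ≠ 0 := by exact_mod_cast (by omega : 1 + n ≠ 0)
  rw [lieBr_gmono, h1, h2, h3, h4] at h5
  refine (K.smul_mem_iff hn).1 ?_
  simpa using h5

/-- By induction on the power of `t`. For `J` not full, `t^{n+1} ξ_J` comes from `t^n ξ_{J ∪ i}`,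
whose degree is one less and still positive except when `t^{n+1} ξ_J = t ξ_j`, which is given; the
full set is then reached from `ξ_{234}`. -/
theorem gmono_mem_of_pos {K : Submodule ℂ G} (h1 : ∀ i, gmono 1 {i} ∈ K) (h3 : ∀ i, xi {i}ᶜ ∈ K)
    (hbr : ∀ i, ∀ x ∈ K, lieBr (gmono 1 {i}) x ∈ K) (n : ℕ) :
    ∀ J : Finset (Fin 4), 0 < degB (n, J) → gmono n J ∈ K := by
  have hJ : ∀ J : Finset (Fin 4), J = Finset.univ ∨ ∃ i, i ∉ J := by decide
  have hU : ∀ n, (∀ J : Finset (Fin 4), J ≠ Finset.univ → 0 < degB (n, J) → gmono n J ∈ K) →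
      ∀ J : Finset (Fin 4), 0 < degB (n, J) → gmono n J ∈ K := by
    intro n h J hd
    rcases eq_or_ne J Finset.univ with rfl | hne
    · refine gmono_univ_mem hbr (h _ (by decide) ?_)
      have : ({0}ᶜ : Finset (Fin 4)).card = 3 := by decide
      simp only [degB, this]; omega
    · exact h J hne hd
  induction n with
  | zero =>
    refine hU 0 fun J hne hd => ?_
    have : ∀ J : Finset (Fin 4), J ≠ Finset.univ → 2 < J.card → ∃ i, J = {i}ᶜ := by
      decide +kernel
    obtain ⟨i, rfl⟩ := this J hne (by simp only [degB] at hd; omega)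
    exact h3 i
  | succ n ih =>
    refine hU (n + 1) fun J hne hd => ?_
    obtain ⟨i, hi⟩ := (hJ J).resolve_left hne
    by_cases h : n = 0 ∧ J.card = 1
    · obtain ⟨rfl, hc⟩ := h
      obtain ⟨j, rfl⟩ := Finset.card_eq_one.1 hc
      exact h1 j
    · refine gmono_succ_mem hbr hi (ih _ ?_)
      simp only [degB, Finset.card_insert_of_notMem hi] at hd ⊢
      push_cast at hd ⊢
      omega

theorem gPos_le {K : Submodule ℂ G} (h : ∀ m I, 0 < degB (m, I) → gmono m I ∈ K) : gPos ≤ K := by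
  rintro ⟨k, c⟩ ⟨hk, hc⟩
  obtain rfl : c = 0 := hc
  have : Finsupp.supported ℂ ℂ {a | 0 < degB a} ≤ K.comap (LinearMap.inl ℂ KPlus ℂ) := by
    rw [Finsupp.supported_eq_span_single, Submodule.span_le]
    rintro _ ⟨⟨m, I⟩, ha, rfl⟩
    exact h m I ha
  exact this hk

/-- Inverts the change of basis from the `ξ_i` to the `w_{ab}`, for any family substituted for the
`ξ_i`; it serves for `pX` and `pY`. -/
theorem wG_induction {M : Type*} [AddCommGroup M] [Module ℂ M] (f : Fin 4 → M)
    (K : Submodule ℂ M) (h00 : f 1 + Complex.I • f 0 ∈ K) (h01 : -f 3 + Complex.I • f 2 ∈ K)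
    (h10 : f 3 + Complex.I • f 2 ∈ K) (h11 : f 1 - Complex.I • f 0 ∈ K) : ∀ i, f i ∈ K := by
  have e : ∀ a : M, a = -(Complex.I * Complex.I) • a := fun a => by
    rw [Complex.I_mul_I, neg_neg, one_smul]
  have h0 : f 0 = (-Complex.I / 2) • ((f 1 + Complex.I • f 0) - (f 1 - Complex.I • f 0)) := by
    conv_lhs => rw [e (f 0)]
    module
  have h1 : f 1 = (1 / 2 : ℂ) • ((f 1 + Complex.I • f 0) + (f 1 - Complex.I • f 0)) := by module
  have h2 : f 2 = (-Complex.I / 2) • ((-f 3 + Complex.I • f 2) + (f 3 + Complex.I • f 2)) := by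
    conv_lhs => rw [e (f 2)]
    module
  have h3 : f 3 = (1 / 2 : ℂ) • ((f 3 + Complex.I • f 2) - (-f 3 + Complex.I • f 2)) := by module
  intro i
  fin_cases i
  · exact h0 ▸ K.smul_mem _ (K.sub_mem h00 h11)
  · exact h1 ▸ K.smul_mem _ (K.add_mem h00 h11)
  · exact h2 ▸ K.smul_mem _ (K.add_mem h01 h10)
  · exact h3 ▸ K.smul_mem _ (K.sub_mem h10 h01)

/-- `𝔤_{>0}` is generated by its component of degree `1`. -/
theorem gPos_le_of_generators {K : Submodule ℂ G} (hX : ∀ i j, PX i j ∈ K) (hY : ∀ i j, PY i j ∈ K)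
    (hbr : ∀ i, ∀ x ∈ K, gmono 1 {i} ∈ K → lieBr (gmono 1 {i}) x ∈ K) : gPos ≤ K := by
  have h1 := wG_induction pX K (hX 0 0) (hX 0 1) (hX 1 0) (hX 1 1)
  have h2 := wG_induction pY K (hY 0 0) (hY 0 1) (hY 1 0) (hY 1 1)
  have h3 : ∀ i, gmono 1 {i} ∈ K := fun i => by
    have : gmono 1 {i} = (1 / 2 : ℂ) • (pX i + pY i) := by rw [pX, pY]; module
    exact this ▸ K.smul_mem _ (K.add_mem (h1 i) (h2 i))
  have h4 : ∀ i, xiStar i ∈ K := fun i => by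
    have : xiStar i = (1 / 2 : ℂ) • (pY i - pX i) := by rw [pX, pY]; module
    exact this ▸ K.smul_mem _ (K.sub_mem (h2 i) (h1 i))
  refine gPos_le (gmono_mem_of_pos h3 (fun i => ?_) fun i x hx => hbr i x hx (h3 i))
  exact (K.smul_mem_iff (pow_ne_zero _ (neg_ne_zero.2 one_ne_zero))).1 (h4 i)

/-- Inverts the definitions of `XG` and `YG`: their traces give `t` and `C`, and the remaining
combinations give the six `ξ_{ij}`. -/
theorem gGe_le_of_generators {K : Submodule ℂ G} (kX : ∀ i j, XG i j ∈ K)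
    (kY : ∀ i j, YG i j ∈ K) (hP : gPos ≤ K) : gGe ≤ K := by
  obtain ⟨x00, x01, x10, x11⟩ := XG_eq
  obtain ⟨y00, y01, y10, y11⟩ := YG_eq
  have e : ∀ a : G, a = -(Complex.I * Complex.I) • a := fun a => by
    rw [Complex.I_mul_I, neg_neg, one_smul]
  have hT : tG = (-1 / 2 : ℂ) • (XG 0 0 + XG 1 1 + YG 0 0 + YG 1 1) := by
    rw [x00, x11, y00, y11]; module
  have hC : cG = (1 / 2 : ℂ) • (XG 0 0 + XG 1 1 - YG 0 0 - YG 1 1) := by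
    rw [x00, x11, y00, y11]; module
  have h01 : xi {0, 1} = (Complex.I / 2) • (XG 0 0 - XG 1 1 + (YG 0 0 - YG 1 1)) := by
    rw [x00, x11, y00, y11, hX, hY]
    conv_lhs => rw [e (xi {0, 1})]
    module
  have h23 : xi {2, 3} = (-Complex.I / 2) • (XG 0 0 - XG 1 1 - (YG 0 0 - YG 1 1)) := by
    rw [x00, x11, y00, y11, hX, hY]
    conv_lhs => rw [e (xi {2, 3})]
    module
  have h02 : xi {0, 2} = (1 / 2 : ℂ) • (XG 1 0 + YG 1 0 - XG 0 1 - YG 0 1) := by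
    rw [x01, x10, y01, y10, eX, fX, eY, fY]; module
  have h13 : xi {1, 3} = (1 / 2 : ℂ) • (XG 1 0 - YG 1 0 - XG 0 1 + YG 0 1) := by
    rw [x01, x10, y01, y10, eX, fX, eY, fY]; module
  have h03 : xi {0, 3} = (Complex.I / 2) • (XG 0 1 - YG 0 1 + XG 1 0 - YG 1 0) := by
    rw [x01, x10, y01, y10, eX, fX, eY, fY]
    conv_lhs => rw [e (xi {0, 3})]
    module
  have h12 : xi {1, 2} = (-Complex.I / 2) • (XG 0 1 + YG 0 1 + XG 1 0 + YG 1 0) := by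
    rw [x01, x10, y01, y10, eX, fX, eY, fY]
    conv_lhs => rw [e (xi {1, 2})]
    module
  have hpair : ∀ I : Finset (Fin 4), I.card = 2 → I = {0, 1} ∨ I = {2, 3} ∨ I = {0, 2} ∨
      I = {1, 3} ∨ I = {0, 3} ∨ I = {1, 2} := by decide
  intro x hx
  refine gGe_induction (P := fun x => x ∈ K) K.zero_mem (fun _ _ => K.add_mem)
    (fun c _ => K.smul_mem c) ?_ (fun m I h => ?_) hx
  · rw [hC]
    exact K.smul_mem _ (K.sub_mem (K.sub_mem (K.add_mem (kX _ _) (kX _ _)) (kY _ _)) (kY _ _))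
  · rcases h.eq_or_lt with h | h
    · rcases degB_eq_zero_cases h.symm with ⟨rfl, rfl⟩ | ⟨rfl, h2⟩
      · rw [← tG_eq_gmono, hT]
        exact K.smul_mem _ (K.add_mem (K.add_mem (K.add_mem (kX _ _) (kX _ _)) (kY _ _)) (kY _ _))
      · rw [← xi_eq_gmono]
        rcases hpair I h2 with rfl | rfl | rfl | rfl | rfl | rfl
        · exact h01 ▸ K.smul_mem _ (K.add_mem (K.sub_mem (kX _ _) (kX _ _))
            (K.sub_mem (kY _ _) (kY _ _)))
        · exact h23 ▸ K.smul_mem _ (K.sub_mem (K.sub_mem (kX _ _) (kX _ _))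
            (K.sub_mem (kY _ _) (kY _ _)))
        · exact h02 ▸ K.smul_mem _ (K.sub_mem (K.sub_mem (K.add_mem (kX _ _) (kY _ _)) (kX _ _))
            (kY _ _))
        · exact h13 ▸ K.smul_mem _ (K.add_mem (K.sub_mem (K.sub_mem (kX _ _) (kY _ _)) (kX _ _))
            (kY _ _))
        · exact h03 ▸ K.smul_mem _ (K.sub_mem (K.add_mem (K.sub_mem (kX _ _) (kY _ _)) (kX _ _))
            (kY _ _))
        · exact h12 ▸ K.smul_mem _ (K.add_mem (K.add_mem (K.add_mem (kX _ _) (kY _ _)) (kX _ _))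
            (kY _ _))
    · refine hP ⟨Finsupp.single_mem_supported ℂ (1 : ℂ) h, Submodule.zero_mem _⟩

/-! # Morphisms of induced modules -/

section Lift

variable {F N : Type} [AddCommGroup F] [Module ℂ F] [AddCommGroup N] [Module ℂ N] [Module U N]
  [IsScalarTower ℂ U N]

/-- The `U`-linear extension of a linear map. -/
def tensorLift (ψ : F →ₗ[ℂ] N) : U ⊗[ℂ] F →ₗ[U] N :=
  { TensorProduct.lift (LinearMap.mk₂ ℂ (fun (u : U) v => u • ψ v)
      (fun u u' v => add_smul u u' (ψ v)) (fun c u v => smul_assoc c u (ψ v))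
      (fun u v v' => by rw [map_add, smul_add])
      (fun c u v => by
        rw [map_smul, ← algebraMap_smul U c (ψ v), ← algebraMap_smul U c (u • ψ v), smul_smul,
          smul_smul, Algebra.commutes])) with
    map_smul' := fun a z => by
      induction z using TensorProduct.induction_on with
      | zero => simp
      | add x y hx hy =>
        simp only [AddHom.toFun_eq_coe, LinearMap.coe_toAddHom, RingHom.id_apply, smul_add,
          map_add] at hx hy ⊢
        rw [hx, hy]
      | tmul u v =>
        simp [TensorProduct.smul_tmul', mul_smul] }

theorem tensorLift_tmul (ψ : F →ₗ[ℂ] N) (u : U) (v : F) : tensorLift ψ (u ⊗ₜ v) = u • ψ v := rfl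

/-- The universal property of the induced module. -/
def indLift (ρ : gGe →ₗ[ℂ] Module.End ℂ F) (ψ : F →ₗ[ℂ] N)
    (h : ∀ (x : gGe) v, iota (x : G) • ψ v = ψ (ρ x v)) : Ind ρ →ₗ[U] N :=
  (indRel ρ).liftQ (tensorLift ψ) (by
    rw [indRel, Submodule.span_le]
    rintro _ ⟨u, x, v, rfl⟩
    rw [SetLike.mem_coe, LinearMap.mem_ker, map_sub, tensorLift_tmul, tensorLift_tmul, mul_smul,
      h, sub_self])

end Lift

/-! ### The action of `𝔤` transported to `U(𝔤_{<0}) ⊗ V_X` -/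

theorem act_isGeRep (q : Quadrant) : IsGeRep (act q) where
  xi i := by rw [xi_eq_gmono, act_gmono, actB_eq_zero q _ _ (by simp [degB])]
  oneG := by rw [oneG, act_gmono, actB_eq_zero q _ _ (by simp [degB])]
  par x := act_parG q x
  lie x hx y hy := act_lieBr q hx hy

/-- The Poincaré–Birkhoff–Witt isomorphism for `M_X`. -/
def ambEquiv (q : Quadrant) : MV ≃ₗ[ℂ] Ind (act q ∘ₗ gGe.subtype) :=
  LinearEquiv.ofBijective (pbwInd _) ⟨pbwInd_injective (act_isGeRep q), pbwInd_surjective _⟩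

theorem ambEquiv_apply (q : Quadrant) (z : MV) : ambEquiv q z = pbwInd _ z := rfl

theorem ambEquiv_smul (q : Quadrant) (u : UNeg) (z : MV) :
    ambEquiv q (u • z) = (u : U) • ambEquiv q z := (coe_smul_pbwInd _ u z).symm

/-- The action of `𝔤` on the space `U(𝔤_{<0}) ⊗ V_X` underlying `M_X`. -/
def gAct (q : Quadrant) : G →ₗ[ℂ] Module.End ℂ MV :=
  LinearMap.mk₂ ℂ (fun x z => (ambEquiv q).symm (iota x • ambEquiv q z))
    (fun x y z => by rw [map_add, add_smul, map_add])
    (fun c x z => by rw [iota.map_smul, smul_assoc, (ambEquiv q).symm.map_smul])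
    (fun x z z' => by rw [map_add, smul_add, map_add])
    (fun c x z => by
      rw [(ambEquiv q).map_smul, ← (ambEquiv q).symm.map_smul,
        ← algebraMap_smul U c (ambEquiv q z), ← algebraMap_smul U c (iota x • ambEquiv q z),
        smul_smul, smul_smul, Algebra.commutes])

theorem ambEquiv_gAct (q : Quadrant) (x : G) (z : MV) :
    ambEquiv q (gAct q x z) = iota x • ambEquiv q z :=
  (ambEquiv q).apply_symm_apply _

theorem gAct_eq_iff (q : Quadrant) (x : G) (z z' : MV) :
    gAct q x z = z' ↔ iota x • ambEquiv q z = ambEquiv q z' := by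
  rw [← (ambEquiv q).injective.eq_iff, ambEquiv_gAct]

theorem gAct_one_tmul (q : Quadrant) {x : G} (hx : x ∈ gGe) (f : V) :
    gAct q x (1 ⊗ₜ f) = 1 ⊗ₜ act q x f := by
  rw [gAct_eq_iff, ambEquiv_apply, ambEquiv_apply, pbwInd_tmul, pbwInd_tmul, Subalgebra.coe_one,
    one_smul, one_smul, iota_smul_indMk _ ⟨x, hx⟩]
  rfl

theorem gAct_wU_smul (q : Quadrant) (x : G) (a b : Fin 2) (z : MV) :
    gAct q x (wU a b • z) = wU a b • gAct q (parG x) z + gAct q (lieBr x (wG a b)) z := by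
  rw [gAct_eq_iff, ambEquiv_smul, coe_wU, smul_smul, iota_mul_wG, add_smul, mul_smul,
    ← coe_wU, ← ambEquiv_gAct, ← ambEquiv_gAct, ← ambEquiv_smul, map_add]

theorem gAct_wG (q : Quadrant) (a b : Fin 2) (z : MV) : gAct q (wG a b) z = wU a b • z := by
  rw [gAct_eq_iff, ambEquiv_smul, coe_wU]

theorem gAct_txi_lieBr (q : Quadrant) (i : Fin 4) (x : G) (z : MV) :
    gAct q (lieBr (gmono 1 {i}) x) z =
      gAct q (gmono 1 {i}) (gAct q x z) - gAct q (parG x) (gAct q (gmono 1 {i}) z) := by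
  have key : iota (gmono 1 {i}) * iota x =
      iota (parG x) * iota (gmono 1 {i}) + iota (lieBr (gmono 1 {i}) x) := by
    have : (LinearMap.mulLeft ℂ (iota (gmono 1 {i}))) ∘ₗ iota =
        (LinearMap.mulRight ℂ (iota (gmono 1 {i}))) ∘ₗ iota ∘ₗ parG
          + iota ∘ₗ lieL (gmono 1 {i}) := by
      refine hom_ext_G (fun m I => ?_) ?_
      · have := iota_mul_iota (gmono_mem_parPart 1 {i}) (gmono_mem_parPart m I)
        simp only [Finset.card_singleton, Nat.one_mod, one_mul,
          ← neg_one_pow_eq_pow_mod_two] at this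
        simpa [lieL_apply, parG_gmono] using this
      · have := iota_mul_iota (gmono_mem_parPart 1 {i}) cG_mem_parPart
        simpa [lieL_apply, parG_cG] using this
    simpa [lieL_apply] using LinearMap.congr_fun this x
  rw [gAct_eq_iff, map_sub, ambEquiv_gAct, ambEquiv_gAct, ambEquiv_gAct, ambEquiv_gAct, smul_smul,
    smul_smul, key, add_smul, add_sub_cancel_left]

theorem gPos_le_gGe : gPos ≤ gGe := gPos_le fun _ _ h => gmono_mem_gGe h.le

theorem act_gPos (q : Quadrant) {x : G} (hx : x ∈ gPos) : act q x = 0 :=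
  gPos_le (K := LinearMap.ker (act q)) (fun m I h => by
    rw [LinearMap.mem_ker, act_gmono, actB_eq_zero q _ _ h.ne']) hx

theorem XG_mem_gGe (i j : Fin 2) : XG i j ∈ gGe := by
  have hx : ∀ I : Finset (Fin 4), I.card = 2 → xi I ∈ gGe := fun I h =>
    gmono_mem_gGe (by simp [degB, h])
  have ht : tG ∈ gGe := gmono_mem_gGe (by simp [degB])
  have hX : hX ∈ gGe :=
    gGe.add_mem (gGe.smul_mem _ (hx _ (by decide))) (gGe.smul_mem _ (hx _ (by decide)))
  revert i j
  simp only [Fin.forall_fin_two, XG_eq, eX, fX]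
  refine ⟨⟨gGe.smul_mem _ (gGe.add_mem (gGe.sub_mem cG_mem_gGe ht) hX), gGe.smul_mem _ ?_⟩,
    gGe.smul_mem _ ?_, gGe.smul_mem _ (gGe.sub_mem (gGe.sub_mem cG_mem_gGe ht) hX)⟩
  · exact gGe.add_mem (gGe.sub_mem (gGe.sub_mem (gGe.neg_mem (hx _ (by decide)))
      (hx _ (by decide))) (gGe.smul_mem _ (hx _ (by decide)))) (gGe.smul_mem _ (hx _ (by decide)))
  · exact gGe.add_mem (gGe.sub_mem (gGe.add_mem (hx _ (by decide))
      (hx _ (by decide))) (gGe.smul_mem _ (hx _ (by decide)))) (gGe.smul_mem _ (hx _ (by decide)))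

theorem YG_mem_gGe (i j : Fin 2) : YG i j ∈ gGe := by
  have hx : ∀ I : Finset (Fin 4), I.card = 2 → xi I ∈ gGe := fun I h =>
    gmono_mem_gGe (by simp [degB, h])
  have ht : tG ∈ gGe := gmono_mem_gGe (by simp [degB])
  have hY : hY ∈ gGe :=
    gGe.sub_mem (gGe.smul_mem _ (hx _ (by decide))) (gGe.smul_mem _ (hx _ (by decide)))
  have hC := gGe.neg_mem cG_mem_gGe
  revert i j
  simp only [Fin.forall_fin_two, YG_eq, eY, fY]
  refine ⟨⟨gGe.smul_mem _ (gGe.add_mem (gGe.sub_mem hC ht) hY), gGe.smul_mem _ ?_⟩,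
    gGe.smul_mem _ ?_, gGe.smul_mem _ (gGe.sub_mem (gGe.sub_mem hC ht) hY)⟩
  · exact gGe.add_mem (gGe.add_mem (gGe.add_mem (gGe.neg_mem (hx _ (by decide)))
      (hx _ (by decide))) (gGe.smul_mem _ (hx _ (by decide)))) (gGe.smul_mem _ (hx _ (by decide)))
  · exact gGe.add_mem (gGe.add_mem (gGe.sub_mem (hx _ (by decide))
      (hx _ (by decide))) (gGe.smul_mem _ (hx _ (by decide)))) (gGe.smul_mem _ (hx _ (by decide)))

theorem pX_mem_gPos (i : Fin 4) : gmono 1 {i} ∈ gPos ∧ xiStar i ∈ gPos := by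
  have h : ({i}ᶜ : Finset (Fin 4)).card = 3 := by revert i; decide
  refine ⟨⟨Finsupp.single_mem_supported ℂ (1 : ℂ) ?_, Submodule.zero_mem _⟩, gPos.smul_mem _
    ⟨Finsupp.single_mem_supported ℂ (1 : ℂ) ?_, Submodule.zero_mem _⟩⟩ <;> simp [degB, h]

theorem PX_mem_gPos (i j : Fin 2) : PX i j ∈ gPos := by
  have h : ∀ i, pX i ∈ gPos := fun i => gPos.sub_mem (pX_mem_gPos i).1 (pX_mem_gPos i).2
  revert i j
  simp only [Fin.forall_fin_two, PX_eq]
  exact ⟨⟨gPos.add_mem (h _) (gPos.smul_mem _ (h _)),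
    gPos.add_mem (gPos.neg_mem (h _)) (gPos.smul_mem _ (h _))⟩,
    gPos.add_mem (h _) (gPos.smul_mem _ (h _)), gPos.sub_mem (h _) (gPos.smul_mem _ (h _))⟩

theorem PY_mem_gPos (i j : Fin 2) : PY i j ∈ gPos := by
  have h : ∀ i, pY i ∈ gPos := fun i => gPos.add_mem (pX_mem_gPos i).1 (pX_mem_gPos i).2
  revert i j
  simp only [Fin.forall_fin_two, PY_eq]
  exact ⟨⟨gPos.add_mem (h _) (gPos.smul_mem _ (h _)),
    gPos.add_mem (gPos.neg_mem (h _)) (gPos.smul_mem _ (h _))⟩,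
    gPos.add_mem (h _) (gPos.smul_mem _ (h _)), gPos.sub_mem (h _) (gPos.smul_mem _ (h _))⟩

theorem SubRep.incl_injective {q : Quadrant} (S : SubRep q) : Function.Injective S.incl :=
  Module.Flat.lTensor_preserves_injective_linearMap S.carrier.subtype S.carrier.injective_subtype

theorem SubRep.incl_smul {q : Quadrant} (S : SubRep q) (u : UNeg) (y : S.M) :
    S.incl (u • y) = u • S.incl y := by
  induction y using TensorProduct.induction_on with
  | zero => simp
  | add a b ha hb => simp only [smul_add, map_add, ha, hb]
  | tmul w v => rfl

theorem SubRep.incl_tmul {q : Quadrant} (S : SubRep q) (u : UNeg) (v : S.carrier) :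
    S.incl (u ⊗ₜ v) = u ⊗ₜ (v : V) := rfl

/-- The inclusion of `Ind S` in `M_X`. -/
def SubRep.indIncl {q : Quadrant} (S : SubRep q) : S.ind →ₗ[U] Ind (act q ∘ₗ gGe.subtype) :=
  indLift S.rho (indMk _ ∘ₗ S.carrier.subtype) fun x v => iota_smul_indMk _ x (v : V)

theorem SubRep.indIncl_pbw {q : Quadrant} (S : SubRep q) (y : S.M) :
    S.indIncl (S.pbw y) = ambEquiv q (S.incl y) := by
  induction y using TensorProduct.induction_on with
  | zero => simp
  | add a b ha hb => simp only [map_add, ha, hb]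
  | tmul w v => rw [S.incl_tmul, ambEquiv_apply, pbwInd_tmul]; rfl

/-- Under the PBW identifications the map becomes `id ⊗` inclusion, injective over a field. Thus all
calculations may be carried out in `M_X` rather than in the modules induced from submodules. -/
theorem SubRep.indIncl_injective {q : Quadrant} (S : SubRep q) :
    Function.Injective S.indIncl := by
  rw [injective_iff_map_eq_zero]
  intro n hn
  obtain ⟨y, rfl⟩ := S.pbw_bijective.2 n
  rw [S.indIncl_pbw, map_eq_zero_iff _ (ambEquiv q).injective,
    map_eq_zero_iff _ S.incl_injective] at hn
  rw [hn, map_zero]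

/-- The universal property of induction extends `v ↦ Φ (1 ⊗ v)` to a `U(𝔤)`-linear map into `M_Y`;
left linearity shows that it agrees with `Φ` everywhere and that it lands in the submodule induced
from `T`. -/
theorem isMorphism_of_gAct {p q : Quadrant} (S : SubRep p) (T : SubRep q) (Φ : MV →ₗ[ℂ] MV)
    (hL : ∀ (u : UNeg) z, Φ (u • z) = u • Φ z)
    (hT : ∀ v ∈ S.carrier, Φ (1 ⊗ₜ v) ∈ LinearMap.range T.incl)
    (hx : ∀ x ∈ gGe, ∀ v ∈ S.carrier, gAct q x (Φ (1 ⊗ₜ v)) = Φ (1 ⊗ₜ act p x v)) :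
    IsMorphism S T Φ := by
  have ht : ∀ (u : UNeg) (v : V), u ⊗ₜ[ℂ] v = u • (1 : UNeg) ⊗ₜ[ℂ] v := fun u v => by
    rw [TensorProduct.smul_tmul', smul_eq_mul, mul_one]
  let Ψ : S.ind →ₗ[U] Ind (act q ∘ₗ gGe.subtype) :=
    indLift S.rho ((ambEquiv q).toLinearMap ∘ₗ Φ ∘ₗ TensorProduct.mk ℂ UNeg V 1 ∘ₗ
      S.carrier.subtype) fun x v => by
        change iota (x : G) • ambEquiv q (Φ (1 ⊗ₜ v)) = ambEquiv q (Φ (1 ⊗ₜ act p x v))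
        rw [← hx x x.2 v v.2, ambEquiv_gAct]
  have hΨ : ∀ y : S.M, Ψ (S.pbw y) = ambEquiv q (Φ (S.incl y)) := by
    intro y
    induction y using TensorProduct.induction_on with
    | zero => simp
    | add a b ha hb => simp only [map_add, ha, hb]
    | tmul w v =>
      rw [S.incl_tmul, ht, hL, ambEquiv_smul]; rfl
  have hR : ∀ y : S.M, ∃ y' : T.M, T.incl y' = Φ (S.incl y) := by
    intro y
    induction y using TensorProduct.induction_on with
    | zero => exact ⟨0, by simp⟩
    | add a b ha hb =>
      obtain ⟨a', ha'⟩ := ha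
      obtain ⟨b', hb'⟩ := hb
      exact ⟨a' + b', by simp only [map_add, ha', hb']⟩
    | tmul w v =>
      obtain ⟨y', hy'⟩ := hT v v.2
      exact ⟨w • y', by rw [T.incl_smul, hy', S.incl_tmul, ht w, hL]⟩
  have hmem : ∀ n, Ψ n ∈ LinearMap.range T.indIncl := by
    intro n
    obtain ⟨y, rfl⟩ := S.pbw_bijective.2 n
    obtain ⟨y', hy'⟩ := hR y
    exact ⟨T.pbw y', by rw [T.indIncl_pbw, hΨ, hy']⟩
  refine ⟨(LinearEquiv.ofInjective T.indIncl T.indIncl_injective).symm.toLinearMap ∘ₗ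
    Ψ.codRestrict _ hmem, fun y => ?_⟩
  obtain ⟨y', hy'⟩ := hR y
  refine ⟨y', hy', ?_⟩
  rw [LinearMap.comp_apply, LinearEquiv.coe_coe, LinearEquiv.symm_apply_eq]
  ext
  rw [LinearEquiv.ofInjective_apply, T.indIncl_pbw, LinearMap.codRestrict_apply, hΨ, hy']

/-- If `t ξ_i` and `x` annihilate `z`, so does their bracket. Hence annihilation by the degree 1
elements propagates to all of `𝔤_{>0}`. -/
theorem gAct_gPos_eq_zero {q : Quadrant} {z : MV} (hX : ∀ i j, gAct q (PX i j) z = 0)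
    (hY : ∀ i j, gAct q (PY i j) z = 0) {x : G} (hx : x ∈ gPos) : gAct q x z = 0 := by
  refine gPos_le_of_generators (K := LinearMap.ker ((gAct q).flip z)) hX hY ?_ hx
  intro i x hx hi
  rw [LinearMap.mem_ker, LinearMap.flip_apply] at hx hi ⊢
  rw [gAct_txi_lieBr, hx, hi, map_zero, map_zero, sub_zero]

/-- A left linear map is a morphism as soon as it commutes with the generators of `𝔤_{≥0}` on the
vectors `1 ⊗ v`. -/
theorem isMorphism_of_generators {p q : Quadrant} (S : SubRep p) (T : SubRep q) (Φ : MV →ₗ[ℂ] MV)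
    (hL : ∀ (u : UNeg) z, Φ (u • z) = u • Φ z)
    (hT : ∀ v ∈ S.carrier, Φ (1 ⊗ₜ v) ∈ LinearMap.range T.incl)
    (hX : ∀ i j, ∀ v ∈ S.carrier, gAct q (XG i j) (Φ (1 ⊗ₜ v)) = Φ (1 ⊗ₜ act p (XG i j) v))
    (hY : ∀ i j, ∀ v ∈ S.carrier, gAct q (YG i j) (Φ (1 ⊗ₜ v)) = Φ (1 ⊗ₜ act p (YG i j) v))
    (hPX : ∀ i j, ∀ v ∈ S.carrier, gAct q (PX i j) (Φ (1 ⊗ₜ v)) = 0)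
    (hPY : ∀ i j, ∀ v ∈ S.carrier, gAct q (PY i j) (Φ (1 ⊗ₜ v)) = 0) :
    IsMorphism S T Φ := by
  refine isMorphism_of_gAct S T Φ hL hT fun x hx v hv => ?_
  let K : Submodule ℂ G := LinearMap.eqLocus ((gAct q).flip (Φ (1 ⊗ₜ v)))
    (Φ ∘ₗ TensorProduct.mk ℂ UNeg V 1 ∘ₗ (act p).flip v)
  refine gGe_le_of_generators (K := K) (fun i j => hX i j v hv) (fun i j => hY i j v hv) ?_ hx
  intro x hx
  change gAct q x (Φ (1 ⊗ₜ v)) = Φ (1 ⊗ₜ act p x v)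
  rw [act_gPos p hx, gAct_gPos_eq_zero (fun i j => hPX i j v hv) (fun i j => hPY i j v hv) hx,
    LinearMap.zero_apply, TensorProduct.tmul_zero, map_zero]

/-! # The Weyl algebra acting on `V_X` -/

/-- Multiplication by `x_i`, or minus the derivation by `∂_{x_i}`. -/
def mx (q : Quadrant) (i : Fin 2) : V →ₗ[ℂ] V :=
  if q.xDual then -(MvPolynomial.pderiv (Sum.inl i)).toLinearMap else LinearMap.mulLeft ℂ (lx i)

/-- Multiplication by `y_i`, or minus the derivation by `∂_{y_i}`. -/
def my (q : Quadrant) (i : Fin 2) : V →ₗ[ℂ] V :=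
  if q.yDual then -(MvPolynomial.pderiv (Sum.inr i)).toLinearMap else LinearMap.mulLeft ℂ (ly i)

theorem pderiv_comm (i j : Fin 2 ⊕ Fin 2) (f : V) : MvPolynomial.pderiv i (MvPolynomial.pderiv j f)
    = MvPolynomial.pderiv j (MvPolynomial.pderiv i f) := by
  have : ⁅MvPolynomial.pderiv (R := ℂ) i, MvPolynomial.pderiv (R := ℂ) j⁆ = 0 :=
    MvPolynomial.derivation_ext fun k => by
      rw [Derivation.commutator_apply, MvPolynomial.pderiv_X, MvPolynomial.pderiv_X]
      by_cases h1 : k = i <;> by_cases h2 : k = j <;> simp [Pi.single_apply, h1, h2] <;>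
        split_ifs <;> simp
  exact apply_comm_of_lie this f

theorem pderiv_inl_lx (i j : Fin 2) :
    MvPolynomial.pderiv (Sum.inl i) (lx j) = if i = j then 1 else 0 := by
  rw [lx, MvPolynomial.pderiv_X]
  simp [Pi.single_apply, eq_comm]

theorem pderiv_inr_ly (i j : Fin 2) :
    MvPolynomial.pderiv (Sum.inr i) (ly j) = if i = j then 1 else 0 := by
  rw [ly, MvPolynomial.pderiv_X]
  simp [Pi.single_apply, eq_comm]

theorem pderiv_inl_ly (i j : Fin 2) : MvPolynomial.pderiv (Sum.inl i) (ly j) = 0 := by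
  rw [ly, MvPolynomial.pderiv_X]
  simp

theorem pderiv_inr_lx (i j : Fin 2) : MvPolynomial.pderiv (Sum.inr i) (lx j) = 0 := by
  rw [lx, MvPolynomial.pderiv_X]
  simp

theorem glX_apply (q : Quadrant) (i j : Fin 2) (f : V) : glX q i j f =
    if q.xDual then -(lx j * MvPolynomial.pderiv (Sum.inl i) f)
    else lx i * MvPolynomial.pderiv (Sum.inl j) f := by
  have : glX q i j = if q.xDual then (-lx j) • MvPolynomial.pderiv (R := ℂ) (Sum.inl i)
      else lx i • MvPolynomial.pderiv (R := ℂ) (Sum.inl j) := by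
    refine MvPolynomial.derivation_ext fun k => ?_
    rcases k with k | k
    · have hk := pderiv_inl_lx i k
      have hk' := pderiv_inl_lx j k
      rw [lx] at hk hk'
      cases h : q.xDual <;> by_cases h1 : i = k <;> by_cases h2 : j = k <;>
        simp_all [glX, MvPolynomial.mkDerivation_X]
    · have hk := pderiv_inl_ly i k
      have hk' := pderiv_inl_ly j k
      rw [ly] at hk hk'
      cases h : q.xDual <;> simp [glX, MvPolynomial.mkDerivation_X, hk, hk', h]
  rw [this]
  split_ifs <;> simp

theorem glY_apply (q : Quadrant) (i j : Fin 2) (f : V) : glY q i j f =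
    if q.yDual then -(ly j * MvPolynomial.pderiv (Sum.inr i) f)
    else ly i * MvPolynomial.pderiv (Sum.inr j) f := by
  have : glY q i j = if q.yDual then (-ly j) • MvPolynomial.pderiv (R := ℂ) (Sum.inr i)
      else ly i • MvPolynomial.pderiv (R := ℂ) (Sum.inr j) := by
    refine MvPolynomial.derivation_ext fun k => ?_
    rcases k with k | k
    · have hk := pderiv_inr_lx i k
      have hk' := pderiv_inr_lx j k
      rw [lx] at hk hk'
      cases h : q.yDual <;> simp [glY, MvPolynomial.mkDerivation_X, hk, hk', h]
    · have hk := pderiv_inr_ly i k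
      have hk' := pderiv_inr_ly j k
      rw [ly] at hk hk'
      cases h : q.yDual <;> by_cases h1 : i = k <;> by_cases h2 : j = k <;>
        simp_all [glY, MvPolynomial.mkDerivation_X]
  rw [this]
  split_ifs <;> simp

/-- With dual letters `∂_{x_j}` is a multiplication and `x_i` is minus a derivation; in the order
`x_i ∂_{x_j}` the Leibniz rule leaves the extra constant `-δ_{ij}`. -/
theorem mx_dx (q : Quadrant) (i j : Fin 2) (f : V) :
    mx q i (dx q j f) = glX q i j f - if q.xDual ∧ i = j then f else 0 := by
  rw [glX_apply]
  cases h : q.xDual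
  · simp [mx, dx, h]
  · by_cases hij : i = j
    · simp [mx, dx, h, pderiv_inl_lx, hij]; ring
    · simp [mx, dx, h, pderiv_inl_lx, hij]

theorem my_dy (q : Quadrant) (i j : Fin 2) (f : V) :
    my q i (dy q j f) = glY q i j f - if q.yDual ∧ i = j then f else 0 := by
  rw [glY_apply]
  cases h : q.yDual
  · simp [my, dy, h]
  · by_cases hij : i = j
    · simp [my, dy, h, pderiv_inr_ly, hij]; ring
    · simp [my, dy, h, pderiv_inr_ly, hij]

/-- The trace `XG 0 0 + XG 1 1 = C - t` acts as `E_x` plus the difference of the two shifts, which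
is `0` for `A`, `D` and `-2` for `B`, `C`: precisely the normal ordering constant summed over two
letters. -/
theorem act_XG (q : Quadrant) (f : V) : ∀ i j, act q (XG i j) f = mx q i (dx q j f) := by
  simp only [Fin.forall_fin_two, XG_eq, mx_dx, map_smul, map_add, map_sub, act_cG, act_tG, act_eX,
    act_fX, act_hX, LinearMap.smul_apply, LinearMap.add_apply, LinearMap.sub_apply, actC, actT,
    eulX, cartX, Derivation.coeFn_coe, Derivation.add_apply, Derivation.sub_apply,
    LinearMap.id_apply]
  refine ⟨⟨?_, ?_⟩, ⟨?_, ?_⟩⟩ <;> cases q <;>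
    simp only [Quadrant.cShift, Quadrant.tShift, Quadrant.xDual, and_true, if_true, and_false,
      if_false, Bool.false_eq_true, zero_ne_one, one_ne_zero] <;> module

theorem act_YG (q : Quadrant) (f : V) : ∀ i j, act q (YG i j) f = my q i (dy q j f) := by
  simp only [Fin.forall_fin_two, YG_eq, my_dy, map_smul, map_add, map_sub, map_neg, act_cG, act_tG,
    act_eY, act_fY, act_hY, LinearMap.smul_apply, LinearMap.add_apply, LinearMap.sub_apply,
    LinearMap.neg_apply, actC, actT, eulY, cartY, Derivation.coeFn_coe, Derivation.add_apply,
    Derivation.sub_apply, LinearMap.id_apply]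
  refine ⟨⟨?_, ?_⟩, ⟨?_, ?_⟩⟩ <;> cases q <;>
    simp only [Quadrant.cShift, Quadrant.tShift, Quadrant.yDual, and_true, if_true, and_false,
      if_false, Bool.false_eq_true, zero_ne_one, one_ne_zero] <;> module

/-- The canonical commutation relation, the same in all quadrants; with it the choice of letters
disappears from the calculations. -/
theorem dx_mx (q : Quadrant) (a i : Fin 2) (f : V) :
    dx q a (mx q i f) = mx q i (dx q a f) + if a = i then f else 0 := by
  cases h : q.xDual <;> by_cases hai : a = i
  · simp [mx, dx, h, pderiv_inl_lx, hai]
  · simp [mx, dx, h, pderiv_inl_lx, hai]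
  · simp [mx, dx, h, pderiv_inl_lx, hai]
  · simp [mx, dx, h, pderiv_inl_lx, hai, Ne.symm hai]

theorem dy_my (q : Quadrant) (a i : Fin 2) (f : V) :
    dy q a (my q i f) = my q i (dy q a f) + if a = i then f else 0 := by
  cases h : q.yDual <;> by_cases hai : a = i
  · simp [my, dy, h, pderiv_inr_ly, hai]
  · simp [my, dy, h, pderiv_inr_ly, hai]
  · simp [my, dy, h, pderiv_inr_ly, hai]
  · simp [my, dy, h, pderiv_inr_ly, hai, Ne.symm hai]

theorem dx_dx (q : Quadrant) (a b : Fin 2) (f : V) : dx q a (dx q b f) = dx q b (dx q a f) := by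
  cases h : q.xDual
  · simp [dx, h, pderiv_comm]
  · simp [dx, h, mul_left_comm]

theorem dy_dy (q : Quadrant) (a b : Fin 2) (f : V) : dy q a (dy q b f) = dy q b (dy q a f) := by
  cases h : q.yDual
  · simp [dy, h, pderiv_comm]
  · simp [dy, h, mul_left_comm]

theorem dy_dx (p q : Quadrant) (a b : Fin 2) (f : V) :
    dy p a (dx q b f) = dx q b (dy p a f) := by
  cases h : q.xDual <;> cases h' : p.yDual
  · simp [dx, dy, h, h', pderiv_comm (Sum.inl b)]
  · simp [dx, dy, h, h', pderiv_inl_ly]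
  · simp [dx, dy, h, h', pderiv_inr_lx]
  · simp [dx, dy, h, h', mul_left_comm]

theorem dy_mx (p q : Quadrant) (a b : Fin 2) (f : V) :
    dy p a (mx q b f) = mx q b (dy p a f) := by
  cases h : q.xDual <;> cases h' : p.yDual
  · simp [mx, dy, h, h', pderiv_inr_lx]
  · simp [mx, dy, h, h', mul_left_comm]
  · simp [mx, dy, h, h', pderiv_comm (Sum.inl b)]
  · simp [mx, dy, h, h', pderiv_inl_ly]

theorem dx_my (p q : Quadrant) (a b : Fin 2) (f : V) :
    dx p a (my q b f) = my q b (dx p a f) := by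
  cases h : q.yDual <;> cases h' : p.xDual
  · simp [my, dx, h, h', pderiv_inl_ly]
  · simp [my, dx, h, h', mul_left_comm]
  · simp [my, dx, h, h', pderiv_comm (Sum.inl a)]
  · simp [my, dx, h, h', pderiv_inr_lx]

/-! # Calculus in `U(𝔤_{<0}) ⊗ V_X` -/

/-- The map `f ↦ 1 ⊗ f`. -/
def oneT : V →ₗ[ℂ] MV := TensorProduct.mk ℂ UNeg V 1

theorem oneT_apply (f : V) : oneT f = 1 ⊗ₜ f := rfl

/-- Left multiplication by an element of `U(𝔤_{<0})`. -/
def uL (u : UNeg) : Module.End ℂ MV := Module.toModuleEnd ℂ (S := UNeg) MV u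

theorem uL_apply (u : UNeg) (z : MV) : uL u z = u • z := rfl

theorem uL_mul (u u' : UNeg) (z : MV) : uL (u * u') z = uL u (uL u' z) := mul_smul u u' z

theorem uL_add (u u' : UNeg) (z : MV) : uL (u + u') z = uL u z + uL u' z := add_smul u u' z

theorem uL_neg (u : UNeg) (z : MV) : uL (-u) z = -uL u z := neg_smul u z

theorem uL_smul (c : ℂ) (u : UNeg) (z : MV) : uL (c • u) z = c • uL u z := smul_assoc c u z

/-- Left multiplication by `w_{ab}`. -/
def wL (a b : Fin 2) : Module.End ℂ MV := uL (wU a b)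

theorem wL_apply (a b : Fin 2) (z : MV) : wL a b z = wU a b • z := rfl

theorem wL_anticomm (a b c d : Fin 2) (z : MV) :
    wL a b (wL c d z) = -wL c d (wL a b z) + (eps a c * eps b d) • uL kappa z := by
  rw [wL, wL, ← uL_mul, wU_anticomm, ← uL_mul, ← uL_smul, uL_add, uL_neg]

theorem wL_wL_self (a b : Fin 2) (z : MV) : wL a b (wL a b z) = 0 := by
  have h := wL_anticomm a b a b z
  have h0 : eps a a = 0 := by revert a; simp [Fin.forall_fin_two, eps_eq]
  rw [h0, zero_mul, zero_smul, add_zero] at h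
  have h2 : (2 : ℂ) • wL a b (wL a b z) = 0 := by
    rw [two_smul]; nth_rewrite 1 [h]; exact neg_add_cancel _
  exact (smul_eq_zero_iff_right two_ne_zero).1 h2

theorem wL_kappa (a b : Fin 2) (z : MV) : wL a b (uL kappa z) = uL kappa (wL a b z) := by
  rw [wL, ← uL_mul, ← uL_mul, kappa_comm]

/-- Rewriting rules to the normal order `w₁₁, w₁₂, w₂₁, w₂₂`. With the squares zero and `κ` central,
they reduce identities between products of the `w`'s to linear algebra. -/
theorem wL_order (z : MV) :
    wL 0 1 (wL 0 0 z) = -wL 0 0 (wL 0 1 z) ∧ wL 1 0 (wL 0 0 z) = -wL 0 0 (wL 1 0 z) ∧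
    wL 1 1 (wL 0 0 z) = -wL 0 0 (wL 1 1 z) + uL kappa z ∧
    wL 1 0 (wL 0 1 z) = -wL 0 1 (wL 1 0 z) - uL kappa z ∧
    wL 1 1 (wL 0 1 z) = -wL 0 1 (wL 1 1 z) ∧ wL 1 1 (wL 1 0 z) = -wL 1 0 (wL 1 1 z) := by
  refine ⟨?_, ?_, ?_, ?_, ?_, ?_⟩ <;> rw [wL_anticomm] <;> simp only [eps_eq] <;> module

theorem wU_tmul (a b : Fin 2) (f : V) : wU a b ⊗ₜ[ℂ] f = wL a b (oneT f) := by
  rw [wL_apply, oneT_apply, TensorProduct.smul_tmul', smul_eq_mul, mul_one]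

theorem uL_oneT (u : UNeg) (f : V) : uL u (oneT f) = u ⊗ₜ f := by
  rw [uL_apply, oneT_apply, TensorProduct.smul_tmul', smul_eq_mul, mul_one]

theorem gAct_wL (q : Quadrant) (x : G) (a b : Fin 2) (z : MV) :
    gAct q x (wL a b z) = wL a b (gAct q (parG x) z) + gAct q (lieBr x (wG a b)) z :=
  gAct_wU_smul q x a b z

theorem gAct_XG_wL (q : Quadrant) (i j a b : Fin 2) (z : MV) : gAct q (XG i j) (wL a b z) =
    wL a b (gAct q (XG i j) z) + if j = a then wL i b z else 0 := by
  rw [gAct_wL, parG_XG, lieBr_XG_wG]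
  split_ifs
  · rw [gAct_wG, wL_apply i b]
  · rw [map_zero, LinearMap.zero_apply]

theorem gAct_YG_wL (q : Quadrant) (i j a b : Fin 2) (z : MV) : gAct q (YG i j) (wL a b z) =
    wL a b (gAct q (YG i j) z) + if j = b then wL a i z else 0 := by
  rw [gAct_wL, parG_YG, lieBr_YG_wG]
  split_ifs
  · rw [gAct_wG, wL_apply a i]
  · rw [map_zero, LinearMap.zero_apply]

theorem gAct_PX_wL (q : Quadrant) (i j a b : Fin 2) (z : MV) : gAct q (PX i j) (wL a b z) =
    -wL a b (gAct q (PX i j) z) + (-4 * eps j b) •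
      (eps a 0 • gAct q (XG i 0) z + eps a 1 • gAct q (XG i 1) z) := by
  rw [gAct_wL, parG_PX, lieBr_PX_wG]
  simp only [map_neg, LinearMap.neg_apply, map_smul, map_add, LinearMap.smul_apply,
    LinearMap.add_apply]

theorem gAct_PY_wL (q : Quadrant) (i j a b : Fin 2) (z : MV) : gAct q (PY i j) (wL a b z) =
    -wL a b (gAct q (PY i j) z) + (-4 * eps i a) •
      (eps b 0 • gAct q (YG j 0) z + eps b 1 • gAct q (YG j 1) z) := by
  rw [gAct_wL, parG_PY, lieBr_PY_wG]
  simp only [map_neg, LinearMap.neg_apply, map_smul, map_add, LinearMap.smul_apply,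
    LinearMap.add_apply]

theorem gAct_XG_oneT (q : Quadrant) (i j : Fin 2) (f : V) :
    gAct q (XG i j) (oneT f) = oneT (mx q i (dx q j f)) := by
  rw [oneT_apply, gAct_one_tmul q (XG_mem_gGe i j), act_XG, oneT_apply]

theorem gAct_YG_oneT (q : Quadrant) (i j : Fin 2) (f : V) :
    gAct q (YG i j) (oneT f) = oneT (my q i (dy q j f)) := by
  rw [oneT_apply, gAct_one_tmul q (YG_mem_gGe i j), act_YG, oneT_apply]

theorem gAct_gPos_oneT (q : Quadrant) {x : G} (hx : x ∈ gPos) (f : V) :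
    gAct q x (oneT f) = 0 := by
  rw [oneT_apply, gAct_one_tmul q (gPos_le_gGe hx), act_gPos q hx, LinearMap.zero_apply,
    TensorProduct.tmul_zero]

theorem gAct_PX_oneT (q : Quadrant) (i j : Fin 2) (f : V) : gAct q (PX i j) (oneT f) = 0 :=
  gAct_gPos_oneT q (PX_mem_gPos i j) f

theorem gAct_PY_oneT (q : Quadrant) (i j : Fin 2) (f : V) : gAct q (PY i j) (oneT f) = 0 :=
  gAct_gPos_oneT q (PY_mem_gPos i j) f

/-! # Generalities on the maps `u ⊗ φ` -/

theorem tm_tmul (u u' : UNeg) (φ : V →ₗ[ℂ] V) (f : V) : tm u φ (u' ⊗ₜ f) = (u' * u) ⊗ₜ φ f := rfl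

theorem tm_smul (u u' : UNeg) (φ : V →ₗ[ℂ] V) (z : MV) : tm u φ (u' • z) = u' • tm u φ z := by
  induction z using TensorProduct.induction_on with
  | zero => simp
  | add a b ha hb => simp only [smul_add, map_add, ha, hb]
  | tmul w v =>
    rw [TensorProduct.smul_tmul', tm_tmul, tm_tmul, TensorProduct.smul_tmul', smul_eq_mul,
      smul_eq_mul, mul_assoc]

theorem tm_uL (u u' : UNeg) (φ : V →ₗ[ℂ] V) (z : MV) : tm u φ (uL u' z) = uL u' (tm u φ z) :=
  tm_smul u u' φ z

theorem tm_oneT (u : UNeg) (φ : V →ₗ[ℂ] V) (f : V) : tm u φ (oneT f) = uL u (oneT (φ f)) := by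
  rw [oneT_apply, tm_tmul, one_mul, uL_oneT]

theorem tm_comp (u u' : UNeg) (φ φ' : V →ₗ[ℂ] V) :
    tm u φ ∘ₗ tm u' φ' = tm (u' * u) (φ ∘ₗ φ') :=
  TensorProduct.ext' fun w v => by
    rw [LinearMap.comp_apply, tm_tmul, tm_tmul, tm_tmul, mul_assoc, LinearMap.comp_apply]

theorem tau_comp (φ : V →ₗ[ℂ] V) : φ ∘ₗ tau = φ := rfl

theorem uL_oneT_mem {q : Quadrant} (T : SubRep q) (u : UNeg) {f : V} (hf : f ∈ T.carrier) :
    uL u (oneT f) ∈ LinearMap.range T.incl := ⟨u ⊗ₜ ⟨f, hf⟩, by rw [uL_oneT, T.incl_tmul]⟩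

/-- A left linear map is determined by its values on the vectors `1 ⊗ f`. -/
theorem ext_of_smul {Φ Ψ : MV →ₗ[ℂ] MV} (hΦ : ∀ (u : UNeg) z, Φ (u • z) = u • Φ z)
    (hΨ : ∀ (u : UNeg) z, Ψ (u • z) = u • Ψ z) (h : ∀ f, Φ (oneT f) = Ψ (oneT f)) : Φ = Ψ :=
  TensorProduct.ext' fun u f => by
    rw [← uL_oneT, uL_apply, hΦ, hΨ, h]

/-! # Degree 1 -/

theorem nabla_eq (q : Quadrant) :
    nabla q = tm w11 (dx q 0 ∘ₗ dy q 0) + tm w21 (dx q 1 ∘ₗ dy q 0)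
      + tm w12 (dx q 0 ∘ₗ dy q 1) + tm w22 (dx q 1 ∘ₗ dy q 1) := by
  simp only [nabla, deltaP, deltaM, LinearMap.add_comp, tm_comp, one_mul]
  abel

theorem nabla_smul (q : Quadrant) (u : UNeg) (z : MV) : nabla q (u • z) = u • nabla q z := by
  simp only [nabla_eq, LinearMap.add_apply, tm_smul, smul_add]

theorem nabla_uL (q : Quadrant) (u : UNeg) (z : MV) : nabla q (uL u z) = uL u (nabla q z) :=
  nabla_smul q u z

theorem nabla_oneT (q : Quadrant) (f : V) : nabla q (oneT f) =
    wL 0 0 (oneT (dx q 0 (dy q 0 f))) + wL 1 0 (oneT (dx q 1 (dy q 0 f)))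
      + wL 0 1 (oneT (dx q 0 (dy q 1 f))) + wL 1 1 (oneT (dx q 1 (dy q 1 f))) := by
  simp only [nabla_eq, LinearMap.add_apply, tm_oneT, LinearMap.comp_apply]
  rfl

/-- In `∇ = ∑ w_{ab} ⊗ ∂_{x_a} ∂_{y_b}` the index `a` of `w` is contracted with a derivative: the
change of `w_{ab}` under `𝔤𝔩₂` cancels the commutator of `x_i` with `∂_{x_a}`. -/
theorem gAct_XG_nabla (q : Quadrant) (f : V) : ∀ i j,
    gAct q (XG i j) (nabla q (oneT f)) = nabla q (oneT (act q (XG i j) f)) := by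
  simp only [Fin.forall_fin_two, nabla_oneT, map_add, gAct_XG_wL, gAct_XG_oneT, act_XG, dy_mx, dx_mx,
    dy_dx, dx_dx q 1 0, if_true, zero_ne_one, one_ne_zero, if_false, map_zero, add_zero]
  refine ⟨⟨?_, ?_⟩, ⟨?_, ?_⟩⟩ <;> first | trivial | abel

theorem gAct_YG_nabla (q : Quadrant) (f : V) : ∀ i j,
    gAct q (YG i j) (nabla q (oneT f)) = nabla q (oneT (act q (YG i j) f)) := by
  simp only [Fin.forall_fin_two, nabla_oneT, map_add, gAct_YG_wL, gAct_YG_oneT, act_YG, dy_my, dx_my,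
    dy_dx, dy_dy q 1 0, if_true, zero_ne_one, one_ne_zero, if_false, map_zero, add_zero]
  refine ⟨⟨?_, ?_⟩, ⟨?_, ?_⟩⟩ <;> first | trivial | abel

/-- Up to a scalar the result is `∑ ε_{jb} ε_{ak} x_i ∂_{x_k} ∂_{x_a} ∂_{y_b} f`, zero because
`ε_{ak}` is antisymmetric and the derivatives commute. -/
theorem gAct_PX_nabla (q : Quadrant) (f : V) : ∀ i j, gAct q (PX i j) (nabla q (oneT f)) = 0 := by
  simp only [Fin.forall_fin_two, nabla_oneT, map_add, gAct_PX_wL, gAct_PX_oneT, gAct_XG_oneT,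
    dx_dx q 1 0, eps_eq, map_zero]
  refine ⟨⟨?_, ?_⟩, ⟨?_, ?_⟩⟩ <;> module

theorem gAct_PY_nabla (q : Quadrant) (f : V) : ∀ i j, gAct q (PY i j) (nabla q (oneT f)) = 0 := by
  simp only [Fin.forall_fin_two, nabla_oneT, map_add, gAct_PY_wL, gAct_PY_oneT, gAct_YG_oneT,
    dy_dx, dy_dy q 1 0, eps_eq, map_zero]
  refine ⟨⟨?_, ?_⟩, ⟨?_, ?_⟩⟩ <;> module

theorem nabla_isMorphism {q : Quadrant} (S T : SubRep q)
    (h : ∀ f ∈ S.carrier, ∀ i j, dx q i (dy q j f) ∈ T.carrier) : IsMorphism S T (nabla q) := by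
  refine isMorphism_of_generators S T _ (nabla_smul q) (fun v hv => ?_)
    (fun i j v _ => gAct_XG_nabla q v i j) (fun i j v _ => gAct_YG_nabla q v i j)
    (fun i j v _ => gAct_PX_nabla q v i j) (fun i j v _ => gAct_PY_nabla q v i j)
  rw [← oneT_apply, nabla_oneT]
  exact Submodule.add_mem _ (Submodule.add_mem _ (Submodule.add_mem _
    (uL_oneT_mem T _ (h v hv _ _)) (uL_oneT_mem T _ (h v hv _ _)))
    (uL_oneT_mem T _ (h v hv _ _))) (uL_oneT_mem T _ (h v hv _ _))

theorem nabla_wL (q : Quadrant) (a b : Fin 2) (z : MV) : nabla q (wL a b z) = wL a b (nabla q z) :=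
  nabla_smul q _ z

/-- The operators `∂_{x_a} ∂_{y_b}` commute, so only anticommutators of the `w`'s survive. These
carry `ε_{ac}`, antisymmetric against `∂_{x_a} ∂_{x_c}`. -/
theorem nabla_nabla (q : Quadrant) : nabla q ∘ₗ nabla q = 0 := by
  refine ext_of_smul (fun u z => by simp only [LinearMap.comp_apply, nabla_smul])
    (fun u z => by simp) fun f => ?_
  simp only [LinearMap.comp_apply, nabla_oneT, map_add, nabla_wL, wL_wL_self, wL_order, dy_dx,
    dx_dx q 1 0, dy_dy q 1 0, LinearMap.zero_apply]
  abel

/-! # Bidegrees -/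

theorem dx_congr {p q : Quadrant} (h : p.xDual = q.xDual) : dx p = dx q := by
  funext i; rw [dx, dx, h]

theorem dy_congr {p q : Quadrant} (h : p.yDual = q.yDual) : dy p = dy q := by
  funext i; rw [dy, dy, h]

theorem mx_congr {p q : Quadrant} (h : p.xDual = q.xDual) : mx p = mx q := by
  funext i; rw [mx, mx, h]

theorem my_congr {p q : Quadrant} (h : p.yDual = q.yDual) : my p = my q := by
  funext i; rw [my, my, h]

/-- The `2` undoes the normal ordering constant of each of the two dual letters. In this form the
degree of `∂_{x_a}` follows from the Weyl relations in all quadrants at once. -/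
theorem eulX_eq (q : Quadrant) (f : V) : eulX q f =
    mx q 0 (dx q 0 f) + mx q 1 (dx q 1 f) + if q.xDual then (2 : ℂ) • f else 0 := by
  rw [mx_dx, mx_dx, eulX, Derivation.add_apply]
  cases q.xDual <;> simp
  module

theorem eulY_eq (q : Quadrant) (f : V) : eulY q f =
    my q 0 (dy q 0 f) + my q 1 (dy q 1 f) + if q.yDual then (2 : ℂ) • f else 0 := by
  rw [my_dy, my_dy, eulY, Derivation.add_apply]
  cases q.yDual <;> simp
  module

theorem eulX_dx (q : Quadrant) (a : Fin 2) (f : V) :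
    eulX q (dx q a f) = dx q a (eulX q f) - dx q a f := by
  simp only [eulX_eq, map_add, dx_mx, apply_ite (dx q a), map_smul, map_zero]
  rw [dx_dx q 0 a, dx_dx q 1 a]
  fin_cases a <;> simp <;> abel

theorem eulY_dy (q : Quadrant) (a : Fin 2) (f : V) :
    eulY q (dy q a f) = dy q a (eulY q f) - dy q a f := by
  simp only [eulY_eq, map_add, dy_my, apply_ite (dy q a), map_smul, map_zero]
  rw [dy_dy q 0 a, dy_dy q 1 a]
  fin_cases a <;> simp <;> abel

theorem eulX_dy (p q : Quadrant) (a : Fin 2) (f : V) :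
    eulX p (dy q a f) = dy q a (eulX p f) := by
  simp only [eulX_eq, map_add, dy_mx, dy_dx, apply_ite (dy q a), map_smul, map_zero]

theorem eulY_dx (p q : Quadrant) (a : Fin 2) (f : V) :
    eulY p (dx q a f) = dx q a (eulY p f) := by
  simp only [eulY_eq, map_add, dx_my, dy_dx, apply_ite (dx q a), map_smul, map_zero]

theorem dx_mem {q : Quadrant} {m n : ℤ} {f : V} (hf : f ∈ bidegSpace q m n) (a : Fin 2) :
    dx q a f ∈ bidegSpace q (m - 1) n := by
  obtain ⟨h1, h2⟩ := hf
  constructor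
  · rw [eulX_dx, h1, map_smul]; push_cast; module
  · rw [eulY_dx, h2, map_smul]

theorem dy_mem {q : Quadrant} {m n : ℤ} {f : V} (hf : f ∈ bidegSpace q m n) (a : Fin 2) :
    dy q a f ∈ bidegSpace q m (n - 1) := by
  obtain ⟨h1, h2⟩ := hf
  constructor
  · rw [eulX_dy, h1, map_smul]
  · rw [eulY_dy, h2, map_smul]; push_cast; module

theorem coeff_X_mul_pderiv (i : Fin 2 ⊕ Fin 2) (f : V) (d : Fin 2 ⊕ Fin 2 →₀ ℕ) :
    (MvPolynomial.X i * MvPolynomial.pderiv i f).coeff d = d i * f.coeff d := by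
  induction f using MvPolynomial.induction_on' with
  | monomial u a =>
    rw [MvPolynomial.X_mul_pderiv_monomial, MvPolynomial.coeff_smul, MvPolynomial.coeff_monomial]
    split_ifs with h
    · rw [h, nsmul_eq_mul]
    · simp
  | add p q hp hq => rw [map_add, mul_add, MvPolynomial.coeff_add, hp, hq, MvPolynomial.coeff_add,
      mul_add]

theorem coeff_eulX (q : Quadrant) (f : V) (d : Fin 2 ⊕ Fin 2 →₀ ℕ) : (eulX q f).coeff d =
    (if q.xDual then -1 else 1) * ((d (Sum.inl 0) : ℂ) + d (Sum.inl 1)) * f.coeff d := by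
  have h0 := coeff_X_mul_pderiv (Sum.inl 0) f d
  have h1 := coeff_X_mul_pderiv (Sum.inl 1) f d
  rw [← lx] at h0 h1
  rw [eulX, Derivation.add_apply, glX_apply, glX_apply]
  cases q.xDual <;> simp [h0, h1] <;> ring

theorem coeff_eulY (q : Quadrant) (f : V) (d : Fin 2 ⊕ Fin 2 →₀ ℕ) : (eulY q f).coeff d =
    (if q.yDual then -1 else 1) * ((d (Sum.inr 0) : ℂ) + d (Sum.inr 1)) * f.coeff d := by
  have h0 := coeff_X_mul_pderiv (Sum.inr 0) f d
  have h1 := coeff_X_mul_pderiv (Sum.inr 1) f d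
  rw [← ly] at h0 h1
  rw [eulY, Derivation.add_apply, glY_apply, glY_apply]
  cases q.yDual <;> simp [h0, h1] <;> ring

theorem natCast_add_eq_zero {a b : ℕ} (h : (a : ℂ) + b = 0) : a = 0 ∧ b = 0 := by
  have : a + b = 0 := by exact_mod_cast h
  omega

/-- On a monomial the Euler operator has eigenvalue plus or minus the total degree in the first
pair, a sum of naturals that vanishes only if both exponents do. -/
theorem support_eulX {q : Quadrant} {f : V} (h : eulX q f = 0) {d : Fin 2 ⊕ Fin 2 →₀ ℕ}
    (hd : d ∈ f.support) (j : Fin 2) : d (Sum.inl j) = 0 := by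
  have h1 := coeff_eulX q f d
  rw [h, MvPolynomial.coeff_zero, eq_comm, mul_eq_zero,
    or_iff_left (MvPolynomial.mem_support_iff.1 hd), mul_eq_zero, or_iff_right (by split_ifs <;> simp)] at h1
  obtain ⟨h2, h3⟩ := natCast_add_eq_zero h1
  fin_cases j <;> assumption

theorem support_eulY {q : Quadrant} {f : V} (h : eulY q f = 0) {d : Fin 2 ⊕ Fin 2 →₀ ℕ}
    (hd : d ∈ f.support) (j : Fin 2) : d (Sum.inr j) = 0 := by
  have h1 := coeff_eulY q f d
  rw [h, MvPolynomial.coeff_zero, eq_comm, mul_eq_zero,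
    or_iff_left (MvPolynomial.mem_support_iff.1 hd), mul_eq_zero, or_iff_right (by split_ifs <;> simp)] at h1
  obtain ⟨h2, h3⟩ := natCast_add_eq_zero h1
  fin_cases j <;> assumption

theorem pderiv_inl_eq_zero {q : Quadrant} {f : V} (h : eulX q f = 0) (j : Fin 2) :
    MvPolynomial.pderiv (Sum.inl j) f = 0 := by
  refine MvPolynomial.pderiv_eq_zero_of_notMem_vars fun hj => ?_
  obtain ⟨d, hd, hj⟩ := (MvPolynomial.mem_vars_iff_mem_support _).1 hj
  exact Finsupp.mem_support_iff.1 hj (support_eulX h hd j)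

theorem pderiv_inr_eq_zero {q : Quadrant} {f : V} (h : eulY q f = 0) (j : Fin 2) :
    MvPolynomial.pderiv (Sum.inr j) f = 0 := by
  refine MvPolynomial.pderiv_eq_zero_of_notMem_vars fun hj => ?_
  obtain ⟨d, hd, hj⟩ := (MvPolynomial.mem_vars_iff_mem_support _).1 hj
  exact Finsupp.mem_support_iff.1 hj (support_eulY h hd j)

theorem eulX_congr {p q : Quadrant} (h : p.xDual = q.xDual) : eulX p = eulX q := by
  have : ∀ i j, glX p i j = glX q i j := fun i j => by rw [glX, glX, h]
  rw [eulX, eulX, this, this]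

theorem eulY_congr {p q : Quadrant} (h : p.yDual = q.yDual) : eulY p = eulY q := by
  have : ∀ i j, glY p i j = glY q i j := fun i j => by rw [glY, glY, h]
  rw [eulY, eulY, this, this]

/-- Either side says that the first pair of letters is absent, which is independent of their type.
This is what allows `τ` to pass between quadrants. -/
theorem eulX_eq_zero_iff (p q : Quadrant) (f : V) : eulX p f = 0 ↔ eulX q f = 0 := by
  have h : ∀ p q : Quadrant, eulX p f = 0 → eulX q f = 0 := fun p q h => by
    rw [eulX, Derivation.add_apply, glX_apply, glX_apply]
    simp [pderiv_inl_eq_zero h]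
  exact ⟨h p q, h q p⟩

theorem eulY_eq_zero_iff (p q : Quadrant) (f : V) : eulY p f = 0 ↔ eulY q f = 0 := by
  have h : ∀ p q : Quadrant, eulY p f = 0 → eulY q f = 0 := fun p q h => by
    rw [eulY, Derivation.add_apply, glY_apply, glY_apply]
    simp [pderiv_inr_eq_zero h]
  exact ⟨h p q, h q p⟩

/-- The normally ordered action on polynomials without `x`. -/
theorem mx_dx_of_eulX {p q : Quadrant} {f : V} (h : eulX p f = 0) (i j : Fin 2) :
    mx q i (dx q j f) = if q.xDual ∧ i = j then -f else 0 := by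
  rw [mx_dx, glX_apply]
  simp only [pderiv_inl_eq_zero h, mul_zero, neg_zero, ite_self, zero_sub]
  split_ifs <;> simp

/-- The normally ordered action on polynomials without `y`. -/
theorem my_dy_of_eulY {p q : Quadrant} {f : V} (h : eulY p f = 0) (i j : Fin 2) :
    my q i (dy q j f) = if q.yDual ∧ i = j then -f else 0 := by
  rw [my_dy, glY_apply]
  simp only [pderiv_inr_eq_zero h, mul_zero, neg_zero, ite_self, zero_sub]
  split_ifs <;> simp

theorem mem_bideg_congr_x {p q : Quadrant} (h : p.xDual = q.xDual) {m : ℤ} {f : V} :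
    f ∈ bidegSpace p m 0 ↔ f ∈ bidegSpace q m 0 := by
  refine and_congr (by rw [eulX_congr h]) ?_
  rw [Int.cast_zero, zero_smul, eulY_eq_zero_iff]

theorem mem_bideg_congr_y {p q : Quadrant} (h : p.yDual = q.yDual) {n : ℤ} {f : V} :
    f ∈ bidegSpace p 0 n ↔ f ∈ bidegSpace q 0 n := by
  refine and_congr ?_ (by rw [eulY_congr h])
  rw [Int.cast_zero, zero_smul, eulX_eq_zero_iff]

theorem eulY_of_mem {q : Quadrant} {m : ℤ} {f : V} (h : f ∈ bidegSpace q m 0) : eulY q f = 0 := by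
  rw [h.2, Int.cast_zero, zero_smul]

theorem eulX_of_mem {q : Quadrant} {n : ℤ} {f : V} (h : f ∈ bidegSpace q 0 n) : eulX q f = 0 := by
  rw [h.1, Int.cast_zero, zero_smul]

theorem eulY_of_mem_axisX {q : Quadrant} {f : V} (h : f ∈ (axisX q).carrier) : eulY q f = 0 := by
  have : (axisX q).carrier ≤ LinearMap.ker (eulY q).toLinearMap :=
    iSup_le fun m g hg => eulY_of_mem hg
  exact this h

theorem eulX_of_mem_axisY {q : Quadrant} {f : V} (h : f ∈ (axisY q).carrier) : eulX q f = 0 := by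
  have : (axisY q).carrier ≤ LinearMap.ker (eulX q).toLinearMap :=
    iSup_le fun m g hg => eulX_of_mem hg
  exact this h

theorem dx_dx_mem_bideg {p q : Quadrant} (h : p.xDual = q.xDual) {m : ℤ} {f : V}
    (hf : f ∈ bidegSpace p m 0) (a b : Fin 2) : dx q a (dx q b f) ∈ bidegSpace q (m - 2) 0 := by
  have := dx_mem (dx_mem ((mem_bideg_congr_x h).1 hf) b) a
  rwa [sub_sub] at this

theorem dy_dy_mem_bideg {p q : Quadrant} (h : p.yDual = q.yDual) {n : ℤ} {f : V}
    (hf : f ∈ bidegSpace p 0 n) (a b : Fin 2) : dy q a (dy q b f) ∈ bidegSpace q 0 (n - 2) := by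
  have := dy_mem (dy_mem ((mem_bideg_congr_y h).1 hf) b) a
  rwa [sub_sub] at this

theorem dx_dx_mem_axisX {p q : Quadrant} (h : p.xDual = q.xDual) {f : V}
    (hf : f ∈ (axisX p).carrier) (a b : Fin 2) : dx q a (dx q b f) ∈ (axisX q).carrier := by
  have : (axisX p).carrier ≤ (axisX q).carrier.comap (dx q a ∘ₗ dx q b) :=
    iSup_le fun m g hg => Submodule.mem_comap.2
      (Submodule.mem_iSup_of_mem (m - 2) (dx_dx_mem_bideg h hg a b))
  exact this hf

theorem dy_dy_mem_axisY {p q : Quadrant} (h : p.yDual = q.yDual) {f : V}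
    (hf : f ∈ (axisY p).carrier) (a b : Fin 2) : dy q a (dy q b f) ∈ (axisY q).carrier := by
  have : (axisY p).carrier ≤ (axisY q).carrier.comap (dy q a ∘ₗ dy q b) :=
    iSup_le fun m g hg => Submodule.mem_comap.2
      (Submodule.mem_iSup_of_mem (m - 2) (dy_dy_mem_bideg h hg a b))
  exact this hf

/-! # Degree 2 -/

theorem nabla2_eq (q : Quadrant) :
    nabla2 q = tm (w11 * w12) (dx q 0 ∘ₗ dx q 0) + tm (w11 * w22) (dx q 0 ∘ₗ dx q 1)
      + tm (w21 * w12) (dx q 0 ∘ₗ dx q 1) + tm (w21 * w22) (dx q 1 ∘ₗ dx q 1) := by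
  have h : dx q 1 ∘ₗ dx q 0 = dx q 0 ∘ₗ dx q 1 := LinearMap.ext fun f => dx_dx q 1 0 f
  simp only [nabla2, deltaP, deltaM, LinearMap.add_comp, LinearMap.comp_add, tm_comp, one_mul,
    tau_comp, h]
  abel

theorem nabla2_smul (q : Quadrant) (u : UNeg) (z : MV) : nabla2 q (u • z) = u • nabla2 q z := by
  simp only [nabla2_eq, LinearMap.add_apply, tm_smul, smul_add]

theorem nabla2_wL (q : Quadrant) (a b : Fin 2) (z : MV) :
    nabla2 q (wL a b z) = wL a b (nabla2 q z) := nabla2_smul q _ z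

theorem nabla2_oneT (q : Quadrant) (f : V) : nabla2 q (oneT f) =
    wL 0 0 (wL 0 1 (oneT (dx q 0 (dx q 0 f)))) + wL 0 0 (wL 1 1 (oneT (dx q 0 (dx q 1 f))))
      + wL 1 0 (wL 0 1 (oneT (dx q 0 (dx q 1 f)))) + wL 1 0 (wL 1 1 (oneT (dx q 1 (dx q 1 f)))) := by
  simp only [nabla2_eq, LinearMap.add_apply, tm_oneT, LinearMap.comp_apply, uL_mul, wL, wU_eq]

theorem gAct_XG_nabla2 (q : Quadrant) (f : V) : ∀ i j,
    gAct q (XG i j) (nabla2 q (oneT f)) = nabla2 q (oneT (mx q i (dx q j f))) := by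
  simp only [Fin.forall_fin_two, nabla2_oneT, map_add, gAct_XG_wL, gAct_XG_oneT, dx_mx,
    dx_dx q 1 0, if_true, zero_ne_one, one_ne_zero, if_false, map_zero, add_zero]
  simp only [wL_order]
  refine ⟨⟨?_, ?_⟩, ⟨?_, ?_⟩⟩ <;> first | trivial | module

/-- The quadratic expressions in `w` transform by the determinant of the second `𝔤𝔩₂`, contributing
`δ_{ij}`; on a polynomial free of `y` the normally ordered action with dual letters is `-δ_{ij}`.
The two cancel, as they must, since the source has degree 0 in non-dual `y`. -/
theorem gAct_YG_nabla2 {p q : Quadrant} (hq : q.yDual = true) {f : V} (hf : eulY p f = 0) :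
    ∀ i j, gAct q (YG i j) (nabla2 q (oneT f)) = 0 := by
  simp only [Fin.forall_fin_two, nabla2_oneT, map_add, gAct_YG_wL, gAct_YG_oneT, dy_dx, ← dx_my,
    my_dy_of_eulY hf, hq, if_true, zero_ne_one, one_ne_zero, if_false, map_zero, add_zero, map_neg,
    and_true, and_false]
  simp only [wL_wL_self, wL_order]
  refine ⟨⟨?_, ?_⟩, ⟨?_, ?_⟩⟩ <;> first | trivial | module

/-- Every term, including those where the element of `𝔤𝔩₂` meets the other factor `w`, pairs an `ε`
in the `x`-indices with commuting `∂_{x_a} ∂_{x_b}`. Nothing is required of `f`. -/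
theorem gAct_PX_nabla2 (q : Quadrant) (f : V) : ∀ i j, gAct q (PX i j) (nabla2 q (oneT f)) = 0 := by
  simp only [Fin.forall_fin_two, nabla2_oneT, map_add, gAct_PX_wL, gAct_PX_oneT, gAct_XG_wL,
    gAct_XG_oneT, dx_dx q 1 0, eps_eq, map_zero, map_neg, map_smul, if_true, zero_ne_one,
    one_ne_zero, if_false]
  refine ⟨⟨?_, ?_⟩, ⟨?_, ?_⟩⟩ <;> module

/-- The bracket with one factor `w` leaves an element of the second `𝔤𝔩₂`. Its action on the
remaining `w` and the normal ordering constant `-1` cancel, up to exchanging the two symmetric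
`x`-indices. -/
theorem gAct_PY_nabla2 {p q : Quadrant} (hq : q.yDual = true) {f : V} (hf : eulY p f = 0) :
    ∀ i j, gAct q (PY i j) (nabla2 q (oneT f)) = 0 := by
  simp only [Fin.forall_fin_two, nabla2_oneT, map_add, gAct_PY_wL, gAct_PY_oneT, gAct_YG_wL,
    gAct_YG_oneT, dy_dx, ← dx_my, my_dy_of_eulY hf, hq, eps_eq, map_zero, map_neg, map_smul,
    if_true, zero_ne_one, one_ne_zero, if_false, and_true, and_false]
  refine ⟨⟨?_, ?_⟩, ⟨?_, ?_⟩⟩ <;> module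

theorem nabla2_isMorphism {p q : Quadrant} (hxy : p.xDual = q.xDual) (hp : p.yDual = false)
    (hq : q.yDual = true) (S : SubRep p) (T : SubRep q) (hS : ∀ f ∈ S.carrier, eulY p f = 0)
    (h : ∀ f ∈ S.carrier, ∀ i j, dx q i (dx q j f) ∈ T.carrier) :
    IsMorphism S T (nabla2 q) := by
  refine isMorphism_of_generators S T _ (nabla2_smul q) (fun v hv => ?_)
    (fun i j v _ => ?_) (fun i j v hv => ?_)
    (fun i j v _ => gAct_PX_nabla2 q v i j) (fun i j v hv => gAct_PY_nabla2 hq (hS v hv) i j)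
  · rw [← oneT_apply, nabla2_oneT]
    simp only [wL, ← uL_mul]
    exact Submodule.add_mem _ (Submodule.add_mem _ (Submodule.add_mem _
      (uL_oneT_mem T _ (h v hv _ _)) (uL_oneT_mem T _ (h v hv _ _)))
      (uL_oneT_mem T _ (h v hv _ _))) (uL_oneT_mem T _ (h v hv _ _))
  · rw [← oneT_apply, gAct_XG_nabla2, act_XG, mx_congr hxy, dx_congr hxy, oneT_apply]
  · rw [← oneT_apply, gAct_YG_nabla2 hq (hS v hv), act_YG, my_dy_of_eulY (hS v hv), hp]
    simp

/-- `Δ⁺` and `Δ⁻` square to zero and anticommute, because the `∂_{x_a}` commute while the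
anticommutators of the `w`'s carry `ε` in the first index. So either summand of `∇` kills `Δ⁻Δ⁺`, on
all polynomials; the axis matters only for `∇₂` to be a morphism. -/
theorem nabla_nabla2 (q : Quadrant) : nabla q ∘ₗ nabla2 q = 0 := by
  refine ext_of_smul (fun u z => by simp only [LinearMap.comp_apply, nabla_smul, nabla2_smul])
    (fun u z => by simp) fun f => ?_
  simp only [LinearMap.comp_apply, nabla_oneT, nabla2_oneT, map_add, nabla_wL, nabla_uL, wL_wL_self, wL_order,
    dy_dx, dx_dx q 1 0, LinearMap.zero_apply, map_neg, map_sub, wL_kappa, map_zero]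
  module

theorem nabla2_nabla {p q : Quadrant} (h : p.xDual = q.xDual) : nabla2 q ∘ₗ nabla p = 0 := by
  refine ext_of_smul (fun u z => by simp only [LinearMap.comp_apply, nabla_smul, nabla2_smul])
    (fun u z => by simp) fun f => ?_
  simp only [LinearMap.comp_apply, nabla_oneT, nabla2_oneT, map_add, nabla2_wL, wL_wL_self, wL_order,
    dx_congr h, dx_dx q 1 0, LinearMap.zero_apply, map_neg, map_sub, wL_kappa, map_zero]
  module

/-! ### Degree 2 for the second pair of letters -/

theorem nablaT2_eq (q : Quadrant) :
    nablaT2 q = tm (w11 * w21) (dy q 0 ∘ₗ dy q 0) + tm (w12 * w21) (dy q 0 ∘ₗ dy q 1)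
      + tm (w11 * w22) (dy q 0 ∘ₗ dy q 1) + tm (w12 * w22) (dy q 1 ∘ₗ dy q 1) := by
  have h : dy q 1 ∘ₗ dy q 0 = dy q 0 ∘ₗ dy q 1 := LinearMap.ext fun f => dy_dy q 1 0 f
  simp only [nablaT2, deltaTP, deltaTM, LinearMap.add_comp, LinearMap.comp_add, tm_comp, one_mul,
    tau_comp, h]
  abel

theorem nablaT2_smul (q : Quadrant) (u : UNeg) (z : MV) : nablaT2 q (u • z) = u • nablaT2 q z := by
  simp only [nablaT2_eq, LinearMap.add_apply, tm_smul, smul_add]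

theorem nablaT2_wL (q : Quadrant) (a b : Fin 2) (z : MV) :
    nablaT2 q (wL a b z) = wL a b (nablaT2 q z) := nablaT2_smul q _ z

theorem nablaT2_oneT (q : Quadrant) (f : V) : nablaT2 q (oneT f) =
    wL 0 0 (wL 1 0 (oneT (dy q 0 (dy q 0 f)))) + wL 0 0 (wL 1 1 (oneT (dy q 0 (dy q 1 f))))
      + wL 0 1 (wL 1 0 (oneT (dy q 0 (dy q 1 f)))) + wL 0 1 (wL 1 1 (oneT (dy q 1 (dy q 1 f)))) := by
  simp only [nablaT2_eq, LinearMap.add_apply, tm_oneT, LinearMap.comp_apply, uL_mul, wL, wU_eq]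
  abel

theorem gAct_YG_nablaT2 (q : Quadrant) (f : V) : ∀ i j,
    gAct q (YG i j) (nablaT2 q (oneT f)) = nablaT2 q (oneT (my q i (dy q j f))) := by
  simp only [Fin.forall_fin_two, nablaT2_oneT, map_add, gAct_YG_wL, gAct_YG_oneT, dy_my,
    dy_dy q 1 0, if_true, zero_ne_one, one_ne_zero, if_false, map_zero, add_zero]
  refine ⟨⟨?_, ?_⟩, ⟨?_, ?_⟩⟩ <;> first | trivial | module

/-- The same cancellation as for `∇₂` with the roles of `x` and `y` exchanged: determinant of the
first `𝔤𝔩₂` against the constant of the dual `x`-letters. -/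
theorem gAct_XG_nablaT2 {p q : Quadrant} (hq : q.xDual = true) {f : V} (hf : eulX p f = 0) :
    ∀ i j, gAct q (XG i j) (nablaT2 q (oneT f)) = 0 := by
  simp only [Fin.forall_fin_two, nablaT2_oneT, map_add, gAct_XG_wL, gAct_XG_oneT, ← dy_dx, ← dy_mx,
    mx_dx_of_eulX hf, hq, if_true, zero_ne_one, one_ne_zero, if_false, map_zero, add_zero, map_neg,
    and_true, and_false]
  simp only [wL_wL_self, wL_order]
  refine ⟨⟨?_, ?_⟩, ⟨?_, ?_⟩⟩ <;> first | trivial | module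

theorem gAct_PY_nablaT2 (q : Quadrant) (f : V) : ∀ i j, gAct q (PY i j) (nablaT2 q (oneT f)) = 0 := by
  simp only [Fin.forall_fin_two, nablaT2_oneT, map_add, gAct_PY_wL, gAct_PY_oneT, gAct_YG_wL,
    gAct_YG_oneT, dy_dy q 1 0, eps_eq, map_zero, map_neg, map_smul, if_true, zero_ne_one,
    one_ne_zero, if_false]
  refine ⟨⟨?_, ?_⟩, ⟨?_, ?_⟩⟩ <;> module

theorem gAct_PX_nablaT2 {p q : Quadrant} (hq : q.xDual = true) {f : V} (hf : eulX p f = 0) :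
    ∀ i j, gAct q (PX i j) (nablaT2 q (oneT f)) = 0 := by
  simp only [Fin.forall_fin_two, nablaT2_oneT, map_add, gAct_PX_wL, gAct_PX_oneT, gAct_XG_wL,
    gAct_XG_oneT, ← dy_dx, ← dy_mx, mx_dx_of_eulX hf, hq, eps_eq, map_zero, map_neg, map_smul,
    if_true, zero_ne_one, one_ne_zero, if_false, and_true, and_false]
  refine ⟨⟨?_, ?_⟩, ⟨?_, ?_⟩⟩ <;> module

theorem nablaT2_isMorphism {p q : Quadrant} (hxy : p.yDual = q.yDual) (hp : p.xDual = false)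
    (hq : q.xDual = true) (S : SubRep p) (T : SubRep q) (hS : ∀ f ∈ S.carrier, eulX p f = 0)
    (h : ∀ f ∈ S.carrier, ∀ i j, dy q i (dy q j f) ∈ T.carrier) :
    IsMorphism S T (nablaT2 q) := by
  refine isMorphism_of_generators S T _ (nablaT2_smul q) (fun v hv => ?_)
    (fun i j v hv => ?_) (fun i j v _ => ?_)
    (fun i j v hv => gAct_PX_nablaT2 hq (hS v hv) i j) (fun i j v _ => gAct_PY_nablaT2 q v i j)
  · rw [← oneT_apply, nablaT2_oneT]
    simp only [wL, ← uL_mul]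
    exact Submodule.add_mem _ (Submodule.add_mem _ (Submodule.add_mem _
      (uL_oneT_mem T _ (h v hv _ _)) (uL_oneT_mem T _ (h v hv _ _)))
      (uL_oneT_mem T _ (h v hv _ _))) (uL_oneT_mem T _ (h v hv _ _))
  · rw [← oneT_apply, gAct_XG_nablaT2 hq (hS v hv), act_XG, mx_dx_of_eulX (hS v hv), hp]
    simp
  · rw [← oneT_apply, gAct_YG_nablaT2, act_YG, my_congr hxy, dy_congr hxy, oneT_apply]

theorem nabla_nablaT2 (q : Quadrant) : nabla q ∘ₗ nablaT2 q = 0 := by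
  refine ext_of_smul (fun u z => by simp only [LinearMap.comp_apply, nabla_smul, nablaT2_smul])
    (fun u z => by simp) fun f => ?_
  simp only [LinearMap.comp_apply, nabla_oneT, nablaT2_oneT, map_add, nabla_wL, wL_wL_self, wL_order,
    dy_dy q 1 0, LinearMap.zero_apply, map_neg, map_sub, wL_kappa, map_zero]
  module

theorem nablaT2_nabla {p q : Quadrant} (h : p.yDual = q.yDual) : nablaT2 q ∘ₗ nabla p = 0 := by
  refine ext_of_smul (fun u z => by simp only [LinearMap.comp_apply, nabla_smul, nablaT2_smul])
    (fun u z => by simp) fun f => ?_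
  simp only [LinearMap.comp_apply, nabla_oneT, nablaT2_oneT, map_add, nablaT2_wL, wL_wL_self, wL_order,
    dy_dx, dy_congr h, dy_dy q 1 0, LinearMap.zero_apply, map_neg, map_zero]
  module

set_option linter.unusedSimpArgs false

/-! # Degree 3 -/

theorem uL_one (z : MV) : uL 1 z = z := one_smul _ z

theorem deltaM_smul (q : Quadrant) (u : UNeg) (z : MV) : deltaM q (u • z) = u • deltaM q z := by
  simp only [deltaM, LinearMap.add_apply, tm_smul, smul_add]

theorem nabla3_smul (u : UNeg) (z : MV) : nabla3 (u • z) = u • nabla3 z := by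
  simp only [nabla3, LinearMap.add_apply, LinearMap.comp_apply, tm_smul, deltaM_smul, smul_add]

theorem nabla3_wL (a b : Fin 2) (z : MV) : nabla3 (wL a b z) = wL a b (nabla3 z) :=
  nabla3_smul _ z

theorem nabla3_oneT (f : V) : nabla3 (oneT f) =
    wL 0 0 (wL 1 0 (wL 0 1 (oneT (dx .C 0 (dy .A 0 f))) + wL 1 1 (oneT (dx .C 1 (dy .A 0 f)))))
    + wL 0 1 (wL 1 0 (wL 0 1 (oneT (dx .C 0 (dy .A 1 f))) + wL 1 1 (oneT (dx .C 1 (dy .A 1 f)))))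
    + wL 0 0 (wL 1 1 (wL 0 1 (oneT (dx .C 0 (dy .A 1 f))) + wL 1 1 (oneT (dx .C 1 (dy .A 1 f))))) := by
  simp only [nabla3, deltaM, LinearMap.add_apply, LinearMap.comp_apply, tm_oneT, tm_uL, uL_mul, uL_add,
    tau, LinearMap.id_apply, wL, wU_eq, map_add, uL_one]
  abel

/-- Commute `x_i` past `∂_{x_a}`; on a polynomial free of `x` the operator `x_i ∂_{x_j}` is the
constant `-δ_{ij}`. -/
theorem mx_dx_dx_of_eulX {p : Quadrant} {g : V} (h : eulX p g = 0) (i j a : Fin 2) :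
    mx .C i (dx .C j (dx .C a g)) =
      -(if i = j then dx .C a g else 0) - if a = i then dx .C j g else 0 := by
  have h1 := dx_mx .C a i (dx .C j g)
  rw [mx_dx_of_eulX h, dx_dx .C a j] at h1
  rw [eq_sub_iff_add_eq, ← h1]
  simp only [Quadrant.xDual, true_and]
  split_ifs <;> simp

theorem my_dy_dx_of_eulY {p : Quadrant} {g : V} (h : eulY p g = 0) (i j a : Fin 2) :
    my .C i (dy .C j (dx .C a g)) = -(if i = j then dx .C a g else 0) := by
  rw [dy_dx, ← dx_my, my_dy_of_eulY h]
  simp only [Quadrant.yDual, true_and]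
  split_ifs <;> simp

theorem dy_my_dy_of_eulY {p : Quadrant} {f : V} (h : ∀ k, eulY p (dy .A k f) = 0) (i j k : Fin 2) :
    dy .A k (my .A i (dy .A j f)) = if k = i then dy .A j f else 0 := by
  rw [dy_my, dy_dy .A k j, my_dy_of_eulY (h k)]
  simp [Quadrant.yDual]

/-- The quadratic factors `w₁₁w₂₁` and `w₁₂w₂₁ + w₁₁w₂₂` transform by the determinant of the first
`𝔤𝔩₂`, giving `δ_{ij}`. The factor `Δ⁻` contributes `-δ_{ij}`, being invariant up to normal
ordering. The source has no `x`, so zero is the required value. -/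
theorem gAct_XG_nabla3 {p : Quadrant} {f : V} (hf : ∀ k, eulX p (dy .A k f) = 0) :
    ∀ i j, gAct .C (XG i j) (nabla3 (oneT f)) = 0 := by
  simp only [Fin.forall_fin_two, nabla3_oneT, map_add, gAct_XG_wL, gAct_XG_oneT,
    mx_dx_dx_of_eulX (hf _), if_true, zero_ne_one, one_ne_zero, if_false, map_zero, add_zero,
    map_neg, map_sub]
  simp only [wL_wL_self, wL_order, map_neg, map_add, map_sub, map_zero, wL_kappa]
  refine ⟨⟨?_, ?_⟩, ⟨?_, ?_⟩⟩ <;> module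

/-- The polynomials on the target side are free of `y`, so `YG` acts on them through the constant
`-δ_{ij}` only; the rest of the action comes from the `w`'s and reproduces the linear action on `f`.
-/
theorem gAct_YG_nabla3 {p : Quadrant} {f : V} (hf : ∀ k, eulY p (dy .A k f) = 0) :
    ∀ i j, gAct .C (YG i j) (nabla3 (oneT f)) = nabla3 (oneT (my .A i (dy .A j f))) := by
  simp only [Fin.forall_fin_two, nabla3_oneT, map_add, gAct_YG_wL, gAct_YG_oneT,
    my_dy_dx_of_eulY (hf _), dy_my_dy_of_eulY hf, if_true, zero_ne_one, one_ne_zero, if_false,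
    map_zero, add_zero, map_neg, map_sub]
  simp only [wL_wL_self, wL_order, map_neg, map_add, map_sub, map_zero, wL_kappa]
  refine ⟨⟨?_, ?_⟩, ⟨?_, ?_⟩⟩ <;> module

theorem gAct_PX_nabla3 {p : Quadrant} {f : V} (hf : ∀ k, eulX p (dy .A k f) = 0) :
    ∀ i j, gAct .C (PX i j) (nabla3 (oneT f)) = 0 := by
  simp only [Fin.forall_fin_two, nabla3_oneT, map_add, gAct_PX_wL, gAct_PX_oneT, gAct_XG_wL,
    gAct_XG_oneT, mx_dx_dx_of_eulX (hf _), eps_eq, map_zero, map_neg, map_smul, map_sub, if_true,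
    zero_ne_one, one_ne_zero, if_false]
  simp only [wL_wL_self, wL_order, map_neg, map_add, map_sub, map_zero, wL_kappa]
  refine ⟨⟨?_, ?_⟩, ⟨?_, ?_⟩⟩ <;> module

theorem gAct_PY_nabla3 {p : Quadrant} {f : V} (hf : ∀ k, eulY p (dy .A k f) = 0) :
    ∀ i j, gAct .C (PY i j) (nabla3 (oneT f)) = 0 := by
  simp only [Fin.forall_fin_two, nabla3_oneT, map_add, gAct_PY_wL, gAct_PY_oneT, gAct_YG_wL,
    gAct_YG_oneT, my_dy_dx_of_eulY (hf _), eps_eq, map_zero, map_neg, map_smul, map_sub, if_true,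
    zero_ne_one, one_ne_zero, if_false]
  simp only [wL_wL_self, wL_order, map_neg, map_add, map_sub, map_zero, wL_kappa]
  refine ⟨⟨?_, ?_⟩, ⟨?_, ?_⟩⟩ <;> module

/-- `∂_{y_k} f` has bidegree `(0, 0)`, hence involves no letters and has bidegree `(0, 0)` in
quadrant `C` as well; there `∂_{x_a}` is a multiplication of degree `-1`. -/
theorem dx_dy_mem_bideg {f : V} (hf : f ∈ bidegSpace .A 0 1) (a k : Fin 2) :
    dx .C a (dy .A k f) ∈ bidegSpace .C (-1) 0 := by
  have h : dy .A k f ∈ bidegSpace .A 0 0 := dy_mem hf k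
  refine dx_mem (m := 0) ⟨?_, ?_⟩ a
  · rw [(eulX_eq_zero_iff .A .C _).1 (eulX_of_mem h), Int.cast_zero, zero_smul]
  · rw [(eulY_eq_zero_iff .A .C _).1 (eulY_of_mem h), Int.cast_zero, zero_smul]

theorem nabla3_isMorphism : IsMorphism (bideg .A 0 1) (bideg .C (-1) 0) nabla3 := by
  have hg : ∀ f ∈ bidegSpace .A 0 1, ∀ k, dy .A k f ∈ bidegSpace .A 0 0 := fun f hf k => dy_mem hf k
  have hX : ∀ f ∈ bidegSpace .A 0 1, ∀ k, eulX .A (dy .A k f) = 0 := fun f hf k =>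
    eulX_of_mem (hg f hf k)
  have hY : ∀ f ∈ bidegSpace .A 0 1, ∀ k, eulY .A (dy .A k f) = 0 := fun f hf k =>
    eulY_of_mem (hg f hf k)
  refine isMorphism_of_generators _ _ _ nabla3_smul (fun v hv => ?_)
    (fun i j v hv => ?_) (fun i j v hv => ?_)
    (fun i j v hv => gAct_PX_nabla3 (hX v hv) i j) (fun i j v hv => gAct_PY_nabla3 (hY v hv) i j)
  · rw [← oneT_apply, nabla3_oneT]
    simp only [wL, map_add, ← uL_mul]
    have h := fun u k a => uL_oneT_mem (bideg .C (-1) 0) u (dx_dy_mem_bideg hv a k)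
    exact Submodule.add_mem _ (Submodule.add_mem _ (Submodule.add_mem _ (h _ _ _) (h _ _ _))
      (Submodule.add_mem _ (h _ _ _) (h _ _ _))) (Submodule.add_mem _ (h _ _ _) (h _ _ _))
  · rw [← oneT_apply, gAct_XG_nabla3 (hX v hv), act_XG, mx_dx_of_eulX (eulX_of_mem hv)]
    simp [Quadrant.xDual]
  · rw [← oneT_apply, gAct_YG_nabla3 (hY v hv), act_YG, oneT_apply]

/-- `Δ⁻` squares to zero and anticommutes with `Δ⁺`, which leaves `Δ⁻Δ⁺` after the quadratic factors
of `∇₃`; these products of four `w`'s cancel in normal order. -/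
theorem nabla_nabla3 : nabla .C ∘ₗ nabla3 = 0 := by
  refine ext_of_smul (fun u z => by simp only [LinearMap.comp_apply, nabla_smul, nabla3_smul])
    (fun u z => by simp) fun f => ?_
  simp only [LinearMap.comp_apply, nabla_oneT, nabla3_oneT, map_add, nabla_wL, dx_dx .C 1 0, dy_dx,
    LinearMap.zero_apply]
  simp only [wL_wL_self, wL_order, map_neg, map_add, map_sub, wL_kappa, map_zero]
  module

theorem nabla3_nabla : nabla3 ∘ₗ nabla .A = 0 := by
  refine ext_of_smul (fun u z => by simp only [LinearMap.comp_apply, nabla_smul, nabla3_smul])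
    (fun u z => by simp) fun f => ?_
  simp only [LinearMap.comp_apply, nabla_oneT, nabla3_oneT, map_add, nabla3_wL, dy_dx, dy_dy .A 1 0,
    LinearMap.zero_apply]
  simp only [wL_wL_self, wL_order, map_neg, map_add, map_sub, wL_kappa, map_zero]
  module

/-! ### Degree 3 with the two pairs of letters exchanged -/

theorem deltaTM_smul (q : Quadrant) (u : UNeg) (z : MV) : deltaTM q (u • z) = u • deltaTM q z := by
  simp only [deltaTM, LinearMap.add_apply, tm_smul, smul_add]

theorem nablaT3_smul (u : UNeg) (z : MV) : nablaT3 (u • z) = u • nablaT3 z := by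
  simp only [nablaT3, LinearMap.add_apply, LinearMap.comp_apply, tm_smul, deltaTM_smul, smul_add]

theorem nablaT3_wL (a b : Fin 2) (z : MV) : nablaT3 (wL a b z) = wL a b (nablaT3 z) :=
  nablaT3_smul _ z

theorem nablaT3_oneT (f : V) : nablaT3 (oneT f) =
    wL 0 0 (wL 0 1 (wL 1 0 (oneT (dy .C 0 (dx .A 0 f))) + wL 1 1 (oneT (dy .C 1 (dx .A 0 f)))))
    + wL 1 0 (wL 0 1 (wL 1 0 (oneT (dy .C 0 (dx .A 1 f))) + wL 1 1 (oneT (dy .C 1 (dx .A 1 f)))))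
    + wL 0 0 (wL 1 1 (wL 1 0 (oneT (dy .C 0 (dx .A 1 f))) + wL 1 1 (oneT (dy .C 1 (dx .A 1 f))))) := by
  simp only [nablaT3, deltaTM, LinearMap.add_apply, LinearMap.comp_apply, tm_oneT, tm_uL, uL_mul, uL_add,
    tau, LinearMap.id_apply, wL, wU_eq, map_add, uL_one]
  abel

theorem my_dy_dy_of_eulY {p : Quadrant} {g : V} (h : eulY p g = 0) (i j a : Fin 2) :
    my .C i (dy .C j (dy .C a g)) =
      -(if i = j then dy .C a g else 0) - if a = i then dy .C j g else 0 := by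
  have h1 := dy_my .C a i (dy .C j g)
  rw [my_dy_of_eulY h, dy_dy .C a j] at h1
  rw [eq_sub_iff_add_eq, ← h1]
  simp only [Quadrant.yDual, true_and]
  split_ifs <;> simp

theorem mx_dx_dy_of_eulX {p : Quadrant} {g : V} (h : eulX p g = 0) (i j a : Fin 2) :
    mx .C i (dx .C j (dy .C a g)) = -(if i = j then dy .C a g else 0) := by
  rw [← dy_dx, ← dy_mx, mx_dx_of_eulX h]
  simp only [Quadrant.xDual, true_and]
  split_ifs <;> simp

theorem dx_mx_dx_of_eulX {p : Quadrant} {f : V} (h : ∀ k, eulX p (dx .A k f) = 0) (i j k : Fin 2) :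
    dx .A k (mx .A i (dx .A j f)) = if k = i then dx .A j f else 0 := by
  rw [dx_mx, dx_dx .A k j, mx_dx_of_eulX (h k)]
  simp [Quadrant.xDual]

theorem gAct_YG_nablaT3 {p : Quadrant} {f : V} (hf : ∀ k, eulY p (dx .A k f) = 0) :
    ∀ i j, gAct .C (YG i j) (nablaT3 (oneT f)) = 0 := by
  simp only [Fin.forall_fin_two, nablaT3_oneT, map_add, gAct_YG_wL, gAct_YG_oneT,
    my_dy_dy_of_eulY (hf _), if_true, zero_ne_one, one_ne_zero, if_false, map_zero, add_zero,
    map_neg, map_sub]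
  simp only [wL_wL_self, wL_order, map_neg, map_add, map_sub, map_zero, wL_kappa]
  refine ⟨⟨?_, ?_⟩, ⟨?_, ?_⟩⟩ <;> module

theorem gAct_XG_nablaT3 {p : Quadrant} {f : V} (hf : ∀ k, eulX p (dx .A k f) = 0) :
    ∀ i j, gAct .C (XG i j) (nablaT3 (oneT f)) = nablaT3 (oneT (mx .A i (dx .A j f))) := by
  simp only [Fin.forall_fin_two, nablaT3_oneT, map_add, gAct_XG_wL, gAct_XG_oneT,
    mx_dx_dy_of_eulX (hf _), dx_mx_dx_of_eulX hf, if_true, zero_ne_one, one_ne_zero, if_false,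
    map_zero, add_zero, map_neg, map_sub]
  simp only [wL_wL_self, wL_order, map_neg, map_add, map_sub, map_zero, wL_kappa]
  refine ⟨⟨?_, ?_⟩, ⟨?_, ?_⟩⟩ <;> module

theorem gAct_PY_nablaT3 {p : Quadrant} {f : V} (hf : ∀ k, eulY p (dx .A k f) = 0) :
    ∀ i j, gAct .C (PY i j) (nablaT3 (oneT f)) = 0 := by
  simp only [Fin.forall_fin_two, nablaT3_oneT, map_add, gAct_PY_wL, gAct_PY_oneT, gAct_YG_wL,
    gAct_YG_oneT, my_dy_dy_of_eulY (hf _), eps_eq, map_zero, map_neg, map_smul, map_sub, if_true,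
    zero_ne_one, one_ne_zero, if_false]
  simp only [wL_wL_self, wL_order, map_neg, map_add, map_sub, map_zero, wL_kappa]
  refine ⟨⟨?_, ?_⟩, ⟨?_, ?_⟩⟩ <;> module

theorem gAct_PX_nablaT3 {p : Quadrant} {f : V} (hf : ∀ k, eulX p (dx .A k f) = 0) :
    ∀ i j, gAct .C (PX i j) (nablaT3 (oneT f)) = 0 := by
  simp only [Fin.forall_fin_two, nablaT3_oneT, map_add, gAct_PX_wL, gAct_PX_oneT, gAct_XG_wL,
    gAct_XG_oneT, mx_dx_dy_of_eulX (hf _), eps_eq, map_zero, map_neg, map_smul, map_sub, if_true,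
    zero_ne_one, one_ne_zero, if_false]
  simp only [wL_wL_self, wL_order, map_neg, map_add, map_sub, map_zero, wL_kappa]
  refine ⟨⟨?_, ?_⟩, ⟨?_, ?_⟩⟩ <;> module

theorem dy_dx_mem_bideg {f : V} (hf : f ∈ bidegSpace .A 1 0) (a k : Fin 2) :
    dy .C a (dx .A k f) ∈ bidegSpace .C 0 (-1) := by
  have h : dx .A k f ∈ bidegSpace .A 0 0 := dx_mem hf k
  refine dy_mem (n := 0) ⟨?_, ?_⟩ a
  · rw [(eulX_eq_zero_iff .A .C _).1 (eulX_of_mem h), Int.cast_zero, zero_smul]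
  · rw [(eulY_eq_zero_iff .A .C _).1 (eulY_of_mem h), Int.cast_zero, zero_smul]

theorem nablaT3_isMorphism : IsMorphism (bideg .A 1 0) (bideg .C 0 (-1)) nablaT3 := by
  have hg : ∀ f ∈ bidegSpace .A 1 0, ∀ k, dx .A k f ∈ bidegSpace .A 0 0 := fun f hf k => dx_mem hf k
  have hY : ∀ f ∈ bidegSpace .A 1 0, ∀ k, eulY .A (dx .A k f) = 0 := fun f hf k =>
    eulY_of_mem (hg f hf k)
  have hX : ∀ f ∈ bidegSpace .A 1 0, ∀ k, eulX .A (dx .A k f) = 0 := fun f hf k =>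
    eulX_of_mem (hg f hf k)
  refine isMorphism_of_generators _ _ _ nablaT3_smul (fun v hv => ?_)
    (fun i j v hv => ?_) (fun i j v hv => ?_)
    (fun i j v hv => gAct_PX_nablaT3 (hX v hv) i j) (fun i j v hv => gAct_PY_nablaT3 (hY v hv) i j)
  · rw [← oneT_apply, nablaT3_oneT]
    simp only [wL, map_add, ← uL_mul]
    have h := fun u k a => uL_oneT_mem (bideg .C 0 (-1)) u (dy_dx_mem_bideg hv a k)
    exact Submodule.add_mem _ (Submodule.add_mem _ (Submodule.add_mem _ (h _ _ _) (h _ _ _))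
      (Submodule.add_mem _ (h _ _ _) (h _ _ _))) (Submodule.add_mem _ (h _ _ _) (h _ _ _))
  · rw [← oneT_apply, gAct_XG_nablaT3 (hX v hv), act_XG, oneT_apply]
  · rw [← oneT_apply, gAct_YG_nablaT3 (hY v hv), act_YG, my_dy_of_eulY (eulY_of_mem hv)]
    simp [Quadrant.yDual]

theorem nabla_nablaT3 : nabla .C ∘ₗ nablaT3 = 0 := by
  refine ext_of_smul (fun u z => by simp only [LinearMap.comp_apply, nabla_smul, nablaT3_smul])
    (fun u z => by simp) fun f => ?_
  simp only [LinearMap.comp_apply, nabla_oneT, nablaT3_oneT, map_add, nabla_wL, dy_dy .C 1 0, dy_dx,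
    LinearMap.zero_apply]
  simp only [wL_wL_self, wL_order, map_neg, map_add, map_sub, wL_kappa, map_zero]
  module

theorem nablaT3_nabla : nablaT3 ∘ₗ nabla .A = 0 := by
  refine ext_of_smul (fun u z => by simp only [LinearMap.comp_apply, nabla_smul, nablaT3_smul])
    (fun u z => by simp) fun f => ?_
  simp only [LinearMap.comp_apply, nabla_oneT, nablaT3_oneT, map_add, nablaT3_wL, dy_dx, dx_dx .A 1 0,
    LinearMap.zero_apply]
  simp only [wL_wL_self, wL_order, map_neg, map_add, map_sub, wL_kappa, map_zero]
  module

/-! # Nonvanishing of products of the `w_{ij}` -/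

/-- Four anticommuting matrices with square `1`. -/
def gammaMat : Fin 4 → Matrix (Fin 4) (Fin 4) ℂ :=
  ![!![0, 0, -Complex.I, 0; 0, 0, 0, -Complex.I; Complex.I, 0, 0, 0; 0, Complex.I, 0, 0],
    !![0, 0, 1, 0; 0, 0, 0, 1; 1, 0, 0, 0; 0, 1, 0, 0],
    !![0, -Complex.I, 0, 0; Complex.I, 0, 0, 0; 0, 0, 0, Complex.I; 0, 0, -Complex.I, 0],
    !![0, -1, 0, 0; -1, 0, 0, 0; 0, 0, 0, 1; 0, 0, 1, 0]]

theorem gammaMat_mul : ∀ i j, gammaMat i * gammaMat j + gammaMat j * gammaMat i =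
    if i = j then 1 + 1 else 0 := by
  intro i j
  rw [← Matrix.ext_iff]
  revert i j
  simp [Fin.forall_fin_succ, gammaMat, Matrix.mul_apply, Fin.sum_univ_four]

theorem gammaMat_anticomm (i j : Fin 4) : gammaMat i * gammaMat j + gammaMat j * gammaMat i =
    if i = j then gammaMat 0 * gammaMat 0 + gammaMat 0 * gammaMat 0 else 0 := by
  rw [gammaMat_mul, gammaMat_mul 0 0, if_pos rfl]

theorem ne_zero_of_gammaMat {u : UNeg} (h : H) (hu : hToNeg h = u) {k l : Fin 4}
    (hM : hLift gammaMat gammaMat_anticomm h k l ≠ 0) : u ≠ 0 := by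
  rintro rfl
  have : h = 0 := hToNeg_injective (hu.trans (map_zero _).symm)
  rw [this, map_zero] at hM
  exact hM rfl

/-- The gamma matrices give a representation of `H`, which is isomorphic to `U(𝔤_{<0})`; one nonzero
matrix entry of the product is enough. -/
theorem w11_w22_w21_ne_zero : w11 * w22 * w21 ≠ 0 := by
  refine ne_zero_of_gammaMat ((hEta 1 + Complex.I • hEta 0) * (hEta 1 - Complex.I • hEta 0)
    * (hEta 3 + Complex.I • hEta 2)) ?_ (k := 1) (l := 0) ?_
  · simp only [map_mul, map_add, map_sub, map_smul, hToNeg_hEta]; rfl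
  · simp only [map_mul, map_add, map_sub, map_smul, hLift_hEta]
    simp [gammaMat, Matrix.mul_apply, Fin.sum_univ_four]

theorem w11_w22_w12_ne_zero : w11 * w22 * w12 ≠ 0 := by
  refine ne_zero_of_gammaMat ((hEta 1 + Complex.I • hEta 0) * (hEta 1 - Complex.I • hEta 0)
    * (-hEta 3 + Complex.I • hEta 2)) ?_ (k := 0) (l := 1) ?_
  · simp only [map_mul, map_add, map_sub, map_smul, map_neg, hToNeg_hEta]; rfl
  · simp only [map_mul, map_add, map_sub, map_smul, map_neg, hLift_hEta]
    simp [gammaMat, Matrix.mul_apply, Fin.sum_univ_four]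

theorem w11_ne_zero : w11 ≠ 0 := fun h => w11_w22_w21_ne_zero (by rw [h, zero_mul, zero_mul])

theorem w22_ne_zero : w22 ≠ 0 := fun h => w11_w22_w21_ne_zero (by rw [h, mul_zero, zero_mul])

theorem w21_ne_zero : w21 ≠ 0 := fun h => w11_w22_w21_ne_zero (by rw [h, mul_zero])

theorem w12_ne_zero : w12 ≠ 0 := fun h => w11_w22_w12_ne_zero (by rw [h, mul_zero])

theorem w22_mul_w12 : w22 * w12 = -(w12 * w22) := by
  have := wU_anticomm 1 1 0 1
  simpa [wU_eq, eps_eq] using this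

theorem w22_mul_w21 : w22 * w21 = -(w21 * w22) := by
  have := wU_anticomm 1 1 1 0
  simpa [wU_eq, eps_eq] using this

/-- Up to sign this is a factor of a nonzero cubic product; the other quadratic products are treated
in the same way. -/
theorem w12_w22_ne_zero : w12 * w22 ≠ 0 := fun h => w11_w22_w12_ne_zero (by
  rw [mul_assoc, w22_mul_w12, h, neg_zero, mul_zero])

theorem w21_w22_ne_zero : w21 * w22 ≠ 0 := fun h => w11_w22_w21_ne_zero (by
  rw [mul_assoc, w22_mul_w21, h, neg_zero, mul_zero])

theorem w11_w12_ne_zero : w11 * w12 ≠ 0 := fun h => w11_w22_w12_ne_zero (by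
  rw [mul_assoc, w22_mul_w12, mul_neg, ← mul_assoc, h, zero_mul, neg_zero])

theorem w11_w21_ne_zero : w11 * w21 ≠ 0 := fun h => w11_w22_w21_ne_zero (by
  rw [mul_assoc, w22_mul_w21, mul_neg, ← mul_assoc, h, zero_mul, neg_zero])

/-! # Degrees -/

theorem UNegDeg_mul {d e : ℕ} {u v : UNeg} (hu : u ∈ UNegDeg d) (hv : v ∈ UNegDeg e) :
    u * v ∈ UNegDeg (d + e) := by
  have h := Submodule.mul_mem_mul hu hv
  rw [UNegDeg, UNegDeg, Submodule.span_mul_span] at h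
  refine Submodule.span_mono ?_ h
  rintro _ ⟨a, ⟨l, h1, h2, h3⟩, b, ⟨l', h1', h2', h3'⟩, rfl⟩
  refine ⟨l ++ l', fun x hx => ?_, ?_, ?_⟩
  · exact (List.mem_append.1 hx).elim (h1 x) (h1' x)
  · rw [List.map_append, List.sum_append, h2, h2']; push_cast; ring
  · rw [List.map_append, List.prod_append, ← h3, ← h3']; rfl

theorem one_mem_UNegDeg : (1 : UNeg) ∈ UNegDeg 0 :=
  Submodule.subset_span ⟨[], by simp, by simp, by simp⟩

theorem eta_mem_UNegDeg (i : Fin 4) : eta i ∈ UNegDeg 1 :=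
  Submodule.subset_span ⟨[(0, {i})], by simp [degB], by simp [degB], by simp [eta, xi]⟩

theorem wU_mem_UNegDeg : ∀ a b, wU a b ∈ UNegDeg 1 := by
  have h := eta_mem_UNegDeg
  have hI : ∀ i, Complex.I • eta i ∈ UNegDeg 1 := fun i => Submodule.smul_mem _ _ (h i)
  simp only [Fin.forall_fin_two, wU_eq]
  exact ⟨⟨Submodule.add_mem _ (h _) (hI _), Submodule.add_mem _ (Submodule.neg_mem _ (h _)) (hI _)⟩,
    Submodule.add_mem _ (h _) (hI _), Submodule.sub_mem _ (h _) (hI _)⟩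

/-- The homogeneous part of degree `d` of `U(𝔤_{<0}) ⊗ S`. -/
def degSub {q : Quadrant} (S : SubRep q) (d : ℕ) : Submodule ℂ MV :=
  (LinearMap.range (TensorProduct.map (UNegDeg d).subtype
    (LinearMap.id : S.carrier →ₗ[ℂ] S.carrier))).map S.incl

theorem oneT_mem_degSub {q : Quadrant} {S : SubRep q} {f : V} (hf : f ∈ S.carrier) :
    oneT f ∈ degSub S 0 :=
  ⟨1 ⊗ₜ ⟨f, hf⟩, ⟨⟨1, one_mem_UNegDeg⟩ ⊗ₜ ⟨f, hf⟩, rfl⟩, rfl⟩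

theorem wL_mem_degSub {q : Quadrant} {S : SubRep q} {d : ℕ} {z : MV} (hz : z ∈ degSub S d)
    (a b : Fin 2) : wL a b z ∈ degSub S (d + 1) := by
  obtain ⟨_, ⟨y, rfl⟩, rfl⟩ := hz
  induction y using TensorProduct.induction_on with
  | zero => simp
  | add y y' h h' => simp only [map_add]; exact Submodule.add_mem _ h h'
  | tmul u v =>
    refine ⟨(wU a b * u) ⊗ₜ v, ⟨⟨wU a b * u, ?_⟩ ⊗ₜ v, rfl⟩, rfl⟩
    rw [add_comm]
    exact UNegDeg_mul (wU_mem_UNegDeg a b) u.2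

/-! # Highest weight vectors -/

/-- `Ind S` embeds in `M_X` compatibly with `incl`, so eigenvector equations can be tested there. -/
theorem SubRep.iota_smul_pbw_eq_iff {q : Quadrant} (S : SubRep q) (x : G) (c : ℂ) (y : S.M) :
    iota x • S.pbw y = c • S.pbw y ↔ gAct q x (S.incl y) = c • S.incl y := by
  rw [gAct_eq_iff, (ambEquiv q).map_smul, ← S.indIncl_pbw, ← algebraMap_smul U c (S.pbw y),
    ← algebraMap_smul U c (S.indIncl (S.pbw y)), ← S.indIncl.map_smul, ← S.indIncl.map_smul,
    S.indIncl_injective.eq_iff]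

theorem derivation_pow_mul_pow {D : Derivation ℂ V V} {a b : V} {c e : ℂ} (ha : D a = c • a)
    (hb : D b = e • b) (m n : ℕ) : D (a ^ m * b ^ n) = (m * c + n * e) • (a ^ m * b ^ n) := by
  have h : ∀ {a : V} {c : ℂ}, D a = c • a → ∀ m : ℕ, D (a ^ m) = (m * c) • a ^ m := by
    intro a c ha m
    induction m with
    | zero => simp
    | succ k ih =>
      rw [pow_succ, Derivation.leibniz, ih, ha, smul_eq_mul, smul_eq_mul, mul_smul_comm,
        mul_smul_comm, mul_comm a, ← add_smul]
      push_cast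
      congr 1
      ring
  rw [Derivation.leibniz, h ha, h hb, smul_eq_mul, smul_eq_mul, mul_smul_comm, mul_smul_comm,
    mul_comm (b ^ n), ← add_smul, add_comm]

/-- The eigenvalue on `hwVec q m n` of a derivation having the letters of `hwVec q 1 1` as
eigenvectors. -/
theorem derivation_hwVec {q : Quadrant} {D : Derivation ℂ V V} {c e : ℂ}
    (hx : D (if q.xDual then lx 1 else lx 0) = c • if q.xDual then lx 1 else lx 0)
    (hy : D (if q.yDual then ly 1 else ly 0) = e • if q.yDual then ly 1 else ly 0) (m n : ℕ) :
    D (hwVec q m n) = (m * c + n * e) • hwVec q m n := by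
  have h : hwVec q m n =
      (if q.xDual then lx 1 else lx 0) ^ m * (if q.yDual then ly 1 else ly 0) ^ n := by
    rw [hwVec]; split_ifs <;> rfl
  rw [h, derivation_pow_mul_pow hx hy]

theorem glX_hwVec (q : Quadrant) (m n : ℕ) : glX q 0 1 (hwVec q m n) = 0 := by
  rw [derivation_hwVec (c := 0) (e := 0)]
  · simp
  · cases h : q.xDual <;> simp [glX_apply, h, pderiv_inl_lx]
  · cases h : q.xDual <;> cases h' : q.yDual <;> simp [glX_apply, h, pderiv_inl_ly]

theorem glY_hwVec (q : Quadrant) (m n : ℕ) : glY q 0 1 (hwVec q m n) = 0 := by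
  rw [derivation_hwVec (c := 0) (e := 0)]
  · simp
  · cases h : q.xDual <;> cases h' : q.yDual <;> simp [glY_apply, h', pderiv_inr_lx]
  · cases h : q.yDual <;> simp [glY_apply, h, pderiv_inr_ly]

theorem cartX_hwVec (q : Quadrant) (m n : ℕ) :
    cartX q (hwVec q m n) = (m : ℂ) • hwVec q m n := by
  rw [derivation_hwVec (c := 1) (e := 0), mul_one, mul_zero, add_zero]
  · cases h : q.xDual <;> simp [cartX, glX_apply, h, pderiv_inl_lx]
  · cases h : q.xDual <;> cases h' : q.yDual <;> simp [cartX, glX_apply, h, pderiv_inl_ly]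

theorem cartY_hwVec (q : Quadrant) (m n : ℕ) :
    cartY q (hwVec q m n) = (n : ℂ) • hwVec q m n := by
  rw [derivation_hwVec (c := 0) (e := 1), mul_one, mul_zero, zero_add]
  · cases h : q.xDual <;> cases h' : q.yDual <;> simp [cartY, glY_apply, h', pderiv_inr_lx]
  · cases h : q.yDual <;> simp [cartY, glY_apply, h, pderiv_inr_ly]

theorem eulX_hwVec (q : Quadrant) (m n : ℕ) :
    eulX q (hwVec q m n) = ((if q.xDual then -(m : ℤ) else m : ℤ) : ℂ) • hwVec q m n := by
  rw [derivation_hwVec (c := if q.xDual then -1 else 1) (e := 0), mul_zero, add_zero]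
  · cases h : q.xDual <;> simp
  · cases h : q.xDual <;> simp [eulX, glX_apply, h, pderiv_inl_lx]
  · cases h : q.xDual <;> cases h' : q.yDual <;> simp [eulX, glX_apply, h, pderiv_inl_ly]

theorem eulY_hwVec (q : Quadrant) (m n : ℕ) :
    eulY q (hwVec q m n) = ((if q.yDual then -(n : ℤ) else n : ℤ) : ℂ) • hwVec q m n := by
  rw [derivation_hwVec (c := 0) (e := if q.yDual then -1 else 1), mul_zero, zero_add]
  · cases h : q.yDual <;> simp
  · cases h : q.xDual <;> cases h' : q.yDual <;> simp [eulY, glY_apply, h', pderiv_inr_lx]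
  · cases h : q.yDual <;> simp [eulY, glY_apply, h, pderiv_inr_ly]

theorem hwVec_mem (q : Quadrant) (m n : ℕ) : hwVec q m n ∈ (vertex q m n).carrier :=
  ⟨eulX_hwVec q m n, eulY_hwVec q m n⟩

theorem actT_hwVec (q : Quadrant) (m n : ℕ) :
    actT q (hwVec q m n) = muT q m n • hwVec q m n := by
  simp only [actT, LinearMap.add_apply, LinearMap.smul_apply, Derivation.coeFn_coe, eulX_hwVec,
    eulY_hwVec, LinearMap.id_apply]
  rw [← add_smul, smul_smul, ← add_smul]
  congr 1
  cases q <;> simp [Quadrant.xDual, Quadrant.yDual, Quadrant.tShift, muT] <;> ring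

theorem actC_hwVec (q : Quadrant) (m n : ℕ) :
    actC q (hwVec q m n) = muC q m n • hwVec q m n := by
  simp only [actC, LinearMap.add_apply, LinearMap.sub_apply, LinearMap.smul_apply,
    Derivation.coeFn_coe, eulX_hwVec, eulY_hwVec, LinearMap.id_apply]
  rw [smul_smul, smul_smul, ← sub_smul, ← add_smul]
  congr 1
  cases q <;> simp [Quadrant.xDual, Quadrant.yDual, Quadrant.cShift, muC] <;> ring

theorem hX_mem_gGe : hX ∈ gGe := by
  have h : hX = XG 0 0 - XG 1 1 := by rw [XG_eq.1, XG_eq.2.2.2]; module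
  rw [h]
  exact gGe.sub_mem (XG_mem_gGe 0 0) (XG_mem_gGe 1 1)

theorem hY_mem_gGe : hY ∈ gGe := by
  have h : hY = YG 0 0 - YG 1 1 := by rw [YG_eq.1, YG_eq.2.2.2]; module
  rw [h]
  exact gGe.sub_mem (YG_mem_gGe 0 0) (YG_mem_gGe 1 1)

theorem tG_mem_gGe : tG ∈ gGe := gmono_mem_gGe (by simp [degB])

/-- A vector on which `𝔤_{≥0}` acts as on the highest weight vector of `vertex p m n`. -/
theorem isHWSingular_of {p q : Quadrant} (S : SubRep q) {d m n : ℕ} {z : MV}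
    (hd : z ∈ degSub S d) (hne : z ≠ 0)
    (h : ∀ x ∈ gGe, ∀ c : ℂ, act p x (hwVec p m n) = c • hwVec p m n → gAct q x z = c • z) :
    IsHWSingular S d m n (muT p m n) (muC p m n) z := by
  obtain ⟨y, hy, rfl⟩ := hd
  have h0 : ∀ x ∈ gGe, act p x (hwVec p m n) = 0 → iota x • S.pbw y = 0 := fun x hx h' => by
    rw [← zero_smul ℂ (S.pbw y), S.iota_smul_pbw_eq_iff]
    exact h x hx 0 (by rw [h', zero_smul])
  have hc : ∀ x ∈ gGe, ∀ c : ℂ, act p x (hwVec p m n) = c • hwVec p m n →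
      iota x • S.pbw y = c • S.pbw y := fun x hx c h' =>
    (S.iota_smul_pbw_eq_iff x c y).2 (h x hx c h')
  refine ⟨y, rfl, fun h' => hne ?_, hy, fun x hx => h0 x (gPos_le_gGe hx) ?_,
    h0 _ (XG_mem_gGe 0 1) ?_, h0 _ (YG_mem_gGe 0 1) ?_, hc _ hX_mem_gGe _ ?_,
    hc _ hY_mem_gGe _ ?_, hc _ tG_mem_gGe _ ?_, hc _ cG_mem_gGe _ ?_⟩
  · rw [S.pbw_bijective.1 (h'.trans (map_zero _).symm), map_zero]
  · rw [act_gPos p hx, LinearMap.zero_apply]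
  · rw [act_eX]; exact glX_hwVec p m n
  · rw [act_eY]; exact glY_hwVec p m n
  · rw [act_hX]; exact cartX_hwVec p m n
  · rw [act_hY]; exact cartY_hwVec p m n
  · rw [act_tG]; exact actT_hwVec p m n
  · rw [act_cG]; exact actC_hwVec p m n

theorem IsMorphism.gAct_map {p q : Quadrant} {S : SubRep p} {T : SubRep q} {Φ : MV →ₗ[ℂ] MV}
    (h : IsMorphism S T Φ) {x : G} (hx : x ∈ gGe) {v : V} (hv : v ∈ S.carrier) :
    gAct q x (Φ (oneT v)) = Φ (oneT (act p x v)) := by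
  obtain ⟨Ψ, hΨ⟩ := h
  obtain ⟨y, hy, hy'⟩ := hΨ (1 ⊗ₜ ⟨v, hv⟩)
  obtain ⟨z, hz, hz'⟩ := hΨ (1 ⊗ₜ ⟨act p x v, S.stable x hv⟩)
  have hs : S.pbw (1 ⊗ₜ ⟨act p x v, S.stable x hv⟩) = iota x • S.pbw (1 ⊗ₜ ⟨v, hv⟩) := by
    rw [SubRep.pbw, pbwInd_tmul, pbwInd_tmul, Subalgebra.coe_one, one_smul, one_smul,
      iota_smul_indMk _ ⟨x, hx⟩]
    rfl
  rw [S.incl_tmul] at hy hz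
  rw [oneT_apply, oneT_apply, ← hy, ← hz, gAct_eq_iff, ← T.indIncl_pbw, ← T.indIncl_pbw, ← hy',
    ← hz', hs, map_smul, map_smul]

/-- The evaluation of the polynomials at a point. -/
def evalMV (g : Fin 2 ⊕ Fin 2 → ℂ) : MV →ₗ[ℂ] UNeg :=
  (TensorProduct.rid ℂ UNeg).toLinearMap ∘ₗ
    TensorProduct.map LinearMap.id (MvPolynomial.aeval g).toLinearMap

theorem evalMV_tmul (g : Fin 2 ⊕ Fin 2 → ℂ) (u : UNeg) (f : V) :
    evalMV g (u ⊗ₜ f) = MvPolynomial.eval g f • u := by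
  simp [evalMV]

theorem eval_lx (g : Fin 2 ⊕ Fin 2 → ℂ) (j : Fin 2) :
    MvPolynomial.eval g (lx j) = g (Sum.inl j) := MvPolynomial.eval_X _

theorem eval_ly (g : Fin 2 ⊕ Fin 2 → ℂ) (j : Fin 2) :
    MvPolynomial.eval g (ly j) = g (Sum.inr j) := MvPolynomial.eval_X _

/-- Evaluating the polynomial factor at a point sends `z` into `U(𝔤_{<0})`; a point that isolates
one term reduces nonvanishing to that of a product of `w`'s. -/
theorem ne_zero_of_evalMV {z : MV} (g : Fin 2 ⊕ Fin 2 → ℂ) {u : UNeg} (hu : u ≠ 0)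
    (h : evalMV g z = u) : z ≠ 0 := by
  rintro rfl
  exact hu (by rw [← h, map_zero])

theorem oneT_hwVec_ne_zero (q : Quadrant) (m n : ℕ) : oneT (hwVec q m n) ≠ 0 := by
  have h : (1 : UNeg) ≠ 0 := fun h => w11_ne_zero (by rw [← mul_one w11, h, mul_zero])
  refine ne_zero_of_evalMV (fun _ => 1) h ?_
  rw [oneT_apply, evalMV_tmul]
  cases q <;> simp [hwVec, Quadrant.xDual, Quadrant.yDual, eval_lx, eval_ly]

/-- Singularity and weight of `z` need no calculation: `z` is a multiple of the image of the highest
weight vector, and a morphism carries every eigenvector equation for `𝔤_{≥0}` along. Only the degree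
and `z ≠ 0` are extra. -/
theorem isArrow_of {p q : Quadrant} {m n m' n' d : ℕ} {Φ : MV →ₗ[ℂ] MV} {r : ℂ} {z : MV}
    (hM : IsMorphism (vertex p m n) (vertex q m' n') Φ)
    (hd : Φ (oneT (hwVec p m n)) ∈ degSub (vertex q m' n') d) (hr : r ≠ 0) (hne : z ≠ 0)
    (hz : Φ (oneT (hwVec p m n)) = r • z) : IsArrow p m n q m' n' d Φ r z := by
  have hz' : z = r⁻¹ • Φ (oneT (hwVec p m n)) := by rw [hz, inv_smul_smul₀ hr]
  refine ⟨hM, ?_, ?_, hr, hz⟩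
  · refine isHWSingular_of _ (oneT_mem_degSub (hwVec_mem p m n)) (oneT_hwVec_ne_zero p m n)
      fun x hx c hc => ?_
    rw [gAct_one_tmul _ hx, hc, TensorProduct.tmul_smul]
  · refine isHWSingular_of _ (hz' ▸ Submodule.smul_mem _ _ hd) hne fun x hx c hc => ?_
    rw [hz', map_smul, hM.gAct_map hx (hwVec_mem p m n), hc, map_smul, map_smul, smul_comm]

set_option linter.unusedSimpArgs false

theorem nabla_mem_degSub {q : Quadrant} {T : SubRep q} {f : V}
    (h : ∀ i j, dx q i (dy q j f) ∈ T.carrier) : nabla q (oneT f) ∈ degSub T 1 := by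
  have hm : ∀ a b i j, wL a b (oneT (dx q i (dy q j f))) ∈ degSub T 1 := fun a b i j =>
    wL_mem_degSub (oneT_mem_degSub (h i j)) a b
  rw [nabla_oneT]
  exact Submodule.add_mem _ (Submodule.add_mem _ (Submodule.add_mem _ (hm _ _ _ _) (hm _ _ _ _))
    (hm _ _ _ _)) (hm _ _ _ _)

theorem nabla2_mem_degSub {q : Quadrant} {T : SubRep q} {f : V}
    (h : ∀ i j, dx q i (dx q j f) ∈ T.carrier) : nabla2 q (oneT f) ∈ degSub T 2 := by
  have hm : ∀ a b c d i j, wL a b (wL c d (oneT (dx q i (dx q j f)))) ∈ degSub T 2 :=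
    fun a b c d i j => wL_mem_degSub (wL_mem_degSub (oneT_mem_degSub (h i j)) c d) a b
  rw [nabla2_oneT]
  exact Submodule.add_mem _ (Submodule.add_mem _ (Submodule.add_mem _ (hm _ _ _ _ _ _)
    (hm _ _ _ _ _ _)) (hm _ _ _ _ _ _)) (hm _ _ _ _ _ _)

theorem nablaT2_mem_degSub {q : Quadrant} {T : SubRep q} {f : V}
    (h : ∀ i j, dy q i (dy q j f) ∈ T.carrier) : nablaT2 q (oneT f) ∈ degSub T 2 := by
  have hm : ∀ a b c d i j, wL a b (wL c d (oneT (dy q i (dy q j f)))) ∈ degSub T 2 :=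
    fun a b c d i j => wL_mem_degSub (wL_mem_degSub (oneT_mem_degSub (h i j)) c d) a b
  rw [nablaT2_oneT]
  exact Submodule.add_mem _ (Submodule.add_mem _ (Submodule.add_mem _ (hm _ _ _ _ _ _)
    (hm _ _ _ _ _ _)) (hm _ _ _ _ _ _)) (hm _ _ _ _ _ _)

/-- Vertices are labelled by natural numbers whereas `∇` lowers the signed bidegree by `(1, 1)`;
`hm` and `hn` translate, so that along dual letters the label increases. -/
theorem nabla_arrow {p : Quadrant} {m n m' n' : ℕ}
    (hm : (if p.xDual then -(m' : ℤ) else m') = (if p.xDual then -(m : ℤ) else m) - 1)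
    (hn : (if p.yDual then -(n' : ℤ) else n') = (if p.yDual then -(n : ℤ) else n) - 1)
    {r : ℂ} {z : MV} (hr : r ≠ 0) (hne : z ≠ 0)
    (hz : nabla p (oneT (hwVec p m n)) = r • z) : IsArrow p m n p m' n' 1 (nabla p) r z := by
  have h : ∀ f ∈ (vertex p m n).carrier, ∀ i j, dx p i (dy p j f) ∈ (vertex p m' n').carrier := by
    intro f hf i j
    rw [vertex, hm, hn]
    exact dx_mem (dy_mem hf j) i
  exact isArrow_of (nabla_isMorphism _ _ h) (nabla_mem_degSub (h _ (hwVec_mem p m n))) hr hne hz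

theorem nabla2_arrow {p q : Quadrant} (hxy : p.xDual = q.xDual) (hp : p.yDual = false)
    (hq : q.yDual = true) {m m' : ℕ}
    (hm : (if q.xDual then -(m' : ℤ) else m') = (if p.xDual then -(m : ℤ) else m) - 2)
    {r : ℂ} {z : MV} (hr : r ≠ 0) (hne : z ≠ 0)
    (hz : nabla2 q (oneT (hwVec p m 0)) = r • z) : IsArrow p m 0 q m' 0 2 (nabla2 q) r z := by
  have h0 : (vertex p m 0).carrier = bidegSpace p (if p.xDual then -(m : ℤ) else m) 0 := by
    simp [vertex, bideg]
  have h0' : (vertex q m' 0).carrier = bidegSpace q (if q.xDual then -(m' : ℤ) else m') 0 := by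
    simp [vertex, bideg]
  have h : ∀ f ∈ (vertex p m 0).carrier, ∀ i j, dx q i (dx q j f) ∈ (vertex q m' 0).carrier := by
    intro f hf i j
    rw [h0', hm]
    exact dx_dx_mem_bideg hxy (h0 ▸ hf) i j
  exact isArrow_of (nabla2_isMorphism hxy hp hq _ _ (fun f hf => eulY_of_mem (h0 ▸ hf)) h)
    (nabla2_mem_degSub (h _ (hwVec_mem p m 0))) hr hne hz

theorem nablaT2_arrow {p q : Quadrant} (hxy : p.yDual = q.yDual) (hp : p.xDual = false)
    (hq : q.xDual = true) {n n' : ℕ}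
    (hn : (if q.yDual then -(n' : ℤ) else n') = (if p.yDual then -(n : ℤ) else n) - 2)
    {r : ℂ} {z : MV} (hr : r ≠ 0) (hne : z ≠ 0)
    (hz : nablaT2 q (oneT (hwVec p 0 n)) = r • z) : IsArrow p 0 n q 0 n' 2 (nablaT2 q) r z := by
  have h0 : (vertex p 0 n).carrier = bidegSpace p 0 (if p.yDual then -(n : ℤ) else n) := by
    simp [vertex, bideg]
  have h0' : (vertex q 0 n').carrier = bidegSpace q 0 (if q.yDual then -(n' : ℤ) else n') := by
    simp [vertex, bideg]
  have h : ∀ f ∈ (vertex p 0 n).carrier, ∀ i j, dy q i (dy q j f) ∈ (vertex q 0 n').carrier := by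
    intro f hf i j
    rw [h0', hn]
    exact dy_dy_mem_bideg hxy (h0 ▸ hf) i j
  exact isArrow_of (nablaT2_isMorphism hxy hp hq _ _ (fun f hf => eulX_of_mem (h0 ▸ hf)) h)
    (nablaT2_mem_degSub (h _ (hwVec_mem p 0 n))) hr hne hz

/-! ### Values of the maps on the highest weight vectors -/

/-- The point of `Fin 2 ⊕ Fin 2 → ℂ` with coordinates `1` at `x_i` and `y_j`, and `0` elsewhere. -/
def unitPt (i j : Fin 2) : Fin 2 ⊕ Fin 2 → ℂ :=
  Sum.elim (fun k => if k = i then 1 else 0) (fun k => if k = j then 1 else 0)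

theorem unitPt_inl (i j k : Fin 2) : unitPt i j (Sum.inl k) = if k = i then 1 else 0 := rfl

theorem unitPt_inr (i j k : Fin 2) : unitPt i j (Sum.inr k) = if k = j then 1 else 0 := rfl

theorem hwVec_eq (m n : ℕ) : hwVec .A m n = lx 0 ^ m * ly 0 ^ n ∧
    hwVec .B m n = lx 1 ^ m * ly 0 ^ n ∧ hwVec .C m n = lx 1 ^ m * ly 1 ^ n ∧
    hwVec .D m n = lx 0 ^ m * ly 1 ^ n := ⟨rfl, rfl, rfl, rfl⟩

theorem w_tmul (f : V) : w11 ⊗ₜ[ℂ] f = wL 0 0 (oneT f) ∧ w12 ⊗ₜ[ℂ] f = wL 0 1 (oneT f) ∧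
    w21 ⊗ₜ[ℂ] f = wL 1 0 (oneT f) ∧ w22 ⊗ₜ[ℂ] f = wL 1 1 (oneT f) :=
  ⟨wU_tmul 0 0 f, wU_tmul 0 1 f, wU_tmul 1 0 f, wU_tmul 1 1 f⟩

theorem wU_mul_tmul (a b c d : Fin 2) (f : V) :
    (wU a b * wU c d) ⊗ₜ[ℂ] f = wL a b (wL c d (oneT f)) := by
  rw [← uL_oneT, uL_mul]; rfl

theorem w_mul_tmul (f : V) : (w11 * w12) ⊗ₜ[ℂ] f = wL 0 0 (wL 0 1 (oneT f)) ∧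
    (w11 * w21) ⊗ₜ[ℂ] f = wL 0 0 (wL 1 0 (oneT f)) ∧
    (w11 * w22) ⊗ₜ[ℂ] f = wL 0 0 (wL 1 1 (oneT f)) ∧
    (w12 * w21) ⊗ₜ[ℂ] f = wL 0 1 (wL 1 0 (oneT f)) ∧
    (w21 * w12) ⊗ₜ[ℂ] f = wL 1 0 (wL 0 1 (oneT f)) ∧
    (w12 * w22) ⊗ₜ[ℂ] f = wL 0 1 (wL 1 1 (oneT f)) ∧
    (w21 * w22) ⊗ₜ[ℂ] f = wL 1 0 (wL 1 1 (oneT f)) :=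
  ⟨wU_mul_tmul 0 0 0 1 f, wU_mul_tmul 0 0 1 0 f, wU_mul_tmul 0 0 1 1 f, wU_mul_tmul 0 1 1 0 f,
    wU_mul_tmul 1 0 0 1 f, wU_mul_tmul 0 1 1 1 f, wU_mul_tmul 1 0 1 1 f⟩

theorem wU_mul_mul_tmul (a b c d e g : Fin 2) (f : V) :
    (wU a b * wU c d * wU e g) ⊗ₜ[ℂ] f = wL a b (wL c d (wL e g (oneT f))) := by
  rw [← uL_oneT, uL_mul, uL_mul]; rfl

theorem dx_nonDual {q : Quadrant} (h : q.xDual = false) (a : ℕ) (f : V)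
    (hf : ∀ i, MvPolynomial.pderiv (Sum.inl i) f = 0) :
    dx q 0 (lx 0 ^ (a + 1) * f) = (a + 1 : ℂ) • (lx 0 ^ a * f) ∧ dx q 1 (lx 0 ^ a * f) = 0 := by
  simp [dx, h, Derivation.leibniz, Derivation.leibniz_pow, pderiv_inl_lx, hf,
    MvPolynomial.smul_eq_C_mul]
  ring

theorem dy_nonDual {q : Quadrant} (h : q.yDual = false) (b : ℕ) (f : V)
    (hf : ∀ i, MvPolynomial.pderiv (Sum.inr i) f = 0) :
    dy q 0 (f * ly 0 ^ (b + 1)) = (b + 1 : ℂ) • (f * ly 0 ^ b) ∧ dy q 1 (f * ly 0 ^ b) = 0 := by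
  simp [dy, h, Derivation.leibniz, Derivation.leibniz_pow, pderiv_inr_ly, hf,
    MvPolynomial.smul_eq_C_mul]
  ring

theorem dx_dual {q : Quadrant} (h : q.xDual = true) (i : Fin 2) (f : V) :
    dx q i f = lx i * f := by
  rw [dx, if_pos h, LinearMap.mulLeft_apply]

theorem dy_dual {q : Quadrant} (h : q.yDual = true) (i : Fin 2) (f : V) :
    dy q i f = ly i * f := by
  rw [dy, if_pos h, LinearMap.mulLeft_apply]

theorem pderiv_inr_lx_pow (i j : Fin 2) (m : ℕ) :
    MvPolynomial.pderiv (Sum.inr i) (lx j ^ m) = 0 := by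
  rw [Derivation.leibniz_pow, pderiv_inr_lx, smul_zero, smul_zero]

theorem pderiv_inl_ly_pow (i j : Fin 2) (n : ℕ) :
    MvPolynomial.pderiv (Sum.inl i) (ly j ^ n) = 0 := by
  rw [Derivation.leibniz_pow, pderiv_inl_ly, smul_zero, smul_zero]

theorem nabla_arrow_A (a b : ℕ) : IsArrow .A (a + 1) (b + 1) .A a b 1 (nabla .A)
    ((a + 1) * (b + 1)) (w11 ⊗ₜ[ℂ] (lx 0 ^ a * ly 0 ^ b)) := by
  refine nabla_arrow (by simp [Quadrant.xDual]) (by simp [Quadrant.yDual]) (by norm_cast)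
    (ne_zero_of_evalMV (unitPt 0 0) w11_ne_zero ?_) ?_
  · simp [evalMV_tmul, eval_lx, eval_ly, unitPt_inl, unitPt_inr]
  · rw [nabla_oneT]
    simp only [w_tmul, TensorProduct.add_tmul, hwVec_eq, dy_nonDual (q := .A) rfl _ _ fun i => pderiv_inr_lx_pow i _ _, dx_nonDual (q := .A) rfl _ _ fun i => pderiv_inl_ly_pow i _ _, map_smul, map_zero, add_zero, zero_add, smul_add, pow_zero, mul_one, one_mul, one_smul, smul_smul]
    ring_nf
    try abel

theorem nabla_arrow_B (a b : ℕ) : IsArrow .B a (b + 1) .B (a + 1) b 1 (nabla .B) (b + 1)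
    (w21 ⊗ₜ[ℂ] (lx 1 ^ (a + 1) * ly 0 ^ b) + w11 ⊗ₜ[ℂ] (lx 0 * lx 1 ^ a * ly 0 ^ b)) := by
  refine nabla_arrow (by simp [Quadrant.xDual]; ring) (by simp [Quadrant.yDual]) (by norm_cast)
    -- With the second letter of the first pair and the first letter of the second pair set to `1`,
    -- and the other two to `0`, the second term vanishes and `w₂₁` remains.
    (ne_zero_of_evalMV (unitPt 1 0) w21_ne_zero ?_) ?_
  · simp [evalMV_tmul, eval_lx, eval_ly, unitPt_inl, unitPt_inr]
  · rw [nabla_oneT]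
    simp only [w_tmul, TensorProduct.add_tmul, hwVec_eq, dy_nonDual (q := .B) rfl _ _ fun i => pderiv_inr_lx_pow i _ _, dx_dual (q := .B) rfl, map_smul, map_zero, add_zero, zero_add, smul_add, pow_zero, mul_one, mul_smul_comm, mul_zero, one_mul, one_smul, smul_smul]
    ring_nf
    try abel

theorem nabla_arrow_C (a b : ℕ) : IsArrow .C a b .C (a + 1) (b + 1) 1 (nabla .C) 1
    (w22 ⊗ₜ[ℂ] (lx 1 ^ (a + 1) * ly 1 ^ (b + 1))
      + w12 ⊗ₜ[ℂ] (lx 0 * lx 1 ^ a * ly 1 ^ (b + 1))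
      + w21 ⊗ₜ[ℂ] (lx 1 ^ (a + 1) * ly 0 * ly 1 ^ b)
      + w11 ⊗ₜ[ℂ] (lx 0 * lx 1 ^ a * ly 0 * ly 1 ^ b)) := by
  refine nabla_arrow (by simp [Quadrant.xDual]; ring) (by simp [Quadrant.yDual]; ring) one_ne_zero
    (ne_zero_of_evalMV (unitPt 1 1) w22_ne_zero ?_) ?_
  · simp [evalMV_tmul, eval_lx, eval_ly, unitPt_inl, unitPt_inr]
  · rw [nabla_oneT]
    simp only [w_tmul, TensorProduct.add_tmul, hwVec_eq, dy_dual (q := .C) rfl, dx_dual (q := .C) rfl, map_smul, map_zero, add_zero, zero_add, smul_add, pow_zero, mul_one, one_mul, one_smul, smul_smul]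
    ring_nf
    try abel

theorem nabla_arrow_D (a b : ℕ) : IsArrow .D (a + 1) b .D a (b + 1) 1 (nabla .D) (a + 1)
    (w12 ⊗ₜ[ℂ] (lx 0 ^ a * ly 1 ^ (b + 1)) + w11 ⊗ₜ[ℂ] (lx 0 ^ a * ly 0 * ly 1 ^ b)) := by
  refine nabla_arrow (by simp [Quadrant.xDual]) (by simp [Quadrant.yDual]; ring) (by norm_cast)
    (ne_zero_of_evalMV (unitPt 0 1) w12_ne_zero ?_) ?_
  · simp [evalMV_tmul, eval_lx, eval_ly, unitPt_inl, unitPt_inr]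
  · rw [nabla_oneT]
    -- The derivations in `x` are applied first, while the other factor is still a pure power
    -- `∂_{y_2}^b` free of `x`.
    simp only [w_tmul, TensorProduct.add_tmul, hwVec_eq, ← dy_dx,
      dx_nonDual (q := .D) rfl _ _ fun i => pderiv_inl_ly_pow i _ _, map_smul, map_zero, add_zero,
      smul_add]
    simp only [dy_dual (q := .D) rfl]
    ring_nf
    try abel

theorem nabla2_arrow_AD (a : ℕ) : IsArrow .A (a + 2) 0 .D a 0 2 (nabla2 .D) ((a + 2) * (a + 1))
    ((w11 * w12) ⊗ₜ[ℂ] (lx 0 ^ a)) := by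
  refine nabla2_arrow (p := .A) (q := .D) rfl rfl rfl (by simp [Quadrant.xDual]) (by norm_cast)
    (ne_zero_of_evalMV (unitPt 0 0) w11_w12_ne_zero ?_) ?_
  · simp [evalMV_tmul, eval_lx, eval_ly, unitPt_inl, unitPt_inr]
  · have h := fun k : ℕ => dx_nonDual (q := .D) rfl k 1 fun _ => Derivation.map_one_eq_zero _
    simp only [mul_one, one_mul] at h
    rw [nabla2_oneT]
    simp only [w_mul_tmul, hwVec_eq, pow_zero, mul_one, one_mul, h (a + 2), h (a + 1), h a, map_smul, map_zero,
      add_zero, smul_smul]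
    push_cast
    ring_nf

theorem nabla2_arrow_BC (a : ℕ) : IsArrow .B a 0 .C (a + 2) 0 2 (nabla2 .C) 1
    ((w21 * w22) ⊗ₜ[ℂ] (lx 1 ^ (a + 2))
      + (w11 * w22 + w21 * w12) ⊗ₜ[ℂ] (lx 0 * lx 1 ^ (a + 1))
      + (w11 * w12) ⊗ₜ[ℂ] (lx 0 ^ 2 * lx 1 ^ a)) := by
  refine nabla2_arrow (p := .B) (q := .C) rfl rfl rfl (by simp [Quadrant.xDual]; ring) one_ne_zero
    (ne_zero_of_evalMV (unitPt 1 1) w21_w22_ne_zero ?_) ?_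
  · simp [evalMV_tmul, eval_lx, eval_ly, unitPt_inl, unitPt_inr]
  · rw [nabla2_oneT]
    simp only [w_mul_tmul, TensorProduct.add_tmul, hwVec_eq, dy_dual (q := .C) rfl, dx_dual (q := .C) rfl, map_smul, map_zero, add_zero, zero_add, smul_add, pow_zero, mul_one, one_mul, one_smul, smul_smul]
    ring_nf
    try abel

theorem nablaT2_arrow_AB (b : ℕ) : IsArrow .A 0 (b + 2) .B 0 b 2 (nablaT2 .B) ((b + 2) * (b + 1))
    ((w11 * w21) ⊗ₜ[ℂ] (ly 0 ^ b)) := by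
  refine nablaT2_arrow (p := .A) (q := .B) rfl rfl rfl (by simp [Quadrant.yDual]) (by norm_cast)
    (ne_zero_of_evalMV (unitPt 0 0) w11_w21_ne_zero ?_) ?_
  · simp [evalMV_tmul, eval_lx, eval_ly, unitPt_inl, unitPt_inr]
  · have h := fun k : ℕ => dy_nonDual (q := .B) rfl k 1 fun _ => Derivation.map_one_eq_zero _
    simp only [mul_one, one_mul] at h
    rw [nablaT2_oneT]
    simp only [w_mul_tmul, hwVec_eq, pow_zero, mul_one, one_mul, h (b + 2), h (b + 1), h b, map_smul, map_zero,
      add_zero, smul_smul]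
    push_cast
    ring_nf

theorem nablaT2_arrow_DC (b : ℕ) : IsArrow .D 0 b .C 0 (b + 2) 2 (nablaT2 .C) 1
    ((w12 * w22) ⊗ₜ[ℂ] (ly 1 ^ (b + 2))
      + (w11 * w22 + w12 * w21) ⊗ₜ[ℂ] (ly 0 * ly 1 ^ (b + 1))
      + (w11 * w21) ⊗ₜ[ℂ] (ly 0 ^ 2 * ly 1 ^ b)) := by
  refine nablaT2_arrow (p := .D) (q := .C) rfl rfl rfl (by simp [Quadrant.yDual]; ring) one_ne_zero
    (ne_zero_of_evalMV (unitPt 1 1) w12_w22_ne_zero ?_) ?_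
  · simp [evalMV_tmul, eval_lx, eval_ly, unitPt_inl, unitPt_inr]
  · rw [nablaT2_oneT]
    simp only [w_mul_tmul, TensorProduct.add_tmul, hwVec_eq, dy_dual (q := .C) rfl, dx_dual (q := .C) rfl, map_smul, map_zero, add_zero, zero_add, smul_add, pow_zero, mul_one, one_mul, one_smul, smul_smul]
    ring_nf
    try abel

theorem nabla3_mem_degSub {f : V} (hf : f ∈ bidegSpace .A 0 1) :
    nabla3 (oneT f) ∈ degSub (bideg .C (-1) 0) 3 := by
  have h : ∀ a b c d e g i k, wL a b (wL c d (wL e g (oneT (dx .C i (dy .A k f))))) ∈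
      degSub (bideg .C (-1) 0) 3 := fun a b c d e g i k =>
    wL_mem_degSub (wL_mem_degSub (wL_mem_degSub (oneT_mem_degSub (dx_dy_mem_bideg hf i k)) _ _) _ _) _ _
  simp only [nabla3_oneT, map_add]
  exact Submodule.add_mem _ (Submodule.add_mem _ (Submodule.add_mem _ (h _ _ _ _ _ _ _ _)
    (h _ _ _ _ _ _ _ _)) (Submodule.add_mem _ (h _ _ _ _ _ _ _ _) (h _ _ _ _ _ _ _ _)))
    (Submodule.add_mem _ (h _ _ _ _ _ _ _ _) (h _ _ _ _ _ _ _ _))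

theorem nabla3_arrow : IsArrow .A 0 1 .C 1 0 3 nabla3 (-1)
    ((w11 * w22 * w21) ⊗ₜ[ℂ] lx 1 - (w21 * w12 * w11) ⊗ₜ[ℂ] lx 0) := by
  have hM : IsMorphism (vertex .A 0 1) (vertex .C 1 0) nabla3 := nabla3_isMorphism
  have hd := nabla3_mem_degSub (hwVec_mem .A 0 1)
  have h1 := (dy_nonDual (q := .A) rfl 0 1 fun _ => Derivation.map_one_eq_zero _).1
  have h2 := (dy_nonDual (q := .A) rfl 1 1 fun _ => Derivation.map_one_eq_zero _).2
  -- The factor `-1` comes from `w₁₁w₂₁w₂₂ = -w₁₁w₂₂w₂₁`, while `w₁₁w₂₁w₁₂ = w₂₁w₁₂w₁₁`.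
  refine isArrow_of hM hd (neg_ne_zero.2 one_ne_zero)
    (ne_zero_of_evalMV (unitPt 1 1) w11_w22_w21_ne_zero ?_) ?_
  · simp [evalMV_tmul, eval_lx, unitPt_inl]
  · have e1 : ∀ f, (w11 * w22 * w21) ⊗ₜ[ℂ] f = wL 0 0 (wL 1 1 (wL 1 0 (oneT f))) :=
      wU_mul_mul_tmul 0 0 1 1 1 0
    have e2 : ∀ f, (w21 * w12 * w11) ⊗ₜ[ℂ] f = wL 1 0 (wL 0 1 (wL 0 0 (oneT f))) :=
      wU_mul_mul_tmul 1 0 0 1 0 0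
    simp only [zero_add, one_mul, mul_one, Nat.cast_zero, one_smul, pow_zero, pow_one] at h1 h2
    simp only [nabla3_oneT, hwVec_eq, pow_zero, pow_one, one_mul, h1, h2, dx_dual (q := .C) rfl,
      mul_one, mul_zero, map_zero, add_zero, e1, e2, map_add, map_neg, wL_order]
    module

theorem nablaT3_mem_degSub {f : V} (hf : f ∈ bidegSpace .A 1 0) :
    nablaT3 (oneT f) ∈ degSub (bideg .C 0 (-1)) 3 := by
  have h : ∀ a b c d e g i k, wL a b (wL c d (wL e g (oneT (dy .C i (dx .A k f))))) ∈
      degSub (bideg .C 0 (-1)) 3 := fun a b c d e g i k =>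
    wL_mem_degSub (wL_mem_degSub (wL_mem_degSub (oneT_mem_degSub (dy_dx_mem_bideg hf i k)) _ _) _ _) _ _
  simp only [nablaT3_oneT, map_add]
  exact Submodule.add_mem _ (Submodule.add_mem _ (Submodule.add_mem _ (h _ _ _ _ _ _ _ _)
    (h _ _ _ _ _ _ _ _)) (Submodule.add_mem _ (h _ _ _ _ _ _ _ _) (h _ _ _ _ _ _ _ _)))
    (Submodule.add_mem _ (h _ _ _ _ _ _ _ _) (h _ _ _ _ _ _ _ _))

theorem nablaT3_arrow : IsArrow .A 1 0 .C 0 1 3 nablaT3 (-1)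
    ((w11 * w22 * w12) ⊗ₜ[ℂ] ly 1 - (w12 * w21 * w11) ⊗ₜ[ℂ] ly 0) := by
  have hM : IsMorphism (vertex .A 1 0) (vertex .C 0 1) nablaT3 := nablaT3_isMorphism
  have hd := nablaT3_mem_degSub (hwVec_mem .A 1 0)
  have h1 := (dx_nonDual (q := .A) rfl 0 1 fun _ => Derivation.map_one_eq_zero _).1
  have h2 := (dx_nonDual (q := .A) rfl 1 1 fun _ => Derivation.map_one_eq_zero _).2
  refine isArrow_of hM hd (neg_ne_zero.2 one_ne_zero)
    (ne_zero_of_evalMV (unitPt 1 1) w11_w22_w12_ne_zero ?_) ?_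
  · simp [evalMV_tmul, eval_ly, unitPt_inr]
  · have e1 : ∀ f, (w11 * w22 * w12) ⊗ₜ[ℂ] f = wL 0 0 (wL 1 1 (wL 0 1 (oneT f))) :=
      wU_mul_mul_tmul 0 0 1 1 0 1
    have e2 : ∀ f, (w12 * w21 * w11) ⊗ₜ[ℂ] f = wL 0 1 (wL 1 0 (wL 0 0 (oneT f))) :=
      wU_mul_mul_tmul 0 1 1 0 0 0
    simp only [zero_add, mul_one, Nat.cast_zero, one_smul, pow_zero, pow_one] at h1 h2
    simp only [nablaT3_oneT, hwVec_eq, pow_zero, pow_one, h1, h2, dy_dual (q := .C) rfl,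
      mul_one, mul_zero, map_zero, add_zero, e1, e2, map_add, map_neg, wL_order]
    module

end KFour

end

/-! ### Assembly of the statement -/

open KFour in
theorem mainTheorem4 :
    -- the Poincaré–Birkhoff–Witt identification `Ind S = U(𝔤_{<0}) ⊗ S`
    (∀ (q : Quadrant) (S : SubRep q), Function.Bijective S.pbw) ∧
    -- degree 1
    ((∀ q : Quadrant,
        nabla q = tm w11 (dx q 0 ∘ₗ dy q 0) + tm w21 (dx q 1 ∘ₗ dy q 0)
          + tm w12 (dx q 0 ∘ₗ dy q 1) + tm w22 (dx q 1 ∘ₗ dy q 1) ∧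
        IsMorphism (whole q) (whole q) (nabla q) ∧
        (∀ m n : ℤ, IsMorphism (bideg q m n) (bideg q (m - 1) (n - 1)) (nabla q)) ∧
        nabla q ∘ₗ nabla q = 0) ∧
      ∀ a b : ℕ,
        IsArrow .A (a + 1) (b + 1) .A a b 1 (nabla .A) ((a + 1) * (b + 1))
          (w11 ⊗ₜ[ℂ] (lx 0 ^ a * ly 0 ^ b)) ∧
        IsArrow .B a (b + 1) .B (a + 1) b 1 (nabla .B) (b + 1)
          (w21 ⊗ₜ[ℂ] (lx 1 ^ (a + 1) * ly 0 ^ b) + w11 ⊗ₜ[ℂ] (lx 0 * lx 1 ^ a * ly 0 ^ b)) ∧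
        IsArrow .C a b .C (a + 1) (b + 1) 1 (nabla .C) 1
          (w22 ⊗ₜ[ℂ] (lx 1 ^ (a + 1) * ly 1 ^ (b + 1))
            + w12 ⊗ₜ[ℂ] (lx 0 * lx 1 ^ a * ly 1 ^ (b + 1))
            + w21 ⊗ₜ[ℂ] (lx 1 ^ (a + 1) * ly 0 * ly 1 ^ b)
            + w11 ⊗ₜ[ℂ] (lx 0 * lx 1 ^ a * ly 0 * ly 1 ^ b)) ∧
        IsArrow .D (a + 1) b .D a (b + 1) 1 (nabla .D) (a + 1)
          (w12 ⊗ₜ[ℂ] (lx 0 ^ a * ly 1 ^ (b + 1)) + w11 ⊗ₜ[ℂ] (lx 0 ^ a * ly 0 * ly 1 ^ b))) ∧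
    -- degree 2, from A to D and from B to C
    ((∀ p q : Quadrant, (p = .A ∧ q = .D) ∨ (p = .B ∧ q = .C) →
        nabla2 q = tm (w11 * w12) (dx q 0 ∘ₗ dx q 0) + tm (w11 * w22) (dx q 0 ∘ₗ dx q 1)
          + tm (w21 * w12) (dx q 0 ∘ₗ dx q 1) + tm (w21 * w22) (dx q 1 ∘ₗ dx q 1) ∧
        IsMorphism (axisX p) (axisX q) (nabla2 q) ∧
        (∀ m : ℤ, IsMorphism (bideg p m 0) (bideg q (m - 2) 0) (nabla2 q)) ∧
        (∀ (m : ℤ) (x : (bideg p m 1).M), nabla2 q (nabla p ((bideg p m 1).incl x)) = 0) ∧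
        (∀ x : (axisX p).M, nabla q (nabla2 q ((axisX p).incl x)) = 0)) ∧
      ∀ a : ℕ,
        IsArrow .A (a + 2) 0 .D a 0 2 (nabla2 .D) ((a + 2) * (a + 1))
          ((w11 * w12) ⊗ₜ[ℂ] (lx 0 ^ a)) ∧
        IsArrow .B a 0 .C (a + 2) 0 2 (nabla2 .C) 1
          ((w21 * w22) ⊗ₜ[ℂ] (lx 1 ^ (a + 2))
            + (w11 * w22 + w21 * w12) ⊗ₜ[ℂ] (lx 0 * lx 1 ^ (a + 1))
            + (w11 * w12) ⊗ₜ[ℂ] (lx 0 ^ 2 * lx 1 ^ a))) ∧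
    -- degree 2, from A to B and from D to C
    ((∀ p q : Quadrant, (p = .A ∧ q = .B) ∨ (p = .D ∧ q = .C) →
        nablaT2 q = tm (w11 * w21) (dy q 0 ∘ₗ dy q 0) + tm (w12 * w21) (dy q 0 ∘ₗ dy q 1)
          + tm (w11 * w22) (dy q 0 ∘ₗ dy q 1) + tm (w12 * w22) (dy q 1 ∘ₗ dy q 1) ∧
        IsMorphism (axisY p) (axisY q) (nablaT2 q) ∧
        (∀ n : ℤ, IsMorphism (bideg p 0 n) (bideg q 0 (n - 2)) (nablaT2 q)) ∧
        (∀ (n : ℤ) (x : (bideg p 1 n).M), nablaT2 q (nabla p ((bideg p 1 n).incl x)) = 0) ∧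
        (∀ x : (axisY p).M, nabla q (nablaT2 q ((axisY p).incl x)) = 0)) ∧
      ∀ b : ℕ,
        IsArrow .A 0 (b + 2) .B 0 b 2 (nablaT2 .B) ((b + 2) * (b + 1))
          ((w11 * w21) ⊗ₜ[ℂ] (ly 0 ^ b)) ∧
        IsArrow .D 0 b .C 0 (b + 2) 2 (nablaT2 .C) 1
          ((w12 * w22) ⊗ₜ[ℂ] (ly 1 ^ (b + 2))
            + (w11 * w22 + w12 * w21) ⊗ₜ[ℂ] (ly 0 * ly 1 ^ (b + 1))
            + (w11 * w21) ⊗ₜ[ℂ] (ly 0 ^ 2 * ly 1 ^ b))) ∧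
    -- degree 3
    (IsArrow .A 0 1 .C 1 0 3 nabla3 (-1)
        ((w11 * w22 * w21) ⊗ₜ[ℂ] lx 1 - (w21 * w12 * w11) ⊗ₜ[ℂ] lx 0) ∧
      (∀ x : (bideg .A 1 2).M, nabla3 (nabla .A ((bideg .A 1 2).incl x)) = 0) ∧
      (∀ x : (bideg .A 0 1).M, nabla .C (nabla3 ((bideg .A 0 1).incl x)) = 0)) ∧
    (IsArrow .A 1 0 .C 0 1 3 nablaT3 (-1)
        ((w11 * w22 * w12) ⊗ₜ[ℂ] ly 1 - (w12 * w21 * w11) ⊗ₜ[ℂ] ly 0) ∧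
      (∀ x : (bideg .A 2 1).M, nablaT3 (nabla .A ((bideg .A 2 1).incl x)) = 0) ∧
      (∀ x : (bideg .A 1 0).M, nabla .C (nablaT3 ((bideg .A 1 0).incl x)) = 0)) := by
  refine ⟨fun q S => S.pbw_bijective, ⟨fun q => ⟨nabla_eq q, ?_, fun m n => ?_, nabla_nabla q⟩,
    fun a b => ⟨nabla_arrow_A a b, nabla_arrow_B a b, nabla_arrow_C a b, nabla_arrow_D a b⟩⟩,
    ⟨?_, fun a => ⟨nabla2_arrow_AD a, nabla2_arrow_BC a⟩⟩,
    ⟨?_, fun b => ⟨nablaT2_arrow_AB b, nablaT2_arrow_DC b⟩⟩,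
    ⟨nabla3_arrow, fun x => LinearMap.congr_fun nabla3_nabla _,
      fun x => LinearMap.congr_fun nabla_nabla3 _⟩,
    ⟨nablaT3_arrow, fun x => LinearMap.congr_fun nablaT3_nabla _,
      fun x => LinearMap.congr_fun nabla_nablaT3 _⟩⟩
  · exact nabla_isMorphism _ _ fun _ _ _ _ => Submodule.mem_top
  · exact nabla_isMorphism _ _ fun f hf i j => dx_mem (dy_mem hf j) i
  · intro p q hpq
    have h : p.xDual = q.xDual ∧ p.yDual = false ∧ q.yDual = true := by
      rcases hpq with ⟨rfl, rfl⟩ | ⟨rfl, rfl⟩ <;> exact ⟨rfl, rfl, rfl⟩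
    refine ⟨nabla2_eq q,
      nabla2_isMorphism h.1 h.2.1 h.2.2 _ _ (fun f hf => eulY_of_mem_axisX hf)
        fun f hf i j => dx_dx_mem_axisX h.1 hf i j,
      fun m => nabla2_isMorphism h.1 h.2.1 h.2.2 _ _ (fun f hf => eulY_of_mem hf)
        fun f hf i j => dx_dx_mem_bideg h.1 hf i j,
      -- The composites are zero as maps on the whole space, hence on the bidegrees and axes of the
      -- statement.
      fun m x => LinearMap.congr_fun (nabla2_nabla h.1) _,
      fun x => LinearMap.congr_fun (nabla_nabla2 q) _⟩
  · intro p q hpq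
    have h : p.yDual = q.yDual ∧ p.xDual = false ∧ q.xDual = true := by
      rcases hpq with ⟨rfl, rfl⟩ | ⟨rfl, rfl⟩ <;> exact ⟨rfl, rfl, rfl⟩
    refine ⟨nablaT2_eq q,
      nablaT2_isMorphism h.1 h.2.1 h.2.2 _ _ (fun f hf => eulX_of_mem_axisY hf)
        fun f hf i j => dy_dy_mem_axisY h.1 hf i j,
      fun m => nablaT2_isMorphism h.1 h.2.1 h.2.2 _ _ (fun f hf => eulX_of_mem hf)
        fun f hf i j => dy_dy_mem_bideg h.1 hf i j,
      fun m x => LinearMap.congr_fun (nablaT2_nabla h.1) _,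
      fun x => LinearMap.congr_fun (nabla_nablaT2 q) _⟩
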